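/- **Setting.** For each $n$ let $P_{n,\theta}$, $\theta\in\mathbb R^s$, be probability measures on a space carrying data $y=y^{(n)}$, let $l(\theta)=l_n(\theta,y)$ be a real criterion function and let $d_i=d_{n,i}>0$ ($1\le i\le s$) with $d_*=\min_i d_i\to\infty$ as $n\to\infty$; put $D=\mathrm{diag}(d_1,\dots,d_s)$. Let $\Theta\subseteq\mathbb R^s$ be the parameter space and $\sigma$ the true parameter, fixed in $n$. $E_\theta$ is the expectation under $P_{n,\theta}$ and $E=E_\sigma$. All derivatives are with respect to the parameter; in functions of $\theta$ such as $A(\theta)$ both the integrand and the expectation are taken at $\theta$. Put $$a=\frac{\partial l}{\partial\sigma},\quad F=\frac{\partial^2 l}{\partial\sigma^2},\quad H_i=\frac{\partial^3 l}{\partial\sigma_i\,\partial\sigma^2},\quad A=E(F),\quad Q=D^{-1}AD^{-1},$$ and let $C$ be the $s\times s$ matrix with $i$th row $a'A^{-1}H_i$. Let $(\lambda_i)=D^{-1}a$, $(\lambda_{jk})=D^{-1/2}(F-A)D^{-1/2}$, $(\lambda_{ijk})_{j,k}=D^{-1}H_iD^{-1}$, and $$U_1=(E\lambda_i\lambda_l),\qquad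 U_2=(E\lambda_{jk}\lambda_l),\qquad U_3=(E\lambda_{jkm}\lambda_l\lambda_n).$$ $|\cdot|$ is the Euclidean norm of a vector, $\|\cdot\|$ the spectral norm of a matrix and the maximum of the absolute values of the entries for arrays with three or more indices. For $\delta>0$ let $S_\delta(\sigma)=\{\tilde\sigma:|\tilde\sigma_i-\sigma_i|\le\delta d_*/d_i,\ 1\le i\le s\}$. "Bounded" means bounded in $n$. Let $\eta=\eta_n$ be real functions of the parameter, $b=\partial\eta/\partial\sigma$, $B=\partial^2\eta/\partial\sigma^2$, and $$\Delta_0=-2b'A^{-1}E(a),\quad \Delta_1=b'A^{-1}E(FA^{-1}a),\quad \Delta_2=\tfrac12E(a'A^{-1}BA^{-1}a),\quad \Delta_3=-\tfrac12 b'A^{-1}E(CA^{-1}a).$$ Fix constants $c_0,\lambda>0$ and a point $\sigma^*\in\Theta$ with $\eta(\sigma^*)=O(d_*^{\lambda})$. For an estimator $\hat\sigma=\hat\sigma(y)$ let $$\hat\eta=\eta(\hat\sigma)-\sum_{j=0}^{3}\Delta_j(\hat\sigma)$$ if the absolute value of the right-hand side is at most $c_0d_*^\lambda$, and $\hat\eta=\eta(\sigma^*)$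 otherwise. **Theorem 4.1.** Suppose that for some $\delta>0$ with $S_\delta(\sigma)\subset\Theta^\circ$ for all $n$: (i) $\eta$ is three times continuously differentiable on $\Theta^\circ$, and $\eta(\sigma)$, $|b(\sigma)|$, $\|B(\sigma)\|$ and $\sup_{\tilde\sigma\in S_\delta(\sigma)}|\partial^3\eta(\tilde\sigma)/\partial\sigma_i\partial\sigma_j\partial\sigma_k|$ are bounded for all $i,j,k$. (ii) $\sigma\in\Theta^\circ$; $l$ is four times continuously differentiable in the parameter on $\Theta^\circ$; $-\infty<\limsup_{n\to\infty}\lambda_{\max}(Q(\sigma))<0$, where $\lambda_{\max}$ is the largest eigenvalue; and for some $g>8+4\lambda$ the $g$th moments (at $\sigma$) of the following are bounded for all $i,j,k$: $$\frac1{d_i}\Big|\frac{\partial l(\sigma)}{\partial\sigma_i}\Big|,\quad \frac1{\sqrt{d_id_j}}\Big|\frac{\partial^2l(\sigma)}{\partial\sigma_i\partial\sigma_j}-E\Big[\frac{\partial^2l(\sigma)}{\partial\sigma_i\partial\sigma_j}\Big]\Big|,\quad \frac{d_*}{d_id_jd_k}\sup_{\tilde\sigma\in S_\delta(\sigma)}\Big|\frac{\partial^3l(\tilde\sigma)}{\partial\sigma_i\partial\sigma_j\partial\sigma_k}\Big|.$$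 (iii) The $g$th moments (at $\sigma$) of the following are bounded for all $i,j,k,m$: $$\frac1{\sqrt{d_jd_k}}\Big|\frac{\partial^3l(\sigma)}{\partial\sigma_i\partial\sigma_j\partial\sigma_k}-E\Big[\frac{\partial^3l(\sigma)}{\partial\sigma_i\partial\sigma_j\partial\sigma_k}\Big]\Big|,\quad \frac1{d_jd_k}\Big|\frac{\partial^3l(\sigma)}{\partial\sigma_i\partial\sigma_j\partial\sigma_k}\Big|,\quad \frac{d_*^2}{d_id_jd_kd_m}\sup_{\tilde\sigma\in S_\delta(\sigma)}\Big|\frac{\partial^4l(\tilde\sigma)}{\partial\sigma_i\partial\sigma_j\partial\sigma_k\partial\sigma_m}\Big|.$$ (iv) For $\tilde\sigma\in S_\delta(\sigma)$ the expectations defining $E(a)$, $A$, $U_1,U_2,U_3$ at $\tilde\sigma$ exist, and $\sup_{\tilde\sigma\in S_{\delta'}(\sigma)}\|Q(\tilde\sigma)-Q(\sigma)\|\to0$ and $\sup_{\tilde\sigma\in S_{\delta'}(\sigma)}\|U_j(\tilde\sigma)-U_j(\sigma)\|\to0$, $j=1,2,3$, as $\delta'\to0$, uniformly in $n$. (v)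 $|E(a)|$ is bounded at $\sigma$, and $\sup_{\tilde\sigma\in S_{\delta'}(\sigma)}|E(a)|_{\sigma=\tilde\sigma}-E(a)|\to0$ as $\delta'\to0$, uniformly in $n$. Then there is an estimator $\hat\sigma$ such that (R) for every $0<\rho<1$ there are a constant $c$ and events $\mathcal B=\mathcal B_n$ with $P_{n,\sigma}(\mathcal B^c)\le c\,d_*^{-\tau g}$, $\tau=\tfrac14\wedge(1-\rho)$, for large $n$, such that for large $n$, on $\mathcal B$, $\hat\sigma\in\Theta$, $\partial l(\hat\sigma)/\partial\sigma=0$ and $|D(\hat\sigma-\sigma)|<d_*^{1-\rho}$; and for every estimator $\hat\sigma$ with property (R), $E(\hat\eta)$ exists and $$E(\hat\eta)=\eta(\sigma)+o(d_*^{-2}).$$ Consequently, if $t(\hat\sigma)=t(\hat\sigma,y)$ is an empirical predictor of a random quantity $\mu$ whose mean squared error $\mathrm{MSE}[t(\hat\sigma)]=E[t(\hat\sigma)-\mu]^2$ is finite and is approximated to second order by $\eta$, that is, $\mathrm{MSE}[t(\hat\sigma)]=\eta(\sigma)+o(d_*^{-2})$, then $\hat\eta$ is a second-order unbiased estimator of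 it: $E(\hat\eta)=\mathrm{MSE}[t(\hat\sigma)]+o(d_*^{-2})$. -/

import Mathlib

open MeasureTheory Filter Topology Asymptotics
open scoped Matrix ENNReal NNReal

universe u v

/-- The space of dispersion parameters `σ = (σ₁, …, σₛ)'`, with the Euclidean norm. -/
abbrev Param (s : ℕ) : Type := EuclideanSpace ℝ (Fin s)

noncomputable section

/-- The partial derivative `∂f/∂σᵢ`. -/
def pderiv {s : ℕ} (i : Fin s) (f : Param s → ℝ) (θ : Param s) : ℝ :=
  fderiv ℝ f θ (EuclideanSpace.single i 1)

/-- The Euclidean length of a vector. -/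
def vecNorm {s : ℕ} (v : Fin s → ℝ) : ℝ := ‖(WithLp.toLp 2 v : Param s)‖

/-- The spectral norm of a matrix: its operator norm for the Euclidean norm. -/
def specNorm {s : ℕ} (B : Matrix (Fin s) (Fin s) ℝ) : ℝ :=
  ‖Matrix.toEuclideanCLM (n := Fin s) (𝕜 := ℝ) B‖

/-- The largest (real) eigenvalue; it is only used for symmetric matrices. -/
def lambdaMax {s : ℕ} (B : Matrix (Fin s) (Fin s) ℝ) : ℝ := sSup (spectrum ℝ B)

/-- The gradient of a function of the parameter, as a vector of partial derivatives. -/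
def gradVec {s : ℕ} (f : Param s → ℝ) (θ : Param s) : Fin s → ℝ := fun i => pderiv i f θ

/-- The matrix of second partial derivatives. -/
def hessMat {s : ℕ} (f : Param s → ℝ) (θ : Param s) : Matrix (Fin s) (Fin s) ℝ :=
  Matrix.of fun i j => pderiv i (pderiv j f) θ

/-- One member (one sample size) of the sequence of statistical experiments: for each parameter
value `θ` a probability `P θ` on a space `Ω` that carries the data `Y` (and possibly more, such as
unobserved random effects), a criterion function `l(θ, y)` and the normalizing
constants `d₁, …, dₛ`. -/
structure Experiment (s : ℕ) where
  Ω : Type u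
  𝒴 : Type v
  [mΩ : MeasurableSpace Ω]
  [m𝒴 : MeasurableSpace 𝒴]
  P : Param s → Measure Ω
  isProb : ∀ θ, IsProbabilityMeasure (P θ)
  Y : Ω → 𝒴
  measurable_Y : Measurable Y
  l : Param s → 𝒴 → ℝ
  d : Fin s → ℝ

attribute [instance] Experiment.mΩ Experiment.m𝒴 Experiment.isProb

namespace Experiment

variable {s : ℕ} (M : Experiment.{u, v} s)

/-- `d_* = min dᵢ`. -/
def dstar : ℝ := ⨅ i, M.d i

/-- `S_δ(σ) = {θ : |θᵢ - σᵢ| ≤ δ d_* / dᵢ for all i}`. -/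
def box (σ : Param s) (δ : ℝ) : Set (Param s) :=
  {θ | ∀ i, |θ i - σ i| ≤ δ * M.dstar / M.d i}

/-- The expectation at `θ` of a function of the data. -/
def expect (θ : Param s) (f : M.𝒴 → ℝ) : ℝ := ∫ ω, f (M.Y ω) ∂(M.P θ)

/-- A function of the data has a finite expectation at `θ`. -/
def HasExpect (θ : Param s) (f : M.𝒴 → ℝ) : Prop := Integrable (fun ω => f (M.Y ω)) (M.P θ)

/-- `a = ∂l/∂σ`, evaluated at `θ`. -/
def a (θ : Param s) (y : M.𝒴) : Fin s → ℝ := gradVec (fun τ => M.l τ y) θ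

/-- `F = ∂²l/∂σ²`, evaluated at `θ`. -/
def F (θ : Param s) (y : M.𝒴) : Matrix (Fin s) (Fin s) ℝ := hessMat (fun τ => M.l τ y) θ

/-- `∂³l/∂σᵢ∂σⱼ∂σₖ`, evaluated at `θ`. -/
def l3 (i j k : Fin s) (θ : Param s) (y : M.𝒴) : ℝ :=
  pderiv i (pderiv j (pderiv k (fun τ => M.l τ y))) θ

/-- `∂⁴l/∂σᵢ∂σⱼ∂σₖ∂σₘ`, evaluated at `θ`. -/
def l4 (i j k m : Fin s) (θ : Param s) (y : M.𝒴) : ℝ :=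
  pderiv i (pderiv j (pderiv k (pderiv m (fun τ => M.l τ y)))) θ

/-- `Hᵢ = ∂³l/∂σᵢ∂σ²`, evaluated at `θ`. -/
def H (i : Fin s) (θ : Param s) (y : M.𝒴) : Matrix (Fin s) (Fin s) ℝ :=
  Matrix.of fun j k => M.l3 i j k θ y

/-- `E(a)`; the expectation is taken at the same `θ` at which `a` is evaluated. -/
def Ea (θ : Param s) : Fin s → ℝ := fun i => M.expect θ fun y => M.a θ y i

/-- `A = E(∂²l/∂σ²)`; the expectation is taken at the same `θ` at which the derivative is. -/
def A (θ : Param s) : Matrix (Fin s) (Fin s) ℝ :=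
  Matrix.of fun i j => M.expect θ fun y => M.F θ y i j

/-- `Q = D⁻¹ A D⁻¹` with `D = diag(d₁, …, dₛ)`. -/
def Q (θ : Param s) : Matrix (Fin s) (Fin s) ℝ :=
  (Matrix.diagonal M.d)⁻¹ * M.A θ * (Matrix.diagonal M.d)⁻¹

/-- `C`, the matrix whose `i`th row is `a' A⁻¹ Hᵢ`. -/
def C (θ : Param s) (y : M.𝒴) : Matrix (Fin s) (Fin s) ℝ :=
  Matrix.of fun i => (M.a θ y ᵥ* (M.A θ)⁻¹) ᵥ* M.H i θ y

/-- `λᵢ`, the entries of `D⁻¹ a`. -/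
def lam1 (i : Fin s) (θ : Param s) (y : M.𝒴) : ℝ := M.a θ y i / M.d i

/-- `λⱼₖ`, the entries of `D^{-1/2} (F - A) D^{-1/2}`. -/
def lam2 (j k : Fin s) (θ : Param s) (y : M.𝒴) : ℝ :=
  (M.F θ y j k - M.A θ j k) / (√(M.d j) * √(M.d k))

/-- `λᵢⱼₖ`, the entries of `D⁻¹ Hᵢ D⁻¹`. -/
def lam3 (i j k : Fin s) (θ : Param s) (y : M.𝒴) : ℝ :=
  M.H i θ y j k / (M.d j * M.d k)

/-- `U₁ = (E(λᵢ λₗ))`. -/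
def U1 (θ : Param s) : Matrix (Fin s) (Fin s) ℝ :=
  Matrix.of fun i l => M.expect θ fun y => M.lam1 i θ y * M.lam1 l θ y

/-- `U₂ = (E(λⱼₖ λₗ))`; the norm on this type is the maximum of the absolute values. -/
def U2 (θ : Param s) : Fin s → Fin s → Fin s → ℝ :=
  fun j k l => M.expect θ fun y => M.lam2 j k θ y * M.lam1 l θ y

/-- `U₃ = (E(λⱼₖₘ λₗ λₙ))`; the norm on this type is the maximum of the absolute values. -/
def U3 (θ : Param s) : Fin s → Fin s → Fin s → Fin s → Fin s → ℝ :=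
  fun j k l m n => M.expect θ fun y => M.lam3 j k m θ y * M.lam1 l θ y * M.lam1 n θ y

/-- All the expectations that define `E(a)`, `A`, `U₁`, `U₂`, `U₃` at `θ` exist. -/
def ExpectationsExist (θ : Param s) : Prop :=
  (∀ i, M.HasExpect θ fun y => M.a θ y i) ∧
  (∀ i j, M.HasExpect θ fun y => M.F θ y i j) ∧
  (∀ i l, M.HasExpect θ fun y => M.lam1 i θ y * M.lam1 l θ y) ∧
  (∀ j k l, M.HasExpect θ fun y => M.lam2 j k θ y * M.lam1 l θ y) ∧
  (∀ j k l m n, M.HasExpect θ fun y => M.lam3 j k m θ y * M.lam1 l θ y * M.lam1 n θ y)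

/-- `Δ₀ = -2 b' A⁻¹ E(a)`, where `b = ∂η/∂σ`. -/
def Delta0 (η : Param s → ℝ) (θ : Param s) : ℝ :=
  -2 * (gradVec η θ ⬝ᵥ ((M.A θ)⁻¹ *ᵥ M.Ea θ))

/-- `Δ₁ = b' A⁻¹ E(F A⁻¹ a)`. -/
def Delta1 (η : Param s → ℝ) (θ : Param s) : ℝ :=
  gradVec η θ ⬝ᵥ ((M.A θ)⁻¹ *ᵥ
    fun i => M.expect θ fun y => (M.F θ y *ᵥ ((M.A θ)⁻¹ *ᵥ M.a θ y)) i)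

/-- `Δ₂ = (1/2) E(a' A⁻¹ B A⁻¹ a)`, where `B = ∂²η/∂σ²`. -/
def Delta2 (η : Param s → ℝ) (θ : Param s) : ℝ :=
  (1 / 2) * M.expect θ fun y =>
    M.a θ y ⬝ᵥ (((M.A θ)⁻¹ * hessMat η θ * (M.A θ)⁻¹) *ᵥ M.a θ y)

/-- `Δ₃ = -(1/2) b' A⁻¹ E(C A⁻¹ a)`. -/
def Delta3 (η : Param s → ℝ) (θ : Param s) : ℝ :=
  -(1 / 2) * (gradVec η θ ⬝ᵥ ((M.A θ)⁻¹ *ᵥ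
    fun i => M.expect θ fun y => (M.C θ y *ᵥ ((M.A θ)⁻¹ *ᵥ M.a θ y)) i))

/-- `η(θ) - ∑_{j=0}^3 Δⱼ(θ)`. -/
def corrected (η : Param s → ℝ) (θ : Param s) : ℝ :=
  η θ - (M.Delta0 η θ + M.Delta1 η θ + M.Delta2 η θ + M.Delta3 η θ)

open Classical in
/-- The truncated estimator: `η(σ̂) - ∑ Δⱼ(σ̂)` if its absolute value is at most `c₀ d_*^κ`,
and `η(σ*)` otherwise. -/
def etaHat (η : Param s → ℝ) (c₀ κ : ℝ) (σstar : Param s) (σhat : M.𝒴 → Param s) (y : M.𝒴) : ℝ :=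
  if |M.corrected η (σhat y)| ≤ c₀ * M.dstar ^ κ then M.corrected η (σhat y) else η σstar

/-- The mean squared error at `σ` of the predictor `t` (a function of the data) of the
random quantity `μ`. -/
def mse (σ : Param s) (t : M.𝒴 → ℝ) (μ : M.Ω → ℝ) : ℝ :=
  ∫ ω, (t (M.Y ω) - μ ω) ^ 2 ∂(M.P σ)

/-- `sup_{θ ∈ S_δ(σ)} |f θ|` -/
def supBox (σ : Param s) (δ : ℝ) (f : Param s → ℝ) : ℝ≥0∞ :=
  ⨆ θ ∈ M.box σ δ, ENNReal.ofReal |f θ|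

end Experiment

open Experiment

/-- The `g`th moments, at the true `σ`, of the nonnegative variables `f n` are bounded in `n`. -/
def MomentsBounded {s : ℕ} (M : ℕ → Experiment.{u, v} s) (σ : Param s) (g : ℝ)
    (f : ∀ n, (M n).𝒴 → ℝ≥0∞) : Prop :=
  ∃ K : ℝ≥0, ∀ n, ∫⁻ ω, (f n ((M n).Y ω)) ^ g ∂((M n).P σ) ≤ K

/-- `sup_{θ ∈ S_δ(σ)} f n θ → 0` as `δ → 0`, uniformly in `n` (for nonnegative `f`). -/
def VanishesUniformly {s : ℕ} (M : ℕ → Experiment.{u, v} s) (σ : Param s)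
    (f : ℕ → Param s → ℝ) : Prop :=
  ∀ ε > 0, ∃ δ > 0, ∀ n, ∀ θ ∈ (M n).box σ δ, f n θ ≤ ε

/-- `σhat` is a consistent solution of the score equation `∂l/∂σ = 0`: for every `0 < ρ < 1` there
are events `ℬ n` with `P(ℬ nᶜ) ≤ c d_*^{-τ g}`, `τ = (1/4) ∧ (1 - ρ)`, such that for large `n`, on
`ℬ n`, `σhat ∈ Θ`, `∂l(σhat)/∂σ = 0` and `|D(σhat - σ)| < d_*^{1-ρ}`. -/
def IsScoreRoot {s : ℕ} (M : ℕ → Experiment.{u, v} s) (Θ : Set (Param s)) (σ : Param s) (g : ℝ)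
    (σhat : ∀ n, (M n).𝒴 → Param s) : Prop :=
  (∀ n, Measurable (σhat n)) ∧
  ∀ ρ : ℝ, 0 < ρ → ρ < 1 → ∃ (ℬ : ∀ n, Set (M n).Ω) (c : ℝ),
    ∀ᶠ n in atTop,
      (∀ ω ∈ ℬ n,
        σhat n ((M n).Y ω) ∈ Θ ∧
        (M n).a (σhat n ((M n).Y ω)) ((M n).Y ω) = 0 ∧
        vecNorm (fun i => (M n).d i * (σhat n ((M n).Y ω) i - σ i)) < (M n).dstar ^ (1 - ρ)) ∧
      (M n).P σ (ℬ n)ᶜ ≤ ENNReal.ofReal (c * (M n).dstar ^ (-(min (1 / 4) (1 - ρ) * g)))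

end

section Calculus

variable {s : ℕ} {U : Set (Param s)} {f : Param s → ℝ}

theorem contDiffOn_pderiv {m n : WithTop ℕ∞} (hU : IsOpen U) (hf : ContDiffOn ℝ n f U)
    (h : m + 1 ≤ n) (i : Fin s) : ContDiffOn ℝ m (pderiv i f) U :=
  (hf.fderiv_of_isOpen hU h).clm_apply contDiffOn_const

theorem sum_smul_single_eq (v : Param s) : ∑ i, v i • (EuclideanSpace.single i (1 : ℝ)) = v := by
  have := (EuclideanSpace.basisFun (Fin s) ℝ).sum_repr v
  simpa using this

theorem fderiv_apply_eq_sum_pderiv (f : Param s → ℝ) (x v : Param s) :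
    fderiv ℝ f x v = ∑ i, v i * pderiv i f x := by
  conv_lhs => rw [← sum_smul_single_eq v]
  simp [pderiv]

theorem hasDerivAt_comp_line (hU : IsOpen U) (hf : DifferentiableOn ℝ f U) (x v : Param s)
    {t : ℝ} (ht : x + t • v ∈ U) :
    HasDerivAt (fun r : ℝ => f (x + r • v)) (∑ i, v i * pderiv i f (x + t • v)) t := by
  rw [← fderiv_apply_eq_sum_pderiv]
  have h1 : HasFDerivAt f (fderiv ℝ f (x + t • v)) (x + t • v) :=
    (hf.differentiableAt (hU.mem_nhds ht)).hasFDerivAt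
  have h2 : HasDerivAt (fun r : ℝ => x + r • v) v t := by
    simpa using ((hasDerivAt_id t).smul_const v).const_add x
  exact h1.comp_hasDerivAt t h2

theorem hasDerivAt_dirDeriv_line (hU : IsOpen U) (hf : ContDiffOn ℝ 2 f U) (x v : Param s)
    {t : ℝ} (ht : x + t • v ∈ U) :
    HasDerivAt (fun r : ℝ => ∑ i, v i * pderiv i f (x + r • v))
      (∑ i, v i * ∑ j, v j * pderiv j (pderiv i f) (x + t • v)) t := by
  refine HasDerivAt.fun_sum fun i _ => HasDerivAt.const_mul _ ?_
  exact hasDerivAt_comp_line hU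
    ((contDiffOn_pderiv hU hf (m := 1) (by norm_num) i).differentiableOn (by norm_num)) x v ht

theorem hasDerivAt_dirDeriv₂_line (hU : IsOpen U) (hf : ContDiffOn ℝ 3 f U) (x v : Param s)
    {t : ℝ} (ht : x + t • v ∈ U) :
    HasDerivAt (fun r : ℝ => ∑ i, v i * ∑ j, v j * pderiv j (pderiv i f) (x + r • v))
      (∑ i, v i * ∑ j, v j * ∑ k, v k * pderiv k (pderiv j (pderiv i f)) (x + t • v)) t := by
  refine HasDerivAt.fun_sum fun i _ => HasDerivAt.const_mul _ ?_
  exact hasDerivAt_dirDeriv_line hU (contDiffOn_pderiv hU hf (m := 2) (by norm_num) i) x v ht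

theorem abs_sub_le_of_hasDerivAt_le {φ φ' : ℝ → ℝ} {C : ℝ}
    (h : ∀ t ∈ Set.Icc (0 : ℝ) 1, HasDerivAt φ (φ' t) t)
    (hC : ∀ t ∈ Set.Icc (0 : ℝ) 1, |φ' t| ≤ C) {t : ℝ} (ht : t ∈ Set.Icc (0 : ℝ) 1) :
    |φ t - φ 0| ≤ C := by
  have hC0 : 0 ≤ C := (abs_nonneg _).trans (hC 0 (by simp))
  have := norm_image_sub_le_of_norm_deriv_le_segment' (f := φ) (f' := φ') (a := 0) (b := 1)
    (C := C) (fun x hx => (h x hx).hasDerivWithinAt)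
    (fun x hx => hC x ⟨hx.1, hx.2.le⟩) t ht
  rw [Real.norm_eq_abs] at this
  have h2 : C * (t - 0) ≤ C := by nlinarith [ht.1, ht.2]
  linarith

theorem taylor_one_abs_le (hU : IsOpen U) (hf : DifferentiableOn ℝ f U) (x v : Param s)
    (hseg : ∀ t ∈ Set.Icc (0 : ℝ) 1, x + t • v ∈ U) {C : ℝ}
    (hC : ∀ t ∈ Set.Icc (0 : ℝ) 1, |∑ i, v i * pderiv i f (x + t • v)| ≤ C) :
    |f (x + v) - f x| ≤ C := by
  have := abs_sub_le_of_hasDerivAt_le (φ := fun r : ℝ => f (x + r • v))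
    (fun t ht => hasDerivAt_comp_line hU hf x v (hseg t ht)) hC (t := 1) (by simp)
  simpa using this

/-- Third-order Taylor expansion along a segment. -/
theorem taylor_three_abs_le (hU : IsOpen U) (hf : ContDiffOn ℝ 3 f U) (x v : Param s)
    (hseg : ∀ t ∈ Set.Icc (0 : ℝ) 1, x + t • v ∈ U) {C : ℝ}
    (hC : ∀ t ∈ Set.Icc (0 : ℝ) 1,
      |∑ i, v i * ∑ j, v j * ∑ k, v k * pderiv k (pderiv j (pderiv i f)) (x + t • v)| ≤ C) :
    |f (x + v) - f x - ∑ i, v i * pderiv i f x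
      - 1 / 2 * ∑ i, v i * ∑ j, v j * pderiv j (pderiv i f) x| ≤ C := by
  set φ₀ := fun r : ℝ => f (x + r • v)
  set φ₁ := fun r : ℝ => ∑ i, v i * pderiv i f (x + r • v) with hφ₁
  set φ₂ := fun r : ℝ => ∑ i, v i * ∑ j, v j * pderiv j (pderiv i f) (x + r • v) with hφ₂
  have d0 : ∀ t ∈ Set.Icc (0 : ℝ) 1, HasDerivAt φ₀ (φ₁ t) t := fun t ht =>
    hasDerivAt_comp_line hU (hf.differentiableOn (by norm_num)) x v (hseg t ht)
  have d1 : ∀ t ∈ Set.Icc (0 : ℝ) 1, HasDerivAt φ₁ (φ₂ t) t := fun t ht =>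
    hasDerivAt_dirDeriv_line hU (hf.of_le (by norm_num)) x v (hseg t ht)
  have b2 : ∀ t ∈ Set.Icc (0 : ℝ) 1, |φ₂ t - φ₂ 0| ≤ C := fun t ht =>
    abs_sub_le_of_hasDerivAt_le (fun t ht => hasDerivAt_dirDeriv₂_line hU hf x v (hseg t ht)) hC ht
  have b1 : ∀ t ∈ Set.Icc (0 : ℝ) 1, |φ₁ t - φ₁ 0 - t * φ₂ 0| ≤ C := fun t ht => by
    have := abs_sub_le_of_hasDerivAt_le (φ := fun r => φ₁ r - r * φ₂ 0)
      (φ' := fun r => φ₂ r - 1 * φ₂ 0) (C := C)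
      (fun r hr => (d1 r hr).sub ((hasDerivAt_id r).mul_const _))
      (fun r hr => by simpa using b2 r hr) ht
    convert this using 2; ring
  have b0 := abs_sub_le_of_hasDerivAt_le (φ := fun r => φ₀ r - r * φ₁ 0 - 1 / 2 * r ^ 2 * φ₂ 0)
      (φ' := fun r => φ₁ r - 1 * φ₁ 0 - r * φ₂ 0) (C := C)
      (fun r hr => by
        have h2 : HasDerivAt (fun r : ℝ => 1 / 2 * r ^ 2 * φ₂ 0) (r * φ₂ 0) r := by
          have := (((hasDerivAt_id r).pow 2).const_mul (1 / 2 : ℝ)).mul_const (φ₂ 0)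
          exact this.congr_deriv (by simp)
        exact ((d0 r hr).sub ((hasDerivAt_id r).mul_const _)).sub h2)
      (fun r hr => by simpa using b1 r hr) (t := 1) (by simp)
  have e1 : φ₁ 0 = ∑ i, v i * pderiv i f x := by simp [hφ₁]
  have e2 : φ₂ 0 = ∑ i, v i * ∑ j, v j * pderiv j (pderiv i f) x := by simp [hφ₂]
  rw [← e1, ← e2]
  convert b0 using 2
  simp [φ₀]; ring

/-- Upper quadratic bound along a segment on which the second derivative is at most `-m`. -/
theorem le_of_dirDeriv₂_le (hU : IsOpen U) (hf : ContDiffOn ℝ 2 f U) (x v : Param s)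
    (hseg : ∀ t ∈ Set.Icc (0 : ℝ) 1, x + t • v ∈ U) {m : ℝ}
    (hm : ∀ t ∈ Set.Icc (0 : ℝ) 1,
      ∑ i, v i * ∑ j, v j * pderiv j (pderiv i f) (x + t • v) ≤ -m) :
    f (x + v) ≤ f x + ∑ i, v i * pderiv i f x - m / 2 := by
  set φ₀ := fun r : ℝ => f (x + r • v) with hφ₀
  set φ₁ := fun r : ℝ => ∑ i, v i * pderiv i f (x + r • v) with hφ₁
  have d0 : ∀ t ∈ Set.Icc (0 : ℝ) 1, HasDerivAt φ₀ (φ₁ t) t := fun t ht =>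
    hasDerivAt_comp_line hU (hf.differentiableOn (by norm_num)) x v (hseg t ht)
  have d1 := fun t (ht : t ∈ Set.Icc (0 : ℝ) 1) =>
    hasDerivAt_dirDeriv_line hU hf x v (hseg t ht)
  have a1 : AntitoneOn (fun r => φ₁ r + m * r) (Set.Icc 0 1) := by
    have dd := fun t (ht : t ∈ Set.Icc (0 : ℝ) 1) =>
      (d1 t ht).add ((hasDerivAt_id t).const_mul m)
    refine antitoneOn_of_hasDerivWithinAt_nonpos (convex_Icc 0 1)
      (fun t ht => (dd t ht).continuousAt.continuousWithinAt)
      (fun t ht => (dd t (interior_subset ht)).hasDerivWithinAt) fun t ht => ?_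
    have := hm t (interior_subset ht)
    simp only [mul_one]; linarith
  have a0 : AntitoneOn (fun r => φ₀ r - φ₁ 0 * r + m / 2 * r ^ 2) (Set.Icc 0 1) := by
    have dd : ∀ t ∈ Set.Icc (0 : ℝ) 1,
        HasDerivAt (fun r => φ₀ r - φ₁ 0 * r + m / 2 * r ^ 2) (φ₁ t - φ₁ 0 + m * t) t := by
      intro t ht
      have := ((d0 t ht).sub ((hasDerivAt_id t).const_mul (φ₁ 0))).add
        (((hasDerivAt_id t).pow 2).const_mul (m / 2))
      exact this.congr_deriv (by simp; ring)
    refine antitoneOn_of_hasDerivWithinAt_nonpos (convex_Icc 0 1)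
      (fun t ht => (dd t ht).continuousAt.continuousWithinAt)
      (fun t ht => (dd t (interior_subset ht)).hasDerivWithinAt) fun t ht => ?_
    have ht' := interior_subset ht
    have := a1 (by simp) ht' ht'.1
    simp only [mul_zero, add_zero] at this
    linarith
  have := a0 (a := 0) (b := 1) (by simp) (by simp) zero_le_one
  have e0 : φ₀ 0 = f x := by simp [hφ₀]
  have e0' : φ₀ 1 = f (x + v) := by simp [hφ₀]
  have e1 : φ₁ 0 = ∑ i, v i * pderiv i f x := by simp [hφ₁]
  simp only [e0, e0', e1] at this
  linarith

theorem pderiv_congr_of_eqOn (hU : IsOpen U) {g : Param s → ℝ} (h : Set.EqOn f g U) (i : Fin s)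
    {x : Param s} (hx : x ∈ U) : pderiv i f x = pderiv i g x := by
  unfold pderiv
  rw [(h.eventuallyEq_of_mem (hU.mem_nhds hx)).fderiv_eq]

theorem pderiv_comm (hU : IsOpen U) (hf : ContDiffOn ℝ 2 f U) (i j : Fin s) {x : Param s}
    (hx : x ∈ U) : pderiv i (pderiv j f) x = pderiv j (pderiv i f) x := by
  have hd : DifferentiableAt ℝ (fderiv ℝ f) x :=
    ((hf.fderiv_of_isOpen hU (m := 1) (by norm_num)).differentiableOn
      (by norm_num)).differentiableAt (hU.mem_nhds hx)
  have key : ∀ i j : Fin s, pderiv i (pderiv j f) x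
      = fderiv ℝ (fderiv ℝ f) x (EuclideanSpace.single i 1) (EuclideanSpace.single j 1) := by
    intro i j
    have : pderiv j f = fun y => fderiv ℝ f y (EuclideanSpace.single j 1) := rfl
    rw [this, pderiv, fderiv_clm_apply hd (by fun_prop)]
    simp
  rw [key, key]
  exact (hf.contDiffAt (hU.mem_nhds hx)).isSymmSndFDerivAt (by simp) _ _

theorem pderiv₃_reverse (hU : IsOpen U) (hf : ContDiffOn ℝ 3 f U) (i j k : Fin s) {x : Param s}
    (hx : x ∈ U) :
    pderiv k (pderiv j (pderiv i f)) x = pderiv i (pderiv j (pderiv k f)) x := by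
  have h2 : ContDiffOn ℝ 2 f U := hf.of_le (by norm_num)
  have hp := fun i => contDiffOn_pderiv hU hf (m := 2) (by norm_num) i
  rw [pderiv_congr_of_eqOn hU (fun y hy => pderiv_comm hU h2 j i hy) k hx,
    pderiv_comm hU (hp j) k i hx,
    pderiv_congr_of_eqOn hU (fun y hy => pderiv_comm hU h2 k j hy) i hx]

theorem measurable_pderiv {𝒴 : Type*} [MeasurableSpace 𝒴] {F : Param s → 𝒴 → ℝ} (hU : IsOpen U)
    (hm : ∀ θ ∈ U, Measurable (F θ)) (hd : ∀ y, DifferentiableOn ℝ (fun θ => F θ y) U)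
    (i : Fin s) {x : Param s} (hx : x ∈ U) :
    Measurable fun y => pderiv i (fun θ => F θ y) x := by
  set v : Param s := EuclideanSpace.single i 1
  have hc : Tendsto (fun n : ℕ => x + ((n : ℝ) + 1)⁻¹ • v) atTop (𝓝 x) := by
    have h0 : Tendsto (fun n : ℕ => ((n : ℝ) + 1)⁻¹) atTop (𝓝 0) := by
      simpa [one_div] using tendsto_one_div_add_atTop_nhds_zero_nat (𝕜 := ℝ)
    simpa using (h0.smul_const v).const_add x
  obtain ⟨N, hN⟩ := eventually_atTop.1 (hc.eventually (hU.mem_nhds hx))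
  refine measurable_of_tendsto_metrizable
    (f := fun n y => ((n + N : ℕ) + 1 : ℝ) *
      (F (x + (((n + N : ℕ) : ℝ) + 1)⁻¹ • v) y - F x y)) (fun n => ?_) ?_
  · exact ((hm _ (hN _ (by omega))).sub (hm _ hx)).const_mul _
  · rw [tendsto_pi_nhds]
    intro y
    have hcinf : Tendsto (fun n : ℕ => ‖(((n + N : ℕ) : ℝ) + 1)‖) atTop atTop := by
      refine tendsto_norm_atTop_atTop.comp (tendsto_atTop_add_const_right _ _ ?_)
      exact tendsto_natCast_atTop_atTop.comp (tendsto_add_atTop_nat N)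
    exact ((hd y).differentiableAt (hU.mem_nhds hx)).hasFDerivAt.lim v hcinf

end Calculus

section Selection

variable {s : ℕ}

theorem measurable_iSup_of_continuousOn {𝒴 : Type*} [MeasurableSpace 𝒴] {K : Set (Param s)}
    {F : Param s → 𝒴 → ℝ} (hm : ∀ θ ∈ K, Measurable (F θ))
    (hc : ∀ y, ContinuousOn (fun θ => F θ y) K) :
    Measurable fun y => ⨆ θ ∈ K, ENNReal.ofReal |F θ y| := by
  obtain ⟨t, htc, htd⟩ := TopologicalSpace.exists_countable_dense K
  have key : (fun y => ⨆ θ ∈ K, ENNReal.ofReal |F θ y|)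
      = fun y => ⨆ θ ∈ t, ENNReal.ofReal |F (θ : Param s) y| := by
    funext y
    apply le_antisymm
    · refine iSup₂_le fun θ hθ => ?_
      have hcont : Continuous fun θ : K => ENNReal.ofReal |F (θ : Param s) y| :=
        ENNReal.continuous_ofReal.comp (continuousOn_iff_continuous_domRestrict.1 (hc y)).abs
      have hcl := isClosed_le hcont
        (continuous_const (y := ⨆ θ ∈ t, ENNReal.ofReal |F (θ : Param s) y|))
      have := (hcl.closure_subset_iff (s := t)).2 fun q hq =>
        le_iSup₂ (f := fun (θ : K) (_ : θ ∈ t) => ENNReal.ofReal |F (θ : Param s) y|) q hq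
      exact this (htd ⟨θ, hθ⟩)
    · exact iSup₂_le fun θ _ =>
        le_iSup₂ (f := fun (θ : Param s) (_ : θ ∈ K) => ENNReal.ofReal |F θ y|) θ.1 θ.2
  rw [key]
  exact Measurable.biSup t htc fun θ _ => (measurable_norm.comp (hm θ.1 θ.2)).ennreal_ofReal

/-- A measurable choice of the maximizer over a compact set, wherever that maximizer is unique. -/
theorem exists_measurable_unique_maximizer {𝒴 : Type*} [MeasurableSpace 𝒴] {K : Set (Param s)}
    (hK : IsCompact K) (hne : K.Nonempty) {F : Param s → 𝒴 → ℝ} (hm : ∀ θ ∈ K, Measurable (F θ))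
    (hc : ∀ y, ContinuousOn (fun θ => F θ y) K) :
    ∃ τ : 𝒴 → Param s, Measurable τ ∧ ∀ y, ∀ θ ∈ K,
      (∀ θ' ∈ K, F θ' y ≤ F θ y) → (∀ θ' ∈ K, F θ y ≤ F θ' y → θ' = θ) → τ y = θ := by
  classical
  have : Nonempty K := hne.to_subtype
  set q : ℕ → K := TopologicalSpace.denseSeq K
  have hbdd : ∀ y, BddAbove (Set.range fun k => F (q k) y) := fun y => by
    obtain ⟨B, hB⟩ := (hK.image_of_continuousOn (hc y)).bddAbove
    exact ⟨B, by rintro _ ⟨k, rfl⟩; exact hB ⟨_, (q k).2, rfl⟩⟩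
  set S : 𝒴 → ℝ := fun y => ⨆ k, F (q k) y
  have hS : Measurable S := Measurable.iSup fun k => hm _ (q k).2
  have hex : ∀ m : ℕ, ∀ y, ∃ k, S y - 1 / ((m : ℝ) + 1) < F (q k) y := fun m y =>
    exists_lt_of_lt_ciSup (sub_lt_self _ (by positivity))
  have hfind : ∀ m : ℕ, Measurable fun y => Nat.find (hex m y) := fun m =>
    measurable_find (hex m) fun k => measurableSet_lt (hS.sub_const _) (hm _ (q k).2)
  set τ' : ℕ → 𝒴 → Param s := fun m y => q (Nat.find (hex m y))
  have hτ' : ∀ m, Measurable (τ' m) := fun m =>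
    (measurable_from_nat (f := fun k => (q k : Param s))).comp (hfind m)
  refine ⟨fun y => limUnder atTop fun m => τ' m y, ?_, fun y θ hθ hmax huniq => ?_⟩
  · exact (StronglyMeasurable.limUnder (f := τ') (l := atTop)
      fun m => (hτ' m).stronglyMeasurable).measurable
  · refine Tendsto.limUnder_eq ?_
    refine hK.tendsto_nhds_of_unique_mapClusterPt
      (Eventually.of_forall fun m => (q _).2) fun z hz hcl => huniq z hz ?_
    have hSθ : F θ y ≤ S y := by
      have hcont : Continuous fun θ : K => F (θ : Param s) y :=
        continuousOn_iff_continuous_domRestrict.1 (hc y)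
      have hcl := isClosed_le hcont (continuous_const (y := S y))
      have := (hcl.closure_subset_iff (s := Set.range q)).2 (by
        rintro _ ⟨k, rfl⟩; exact le_ciSup (hbdd y) k)
      exact this (TopologicalSpace.denseRange_denseSeq K ⟨θ, hθ⟩)
    by_contra! hlt
    obtain ⟨r, hr1, hr2⟩ := exists_between hlt
    have hnear : ∀ᶠ x in 𝓝[K] z, F x y < r := (hc y z hz).eventually (gt_mem_nhds hr1)
    obtain ⟨V, hV, hVK⟩ := mem_nhdsWithin_iff_exists_mem_nhds_inter.1 hnear
    have hfreq := hcl.frequently hV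
    have hev : ∀ᶠ m : ℕ in atTop, r < S y - 1 / ((m : ℝ) + 1) := by
      have h0 := (tendsto_one_div_add_atTop_nhds_zero_nat (𝕜 := ℝ)).const_sub (S y)
      rw [sub_zero] at h0
      exact h0.eventually (lt_mem_nhds (hr2.trans_le hSθ))
    obtain ⟨m, hm1, hm2⟩ := (hfreq.and_eventually hev).exists
    have h1 : F (τ' m y) y < r := hVK ⟨hm1, (q _).2⟩
    have h2 := Nat.find_spec (hex m y)
    exact absurd (h2.trans (h1.trans hm2)) (lt_irrefl _)

end Selection

section LinearAlgebra

variable {s : ℕ}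

theorem abs_apply_le_vecNorm (v : Fin s → ℝ) (i : Fin s) : |v i| ≤ vecNorm v := by
  have := PiLp.norm_apply_le (WithLp.toLp 2 v : Param s) i
  simpa [vecNorm] using this

theorem vecNorm_le_sum_abs (v : Fin s → ℝ) : vecNorm v ≤ ∑ i, |v i| := by
  unfold vecNorm
  rw [EuclideanSpace.norm_eq]
  refine Real.sqrt_le_iff.2 ⟨Finset.sum_nonneg fun i _ => abs_nonneg _, ?_⟩
  simp only [Real.norm_eq_abs]
  exact Finset.sum_sq_le_sq_sum_of_nonneg fun i _ => abs_nonneg _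

theorem abs_apply_le_specNorm (B : Matrix (Fin s) (Fin s) ℝ) (i j : Fin s) :
    |B i j| ≤ specNorm B := by
  set T := Matrix.toEuclideanCLM (n := Fin s) (𝕜 := ℝ) B
  have h1 : T (EuclideanSpace.single j 1) i = B i j := by
    simp [T]
  have h2 := PiLp.norm_apply_le (T (EuclideanSpace.single j 1)) i
  have h3 := T.le_opNorm (EuclideanSpace.single j 1)
  rw [h1, Real.norm_eq_abs] at h2
  simp only [PiLp.norm_single, norm_one, mul_one] at h3
  exact h2.trans h3

/-- The quadratic form of `B` is at most `-m` times the squared Euclidean norm. -/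
def IsNegDefBy (m : ℝ) (B : Matrix (Fin s) (Fin s) ℝ) : Prop :=
  ∀ x : Fin s → ℝ, x ⬝ᵥ (B *ᵥ x) ≤ -m * ∑ i, x i ^ 2

theorem isNegDefBy_of_lambdaMax_le {B : Matrix (Fin s) (Fin s) ℝ} (hB : B.IsSymm) {m : ℝ}
    (h : lambdaMax B ≤ -m) : IsNegDefBy m B := by
  have hH : B.IsHermitian := by
    rw [Matrix.IsHermitian, Matrix.conjTranspose_eq_transpose_of_trivial]; exact hB
  have hle : ∀ r ∈ spectrum ℝ B, r ≤ -m := fun r hr =>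
    (le_csSup (Matrix.finite_real_spectrum.bddAbove) hr).trans h
  have hH' : (algebraMap ℝ (Matrix (Fin s) (Fin s) ℝ) (-m) - B).IsHermitian := by
    refine Matrix.IsHermitian.sub ?_ hH
    rw [Matrix.IsHermitian, Matrix.algebraMap_eq_diagonal, Matrix.diagonal_conjTranspose]
    simp
  have hpos : (algebraMap ℝ (Matrix (Fin s) (Fin s) ℝ) (-m) - B).PosSemidef := by
    rw [hH'.posSemidef_iff_eigenvalues_nonneg]
    intro i
    have := hH'.eigenvalues_mem_spectrum_real i
    rw [← spectrum.singleton_sub_eq] at this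
    obtain ⟨_, rfl, r, hr, he⟩ := this
    have := hle r hr
    simp only [Pi.zero_apply]
    rw [← he]; simp only; linarith
  intro x
  have := hpos.dotProduct_mulVec_nonneg x
  simp only [star_trivial, Matrix.sub_mulVec, dotProduct_sub, Algebra.algebraMap_eq_smul_one,
    Matrix.smul_mulVec, Matrix.one_mulVec, dotProduct_smul, smul_eq_mul] at this
  have e : x ⬝ᵥ x = ∑ i, x i ^ 2 := by simp [dotProduct, sq]
  rw [e] at this
  linarith

theorem abs_dotProduct_mulVec_le {B : Matrix (Fin s) (Fin s) ℝ} {ε : ℝ}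
    (hB : ∀ i j, |B i j| ≤ ε) (x : Fin s → ℝ) :
    |x ⬝ᵥ (B *ᵥ x)| ≤ s * ε * ∑ i, x i ^ 2 := by
  have h1 : |x ⬝ᵥ (B *ᵥ x)| ≤ ∑ i, ∑ j, ε * ((x i ^ 2 + x j ^ 2) / 2) := by
    simp only [dotProduct, Matrix.mulVec, Finset.mul_sum]
    refine (Finset.abs_sum_le_sum_abs _ _).trans (Finset.sum_le_sum fun i _ => ?_)
    refine (Finset.abs_sum_le_sum_abs _ _).trans (Finset.sum_le_sum fun j _ => ?_)
    rw [abs_mul, abs_mul]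
    have : |x i| * |x j| ≤ (x i ^ 2 + x j ^ 2) / 2 := by
      nlinarith [sq_nonneg (|x i| - |x j|), sq_abs (x i), sq_abs (x j)]
    calc |x i| * (|B i j| * |x j|) = |B i j| * (|x i| * |x j|) := by ring
      _ ≤ _ := mul_le_mul (hB i j) this (by positivity) ((abs_nonneg _).trans (hB i j))
  refine h1.trans (le_of_eq ?_)
  simp only [← Finset.mul_sum, ← Finset.sum_div, Finset.sum_add_distrib, Finset.sum_const,
    Finset.card_univ, Fintype.card_fin, nsmul_eq_mul]
  ring

theorem IsNegDefBy.of_close {B B' : Matrix (Fin s) (Fin s) ℝ} {m ε : ℝ} (h : IsNegDefBy m B)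
    (hε : ∀ i j, |B' i j - B i j| ≤ ε) (hs : s * ε ≤ m / 2) : IsNegDefBy (m / 2) B' := by
  intro x
  have h1 := abs_dotProduct_mulVec_le (B := B' - B) hε x
  have h2 := h x
  have h3 : x ⬝ᵥ (B' *ᵥ x) = x ⬝ᵥ (B *ᵥ x) + x ⬝ᵥ ((B' - B) *ᵥ x) := by
    rw [Matrix.sub_mulVec, dotProduct_sub]; ring
  have h4 : (s : ℝ) * ε * ∑ i, x i ^ 2 ≤ m / 2 * ∑ i, x i ^ 2 :=
    mul_le_mul_of_nonneg_right hs (Finset.sum_nonneg fun i _ => sq_nonneg _)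
  have h5 := le_abs_self (x ⬝ᵥ ((B' - B) *ᵥ x))
  rw [h3]; linarith

theorem IsNegDefBy.isUnit_det {B : Matrix (Fin s) (Fin s) ℝ} {m : ℝ} (hm : 0 < m)
    (h : IsNegDefBy m B) : IsUnit B.det := by
  rw [isUnit_iff_ne_zero]
  intro h0
  obtain ⟨v, hv, hv0⟩ := Matrix.exists_mulVec_eq_zero_iff.2 h0
  have := h v
  rw [hv0, dotProduct_zero] at this
  have h2 : 0 < ∑ i, v i ^ 2 := by
    obtain ⟨i, hi⟩ := Function.ne_iff.1 hv
    exact Finset.sum_pos' (fun i _ => sq_nonneg _) ⟨i, Finset.mem_univ _, by have : v i ≠ 0 := hi; positivity⟩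
  nlinarith

theorem IsNegDefBy.abs_inv_apply_le {B : Matrix (Fin s) (Fin s) ℝ} {m : ℝ} (hm : 0 < m)
    (h : IsNegDefBy m B) (i j : Fin s) : |B⁻¹ i j| ≤ 1 / m := by
  set y : Fin s → ℝ := B⁻¹ *ᵥ Pi.single j 1
  have hy : ∀ i, y i = B⁻¹ i j := fun i => by simp [y]
  have hBy : B *ᵥ y = Pi.single j 1 := by
    simp only [y, Matrix.mulVec_mulVec, Matrix.mul_nonsing_inv _ (h.isUnit_det hm),
      Matrix.one_mulVec]
  have h1 := h y
  rw [hBy, dotProduct_single, mul_one] at h1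
  have hle : ∀ k, y k ^ 2 ≤ ∑ i, y i ^ 2 := fun k =>
    Finset.single_le_sum (f := fun i => y i ^ 2) (fun i _ => sq_nonneg _) (Finset.mem_univ k)
  have hj : |y j| ≤ 1 / m := by
    have h2 : m * |y j| ^ 2 ≤ |y j| := by
      rw [sq_abs]; nlinarith [neg_abs_le (y j), hle j]
    rw [le_div_iff₀ hm]
    rcases (abs_nonneg (y j)).eq_or_lt with h0 | h0
    · rw [← h0]; simp
    · nlinarith
  rw [← hy]
  have h3 : m * y i ^ 2 ≤ 1 / m := by nlinarith [neg_abs_le (y j), hle i]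
  refine abs_le_of_sq_le_sq ?_ (by positivity)
  rw [div_pow, one_pow, le_div_iff₀ (by positivity)]
  rw [le_div_iff₀ hm] at h3
  nlinarith

end LinearAlgebra

section Basics

variable {s : ℕ} {M : Experiment.{u, v} s} {σ : Param s}

theorem Experiment.dstar_le (M : Experiment.{u, v} s) (i : Fin s) : M.dstar ≤ M.d i :=
  ciInf_le (Set.finite_range _).bddBelow i

theorem Experiment.dstar_nonneg (hd : ∀ i, 0 < M.d i) : 0 ≤ M.dstar :=
  Real.iInf_nonneg fun i => (hd i).le

theorem Experiment.box_mono (hd : ∀ i, 0 < M.d i) {r r' : ℝ} (h : r ≤ r') :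
    M.box σ r ⊆ M.box σ r' := fun θ hθ i =>
  (hθ i).trans (by
    have := M.dstar_nonneg hd
    have := hd i
    gcongr)

theorem Experiment.self_mem_box (hd : ∀ i, 0 < M.d i) {r : ℝ} (hr : 0 ≤ r) : σ ∈ M.box σ r := by
  intro i
  have := M.dstar_nonneg hd
  have := hd i
  simp only [sub_self, abs_zero]
  positivity

theorem Experiment.abs_sub_le_of_mem_box (hd : ∀ i, 0 < M.d i) {r : ℝ} (hr : 0 ≤ r) {θ : Param s}
    (hθ : θ ∈ M.box σ r) (i : Fin s) : |θ i - σ i| ≤ r := by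
  refine (hθ i).trans ?_
  rw [div_le_iff₀ (hd i)]
  exact mul_le_mul_of_nonneg_left (M.dstar_le i) hr

theorem Experiment.convex_box (M : Experiment.{u, v} s) (σ : Param s) (r : ℝ) :
    Convex ℝ (M.box σ r) := by
  intro x hx y hy p q hp hq hpq i
  have e : (p • x + q • y) i - σ i = p * (x i - σ i) + q * (y i - σ i) := by
    have : σ i = (p + q) * σ i := by rw [hpq, one_mul]
    simp only [PiLp.add_apply, PiLp.smul_apply, smul_eq_mul]
    linear_combination -this
  rw [e]
  calc |p * (x i - σ i) + q * (y i - σ i)|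
      ≤ p * |x i - σ i| + q * |y i - σ i| := by
        refine (abs_add_le _ _).trans (le_of_eq ?_)
        rw [abs_mul, abs_mul, abs_of_nonneg hp, abs_of_nonneg hq]
    _ ≤ p * (r * M.dstar / M.d i) + q * (r * M.dstar / M.d i) := by
        gcongr
        · exact hx i
        · exact hy i
    _ = r * M.dstar / M.d i := by rw [← add_mul, hpq, one_mul]

theorem Experiment.segment_mem_box {r : ℝ} {x y : Param s} (hx : x ∈ M.box σ r)
    (hy : y ∈ M.box σ r) {t : ℝ} (ht : t ∈ Set.Icc (0 : ℝ) 1) : x + t • (y - x) ∈ M.box σ r :=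
  (M.convex_box σ r).add_smul_sub_mem hx hy ht

theorem Experiment.isCompact_box (M : Experiment.{u, v} s) (σ : Param s) (r : ℝ) :
    IsCompact (M.box σ r) := by
  have : M.box σ r = (EuclideanSpace.equiv (Fin s) ℝ) ⁻¹'
      (Set.univ.pi fun i => Metric.closedBall (σ i) (r * M.dstar / M.d i)) := by
    ext θ
    simp [Experiment.box, Real.dist_eq]
  rw [this]
  exact (EuclideanSpace.equiv (Fin s) ℝ).toHomeomorph.isCompact_preimage.2
    (isCompact_univ_pi fun i => isCompact_closedBall _ _)

theorem Experiment.A_isSymm {U : Set (Param s)} (hU : IsOpen U) {θ : Param s} (hθ : θ ∈ U)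
    (hl : ∀ y, ContDiffOn ℝ 4 (fun τ => M.l τ y) U) : (M.A θ).IsSymm := by
  ext i j
  simp only [Matrix.transpose_apply, Experiment.A, Matrix.of_apply, Experiment.expect,
    Experiment.F, hessMat]
  congr 1
  funext ω
  exact pderiv_comm hU ((hl _).of_le (by norm_num)) j i hθ

theorem Experiment.diagonal_inv (hd : ∀ i, 0 < M.d i) :
    (Matrix.diagonal M.d)⁻¹ = Matrix.diagonal fun i => (M.d i)⁻¹ := by
  refine Matrix.inv_eq_right_inv ?_
  rw [Matrix.diagonal_mul_diagonal, ← Matrix.diagonal_one]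
  congr 1
  funext i
  exact mul_inv_cancel₀ (hd i).ne'

theorem Experiment.Q_apply (hd : ∀ i, 0 < M.d i) (θ : Param s) (i j : Fin s) :
    M.Q θ i j = M.A θ i j / (M.d i * M.d j) := by
  rw [Experiment.Q, M.diagonal_inv hd, Matrix.mul_diagonal, Matrix.diagonal_mul]
  field_simp

theorem Experiment.Q_isSymm (hd : ∀ i, 0 < M.d i) {θ : Param s} (h : (M.A θ).IsSymm) :
    (M.Q θ).IsSymm := by
  ext i j
  rw [Matrix.transpose_apply, M.Q_apply hd, M.Q_apply hd, h.apply, mul_comm (M.d j)]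

theorem Experiment.inv_A_apply (hd : ∀ i, 0 < M.d i) (θ : Param s) (i j : Fin s) :
    (M.A θ)⁻¹ i j = (M.Q θ)⁻¹ i j / (M.d i * M.d j) := by
  have hdet : IsUnit (Matrix.diagonal M.d).det := by
    rw [Matrix.det_diagonal, isUnit_iff_ne_zero]
    exact Finset.prod_ne_zero_iff.2 fun i _ => (hd i).ne'
  have : (M.Q θ)⁻¹ = Matrix.diagonal M.d * (M.A θ)⁻¹ * Matrix.diagonal M.d := by
    rw [Experiment.Q, Matrix.mul_inv_rev, Matrix.mul_inv_rev, Matrix.nonsing_inv_nonsing_inv _ hdet,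
      Matrix.mul_assoc]
  rw [this, Matrix.mul_diagonal, Matrix.diagonal_mul]
  have := (hd i).ne'
  have := (hd j).ne'
  field_simp

theorem Experiment.isUnit_A_det {θ : Param s} (h : IsUnit (M.Q θ).det) :
    IsUnit (M.A θ).det := by
  rw [Experiment.Q, Matrix.det_mul, Matrix.det_mul] at h
  exact isUnit_of_mul_isUnit_right (isUnit_of_mul_isUnit_left h)

end Basics

section Measurability

variable {s : ℕ} {M : Experiment.{u, v} s} {U : Set (Param s)}

theorem Experiment.measurable_a (hU : IsOpen U) (hm : ∀ θ ∈ U, Measurable (M.l θ))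
    (hl : ∀ y, ContDiffOn ℝ 4 (fun τ => M.l τ y) U) (i : Fin s) {θ : Param s} (hθ : θ ∈ U) :
    Measurable fun y => M.a θ y i :=
  measurable_pderiv hU hm (fun y => (hl y).differentiableOn (by norm_num)) i hθ

theorem Experiment.measurable_F (hU : IsOpen U) (hm : ∀ θ ∈ U, Measurable (M.l θ))
    (hl : ∀ y, ContDiffOn ℝ 4 (fun τ => M.l τ y) U) (i j : Fin s) {θ : Param s} (hθ : θ ∈ U) :
    Measurable fun y => M.F θ y i j :=
  measurable_pderiv (F := fun θ y => M.a θ y j) hU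
    (fun _ hθ => M.measurable_a hU hm hl j hθ)
    (fun y => (contDiffOn_pderiv hU (hl y) (m := 3) (by norm_num) j).differentiableOn
      (by norm_num)) i hθ

theorem Experiment.contDiffOn_F (hU : IsOpen U)
    (hl : ∀ y, ContDiffOn ℝ 4 (fun τ => M.l τ y) U) (i j : Fin s) (y : M.𝒴) :
    ContDiffOn ℝ 2 (fun θ => M.F θ y i j) U :=
  contDiffOn_pderiv hU (contDiffOn_pderiv hU (hl y) (m := 3) (by norm_num) j)
    (m := 2) (by norm_num) i

theorem Experiment.measurable_l3 (hU : IsOpen U) (hm : ∀ θ ∈ U, Measurable (M.l θ))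
    (hl : ∀ y, ContDiffOn ℝ 4 (fun τ => M.l τ y) U) (i j k : Fin s) {θ : Param s} (hθ : θ ∈ U) :
    Measurable fun y => M.l3 i j k θ y :=
  measurable_pderiv (F := fun θ y => M.F θ y j k) hU
    (fun _ hθ => M.measurable_F hU hm hl j k hθ)
    (fun y => (M.contDiffOn_F hU hl j k y).differentiableOn (by norm_num)) i hθ

theorem Experiment.contDiffOn_l3 (hU : IsOpen U)
    (hl : ∀ y, ContDiffOn ℝ 4 (fun τ => M.l τ y) U) (i j k : Fin s) (y : M.𝒴) :
    ContDiffOn ℝ 1 (fun θ => M.l3 i j k θ y) U :=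
  contDiffOn_pderiv hU (M.contDiffOn_F hU hl j k y) (m := 1) (by norm_num) i

theorem Experiment.measurable_l4 (hU : IsOpen U) (hm : ∀ θ ∈ U, Measurable (M.l θ))
    (hl : ∀ y, ContDiffOn ℝ 4 (fun τ => M.l τ y) U) (i j k m : Fin s) {θ : Param s}
    (hθ : θ ∈ U) : Measurable fun y => M.l4 i j k m θ y :=
  measurable_pderiv (F := fun θ y => M.l3 j k m θ y) hU
    (fun _ hθ => M.measurable_l3 hU hm hl j k m hθ)
    (fun y => (M.contDiffOn_l3 hU hl j k m y).differentiableOn (by norm_num)) i hθ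

theorem Experiment.continuousOn_l4 (hU : IsOpen U)
    (hl : ∀ y, ContDiffOn ℝ 4 (fun τ => M.l τ y) U) (i j k m : Fin s) (y : M.𝒴) :
    ContinuousOn (fun θ => M.l4 i j k m θ y) U :=
  (contDiffOn_pderiv hU (M.contDiffOn_l3 hU hl j k m y) (m := 0) (by norm_num) i).continuousOn

end Measurability

section Envelope

variable {s : ℕ}

theorem MomentsBounded.add {M : ℕ → Experiment.{u, v} s} {σ : Param s} {g : ℝ} (hg : 1 ≤ g)
    {f₁ f₂ : ∀ n, (M n).𝒴 → ℝ≥0∞} (hf : ∀ n, Measurable (f₁ n)) (h₁ : MomentsBounded M σ g f₁)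
    (h₂ : MomentsBounded M σ g f₂) : MomentsBounded M σ g fun n y => f₁ n y + f₂ n y := by
  obtain ⟨K₁, h₁⟩ := h₁
  obtain ⟨K₂, h₂⟩ := h₂
  have htop : (2 : ℝ≥0∞) ^ (g - 1) ≠ ∞ :=
    ENNReal.rpow_ne_top_of_nonneg (by linarith) (by norm_num)
  refine ⟨((2 : ℝ≥0∞) ^ (g - 1)).toNNReal * (K₁ + K₂), fun n => ?_⟩
  have hm : Measurable fun ω => f₁ n ((M n).Y ω) ^ g :=
    ((hf n).comp (M n).measurable_Y).pow_const g
  calc ∫⁻ ω, (f₁ n ((M n).Y ω) + f₂ n ((M n).Y ω)) ^ g ∂((M n).P σ)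
      ≤ ∫⁻ ω, 2 ^ (g - 1) * (f₁ n ((M n).Y ω) ^ g + f₂ n ((M n).Y ω) ^ g) ∂((M n).P σ) :=
        lintegral_mono fun ω => ENNReal.rpow_add_le_mul_rpow_add_rpow _ _ hg
    _ = 2 ^ (g - 1) * (∫⁻ ω, f₁ n ((M n).Y ω) ^ g ∂((M n).P σ)
          + ∫⁻ ω, f₂ n ((M n).Y ω) ^ g ∂((M n).P σ)) := by
        rw [lintegral_const_mul' _ _ htop, lintegral_add_left hm]
    _ ≤ _ := by
        push_cast
        rw [ENNReal.coe_toNNReal htop]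
        gcongr
        · exact h₁ n
        · exact h₂ n

theorem MomentsBounded.const_one {M : ℕ → Experiment.{u, v} s} {σ : Param s} {g : ℝ} :
    MomentsBounded M σ g fun _ _ => 1 :=
  ⟨1, fun n => by simp⟩

theorem MomentsBounded.sum {M : ℕ → Experiment.{u, v} s} {σ : Param s} {g : ℝ} (hg : 1 ≤ g)
    {ι : Type*} (t : Finset ι) {f : ι → ∀ n, (M n).𝒴 → ℝ≥0∞} (hf : ∀ i n, Measurable (f i n))
    (h : ∀ i, MomentsBounded M σ g (f i)) : MomentsBounded M σ g fun n y => ∑ i ∈ t, f i n y := by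
  classical
  induction t using Finset.induction_on with
  | empty => exact ⟨0, fun n => by simp [show (0 : ℝ) < g by linarith]⟩
  | insert a t ha ih =>
    simp only [Finset.sum_insert ha]
    exact MomentsBounded.add hg (hf a) (h a) ih

/-- The value `x` dominates all the normalized derivatives of the criterion function. -/
structure Experiment.Dominates (M : Experiment.{u, v} s) (σ : Param s) (δ : ℝ) (y : M.𝒴)
    (x : ℝ) : Prop where
  one_le : 1 ≤ x
  a_le : ∀ i, |M.a σ y i| ≤ x * M.d i
  F_le : ∀ i j, |M.F σ y i j - M.A σ i j| ≤ x * (√(M.d i) * √(M.d j))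
  l3_le : ∀ i j k, ∀ θ ∈ M.box σ δ, |M.l3 i j k θ y| ≤ x * (M.d i * M.d j * M.d k / M.dstar)
  l3_self_le : ∀ i j k, |M.l3 i j k σ y| ≤ x * (M.d j * M.d k)
  l4_le : ∀ i j k m, ∀ θ ∈ M.box σ δ,
    |M.l4 i j k m θ y| ≤ x * (M.d i * M.d j * M.d k * M.d m / M.dstar ^ 2)

/-- The sum of the normalized derivatives of the criterion function. -/
noncomputable def Experiment.envelope (M : Experiment.{u, v} s) (σ : Param s) (δ : ℝ)
    (y : M.𝒴) : ℝ≥0∞ :=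
  1 + ((∑ i, ENNReal.ofReal (|M.a σ y i| / M.d i)) +
  ((∑ p : Fin s × Fin s, ENNReal.ofReal
    (|M.F σ y p.1 p.2 - M.expect σ fun y' => M.F σ y' p.1 p.2| / √(M.d p.1 * M.d p.2))) +
  ((∑ p : Fin s × Fin s × Fin s,
    ENNReal.ofReal (M.dstar / (M.d p.1 * M.d p.2.1 * M.d p.2.2)) *
      M.supBox σ δ fun θ => M.l3 p.1 p.2.1 p.2.2 θ y) +
  ((∑ p : Fin s × Fin s × Fin s,
    ENNReal.ofReal (|M.l3 p.1 p.2.1 p.2.2 σ y| / (M.d p.2.1 * M.d p.2.2))) +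
  (∑ p : Fin s × Fin s × Fin s × Fin s,
    ENNReal.ofReal (M.dstar ^ 2 / (M.d p.1 * M.d p.2.1 * M.d p.2.2.1 * M.d p.2.2.2)) *
      M.supBox σ δ fun θ => M.l4 p.1 p.2.1 p.2.2.1 p.2.2.2 θ y)))))

theorem le_of_ofReal_mul_supBox_le {M : Experiment.{u, v} s} {σ : Param s} {δ : ℝ}
    {f : Param s → ℝ} {w : ℝ} (hw : 0 < w) {X : ℝ≥0∞} (hX : X ≠ ∞)
    (h : ENNReal.ofReal w⁻¹ * M.supBox σ δ f ≤ X) {θ : Param s} (hθ : θ ∈ M.box σ δ) :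
    |f θ| ≤ X.toReal * w := by
  have h1 : ENNReal.ofReal (w⁻¹ * |f θ|) ≤ X := by
    rw [ENNReal.ofReal_mul (by positivity)]
    refine le_trans ?_ h
    gcongr
    exact le_iSup₂ (f := fun θ (_ : θ ∈ M.box σ δ) => ENNReal.ofReal |f θ|) θ hθ
  have h2 := (ENNReal.ofReal_le_iff_le_toReal hX).1 h1
  rwa [inv_mul_le_iff₀ hw, mul_comm] at h2

theorem Experiment.dominates_envelope {M : Experiment.{u, v} s} {σ : Param s} {δ : ℝ}
    (hd : ∀ i, 0 < M.d i) (hd' : 0 < M.dstar) {y : M.𝒴} (h : M.envelope σ δ y ≠ ∞) :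
    M.Dominates σ δ y (M.envelope σ δ y).toReal := by
  have key : ∀ b₀ b₁ b₂ b₃ b₄ b₅ : ℝ≥0∞, b₀ ≤ b₀ + (b₁ + (b₂ + (b₃ + (b₄ + b₅)))) ∧
      b₁ ≤ b₀ + (b₁ + (b₂ + (b₃ + (b₄ + b₅)))) ∧ b₂ ≤ b₀ + (b₁ + (b₂ + (b₃ + (b₄ + b₅)))) ∧
      b₃ ≤ b₀ + (b₁ + (b₂ + (b₃ + (b₄ + b₅)))) ∧ b₄ ≤ b₀ + (b₁ + (b₂ + (b₃ + (b₄ + b₅)))) ∧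
      b₅ ≤ b₀ + (b₁ + (b₂ + (b₃ + (b₄ + b₅)))) := fun b₀ b₁ b₂ b₃ b₄ b₅ =>
    ⟨le_self_add, le_add_left le_self_add, le_add_left (le_add_left le_self_add),
      le_add_left (le_add_left (le_add_left le_self_add)),
      le_add_left (le_add_left (le_add_left (le_add_left le_self_add))),
      le_add_left (le_add_left (le_add_left (le_add_left le_add_self)))⟩
  obtain ⟨e0, e1, e2, e3, e4, e5⟩ : _ ≤ M.envelope σ δ y ∧ _ ≤ M.envelope σ δ y ∧
      _ ≤ M.envelope σ δ y ∧ _ ≤ M.envelope σ δ y ∧ _ ≤ M.envelope σ δ y ∧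
      _ ≤ M.envelope σ δ y := key _ _ _ _ _ _
  generalize M.envelope σ δ y = X at *
  have t1 : ∀ {x : ℝ}, ENNReal.ofReal x ≤ X → x ≤ X.toReal := fun hx =>
    (ENNReal.ofReal_le_iff_le_toReal h).1 hx
  have hsum : ∀ {ι : Type} [Fintype ι] {f : ι → ℝ≥0∞}, ∑ i, f i ≤ X → ∀ i, f i ≤ X :=
    fun hf i => (Finset.single_le_sum (fun _ _ => zero_le) (Finset.mem_univ i)).trans hf
  refine ⟨?_, fun i => ?_, fun i j => ?_, fun i j k θ hθ => ?_, fun i j k => ?_,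
    fun i j k m θ hθ => ?_⟩
  · exact t1 (by rwa [ENNReal.ofReal_one])
  · rw [← div_le_iff₀ (hd i)]
    exact t1 (hsum e1 i)
  · rw [← Real.sqrt_mul (hd i).le,
      ← div_le_iff₀ (Real.sqrt_pos.2 (mul_pos (hd i) (hd j)))]
    exact t1 (hsum e2 (i, j))
  · have := hd i; have := hd j; have := hd k
    refine le_of_ofReal_mul_supBox_le (M := M) (f := fun θ => M.l3 i j k θ y) (by positivity) h ?_ hθ
    rw [inv_div]
    exact hsum e3 (i, j, k)
  · rw [← div_le_iff₀ (mul_pos (hd j) (hd k))]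
    exact t1 (hsum e4 (i, j, k))
  · have := hd i; have := hd j; have := hd k; have := hd m
    refine le_of_ofReal_mul_supBox_le (M := M) (f := fun θ => M.l4 i j k m θ y)
      (by positivity) h ?_ hθ
    rw [inv_div]
    exact hsum e5 (i, j, k, m)

section

variable {M : Experiment.{u, v} s} {U : Set (Param s)} {σ : Param s} {δ : ℝ}

theorem Experiment.measurable_supBox {f : Param s → M.𝒴 → ℝ}
    (hm : ∀ θ ∈ M.box σ δ, Measurable (f θ))
    (hc : ∀ y, ContinuousOn (fun θ => f θ y) (M.box σ δ)) :
    Measurable fun y => M.supBox σ δ fun θ => f θ y :=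
  measurable_iSup_of_continuousOn hm hc

theorem Experiment.measurable_supBox_l3 (hU : IsOpen U) (hbox : M.box σ δ ⊆ U)
    (hm : ∀ θ ∈ U, Measurable (M.l θ)) (hl : ∀ y, ContDiffOn ℝ 4 (fun τ => M.l τ y) U)
    (i j k : Fin s) : Measurable fun y => M.supBox σ δ fun θ => M.l3 i j k θ y :=
  M.measurable_supBox (fun _ hθ => M.measurable_l3 hU hm hl i j k (hbox hθ))
    fun y => ((M.contDiffOn_l3 hU hl i j k y).continuousOn).mono hbox

theorem Experiment.measurable_supBox_l4 (hU : IsOpen U) (hbox : M.box σ δ ⊆ U)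
    (hm : ∀ θ ∈ U, Measurable (M.l θ)) (hl : ∀ y, ContDiffOn ℝ 4 (fun τ => M.l τ y) U)
    (i j k m : Fin s) : Measurable fun y => M.supBox σ δ fun θ => M.l4 i j k m θ y :=
  M.measurable_supBox (fun _ hθ => M.measurable_l4 hU hm hl i j k m (hbox hθ))
    fun y => (M.continuousOn_l4 hU hl i j k m y).mono hbox

end

theorem exists_envelope_moments {M : ℕ → Experiment.{u, v} s} {U : Set (Param s)} {σ : Param s}
    {δ g : ℝ} (hg : 1 ≤ g) (hU : IsOpen U) (hσ : σ ∈ U) (hbox : ∀ n, (M n).box σ δ ⊆ U)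
    (hm : ∀ n, ∀ θ ∈ U, Measurable ((M n).l θ))
    (hl : ∀ n y, ContDiffOn ℝ 4 (fun θ => (M n).l θ y) U)
    (hm1 : ∀ i, MomentsBounded M σ g fun n y =>
      ENNReal.ofReal (|(M n).a σ y i| / (M n).d i))
    (hm2 : ∀ i j, MomentsBounded M σ g fun n y =>
      ENNReal.ofReal (|(M n).F σ y i j - (M n).expect σ fun y' => (M n).F σ y' i j|
        / √((M n).d i * (M n).d j)))
    (hm3 : ∀ i j k, MomentsBounded M σ g fun n y =>
      ENNReal.ofReal ((M n).dstar / ((M n).d i * (M n).d j * (M n).d k)) *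
        (M n).supBox σ δ fun θ => (M n).l3 i j k θ y)
    (hm5 : ∀ i j k, MomentsBounded M σ g fun n y =>
      ENNReal.ofReal (|(M n).l3 i j k σ y| / ((M n).d j * (M n).d k)))
    (hm6 : ∀ i j k m, MomentsBounded M σ g fun n y =>
      ENNReal.ofReal ((M n).dstar ^ 2 / ((M n).d i * (M n).d j * (M n).d k * (M n).d m)) *
        (M n).supBox σ δ fun θ => (M n).l4 i j k m θ y) :
    (∀ n, Measurable ((M n).envelope σ δ)) ∧
      MomentsBounded M σ g fun n => (M n).envelope σ δ := by
  have me1 : ∀ i n, Measurable fun y => ENNReal.ofReal (|(M n).a σ y i| / (M n).d i) :=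
    fun i n => (((M n).measurable_a hU (hm n) (hl n) i hσ).abs.div_const _).ennreal_ofReal
  have me2 : ∀ (p : Fin s × Fin s) n, Measurable fun y => ENNReal.ofReal
      (|(M n).F σ y p.1 p.2 - (M n).expect σ fun y' => (M n).F σ y' p.1 p.2|
        / √((M n).d p.1 * (M n).d p.2)) :=
    fun p n => ((((M n).measurable_F hU (hm n) (hl n) p.1 p.2 hσ).sub_const _).abs.div_const
      _).ennreal_ofReal
  have me3 : ∀ (p : Fin s × Fin s × Fin s) n, Measurable fun y =>
      ENNReal.ofReal ((M n).dstar / ((M n).d p.1 * (M n).d p.2.1 * (M n).d p.2.2)) *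
        (M n).supBox σ δ fun θ => (M n).l3 p.1 p.2.1 p.2.2 θ y :=
    fun p n => ((M n).measurable_supBox_l3 hU (hbox n) (hm n) (hl n) _ _ _).const_mul _
  have me5 : ∀ (p : Fin s × Fin s × Fin s) n, Measurable fun y =>
      ENNReal.ofReal (|(M n).l3 p.1 p.2.1 p.2.2 σ y| / ((M n).d p.2.1 * (M n).d p.2.2)) :=
    fun p n => (((M n).measurable_l3 hU (hm n) (hl n) _ _ _ hσ).abs.div_const _).ennreal_ofReal
  have me6 : ∀ (p : Fin s × Fin s × Fin s × Fin s) n, Measurable fun y =>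
      ENNReal.ofReal ((M n).dstar ^ 2 /
        ((M n).d p.1 * (M n).d p.2.1 * (M n).d p.2.2.1 * (M n).d p.2.2.2)) *
        (M n).supBox σ δ fun θ => (M n).l4 p.1 p.2.1 p.2.2.1 p.2.2.2 θ y :=
    fun p n => ((M n).measurable_supBox_l4 hU (hbox n) (hm n) (hl n) _ _ _ _).const_mul _
  have ms1 := fun n => Finset.measurable_fun_sum Finset.univ fun i _ => me1 i n
  have ms2 := fun n => Finset.measurable_fun_sum Finset.univ fun i _ => me2 i n
  have ms3 := fun n => Finset.measurable_fun_sum Finset.univ fun i _ => me3 i n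
  have ms5 := fun n => Finset.measurable_fun_sum Finset.univ fun i _ => me5 i n
  have ms6 := fun n => Finset.measurable_fun_sum Finset.univ fun i _ => me6 i n
  refine ⟨fun n => measurable_const.add ((ms1 n).add ((ms2 n).add ((ms3 n).add
    ((ms5 n).add (ms6 n))))), ?_⟩
  exact MomentsBounded.const_one.add hg (fun n => measurable_const)
    ((MomentsBounded.sum hg _ me1 hm1).add hg ms1
    ((MomentsBounded.sum hg _ me2 fun p => hm2 _ _).add hg ms2
    ((MomentsBounded.sum hg _ me3 fun p => hm3 _ _ _).add hg ms3
    ((MomentsBounded.sum hg _ me5 fun p => hm5 _ _ _).add hg ms5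
    (MomentsBounded.sum hg _ me6 fun p => hm6 _ _ _ _)))))

end Envelope

section Tame

variable {s : ℕ} {M : ℕ → Experiment.{u, v} s} {σ : Param s}

/-- The functions `f n` are bounded at `σ` and continuous at `σ`, both uniformly in large `n`;
neighbourhoods of `σ` are the boxes `S_δ(σ)`. -/
def Tame (M : ℕ → Experiment.{u, v} s) (σ : Param s) (f : ℕ → Param s → ℝ) : Prop :=
  (∃ K : ℝ, ∀ᶠ n in atTop, |f n σ| ≤ K) ∧
  ∀ ε > 0, ∃ δ > 0, ∀ᶠ n in atTop, ∀ θ ∈ (M n).box σ δ, |f n θ - f n σ| ≤ ε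

theorem Tame.of_vanishesUniformly {f e : ℕ → Param s → ℝ} {K : ℝ} (hK : ∀ᶠ n in atTop, |f n σ| ≤ K)
    (h : VanishesUniformly M σ e) (hle : ∀ n θ, |f n θ - f n σ| ≤ e n θ) : Tame M σ f :=
  ⟨⟨K, hK⟩, fun ε hε => by
    obtain ⟨δ, hδ, h⟩ := h ε hε
    exact ⟨δ, hδ, Eventually.of_forall fun n θ hθ => (hle n θ).trans (h n θ hθ)⟩⟩

theorem Tame.const {w : ℕ → ℝ} {K : ℝ} (h : ∀ᶠ n in atTop, |w n| ≤ K) :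
    Tame M σ fun n _ => w n :=
  ⟨⟨K, h⟩, fun ε hε => ⟨1, one_pos, Eventually.of_forall fun n θ _ => by simpa using hε.le⟩⟩

theorem Tame.add (hd : ∀ n i, 0 < (M n).d i) {f g : ℕ → Param s → ℝ} (hf : Tame M σ f)
    (hg : Tame M σ g) : Tame M σ fun n θ => f n θ + g n θ := by
  obtain ⟨⟨K, hK⟩, hf⟩ := hf
  obtain ⟨⟨L, hL⟩, hg⟩ := hg
  refine ⟨⟨K + L, ?_⟩, fun ε hε => ?_⟩
  · filter_upwards [hK, hL] with n h1 h2
    exact (abs_add_le _ _).trans (add_le_add h1 h2)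
  · obtain ⟨δ₁, hδ₁, h1⟩ := hf (ε / 2) (half_pos hε)
    obtain ⟨δ₂, hδ₂, h2⟩ := hg (ε / 2) (half_pos hε)
    refine ⟨min δ₁ δ₂, lt_min hδ₁ hδ₂, ?_⟩
    filter_upwards [h1, h2] with n h1 h2 θ hθ
    have e1 := h1 θ ((M n).box_mono (hd n) (min_le_left _ _) hθ)
    have e2 := h2 θ ((M n).box_mono (hd n) (min_le_right _ _) hθ)
    calc |f n θ + g n θ - (f n σ + g n σ)| = |(f n θ - f n σ) + (g n θ - g n σ)| := by ring_nf
      _ ≤ ε / 2 + ε / 2 := (abs_add_le _ _).trans (add_le_add e1 e2)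
      _ = ε := by ring

theorem Tame.mul (hd : ∀ n i, 0 < (M n).d i) {f g : ℕ → Param s → ℝ} (hf : Tame M σ f)
    (hg : Tame M σ g) : Tame M σ fun n θ => f n θ * g n θ := by
  obtain ⟨⟨K, hK⟩, hf⟩ := hf
  obtain ⟨⟨L, hL⟩, hg⟩ := hg
  refine ⟨⟨|K| * |L|, ?_⟩, fun ε hε => ?_⟩
  · filter_upwards [hK, hL] with n h1 h2
    rw [abs_mul]
    exact mul_le_mul (h1.trans (le_abs_self _)) (h2.trans (le_abs_self _)) (abs_nonneg _)
      (abs_nonneg _)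
  · set e := min 1 (ε / (|K| + |L| + 1)) with he
    have hpos : 0 < |K| + |L| + 1 := by positivity
    have he0 : 0 < e := lt_min one_pos (div_pos hε hpos)
    have he1 : e ≤ 1 := min_le_left _ _
    have he2 : e * (|K| + |L| + 1) ≤ ε := (le_div_iff₀ hpos).1 (min_le_right _ _)
    obtain ⟨δ₁, hδ₁, h1⟩ := hf e he0
    obtain ⟨δ₂, hδ₂, h2⟩ := hg e he0
    refine ⟨min δ₁ δ₂, lt_min hδ₁ hδ₂, ?_⟩
    filter_upwards [h1, h2, hK, hL] with n h1 h2 h3 h4 θ hθ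
    have e1 := h1 θ ((M n).box_mono (hd n) (min_le_left _ _) hθ)
    have e2 := h2 θ ((M n).box_mono (hd n) (min_le_right _ _) hθ)
    have h3 := h3.trans (le_abs_self K)
    have h4 := h4.trans (le_abs_self L)
    have eq : f n θ * g n θ - f n σ * g n σ = (f n θ - f n σ) * (g n θ - g n σ)
        + (f n θ - f n σ) * g n σ + f n σ * (g n θ - g n σ) := by ring
    rw [eq]
    refine (abs_add_three _ _ _).trans ?_
    rw [abs_mul, abs_mul, abs_mul]
    have m1 : |f n θ - f n σ| * |g n θ - g n σ| ≤ e * 1 :=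
      mul_le_mul e1 (e2.trans he1) (abs_nonneg _) he0.le
    have m2 : |f n θ - f n σ| * |g n σ| ≤ e * |L| := mul_le_mul e1 h4 (abs_nonneg _) he0.le
    have m3 : |f n σ| * |g n θ - g n σ| ≤ |K| * e := mul_le_mul h3 e2 (abs_nonneg _) (abs_nonneg _)
    linarith

theorem Tame.sum (hd : ∀ n i, 0 < (M n).d i) {ι : Type*} (t : Finset ι)
    {f : ι → ℕ → Param s → ℝ} (hf : ∀ i, Tame M σ (f i)) :
    Tame M σ fun n θ => ∑ i ∈ t, f i n θ := by
  classical
  induction t using Finset.induction_on with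
  | empty => simpa using Tame.const (M := M) (σ := σ) (w := fun _ => 0) (K := 0) (by simp)
  | insert a t ha ih =>
    simp only [Finset.sum_insert ha]
    exact (hf a).add hd ih

theorem Tame.congr (hd : ∀ n i, 0 < (M n).d i) {f g : ℕ → Param s → ℝ} (hg : Tame M σ g)
    {δ : ℝ} (hδ : 0 < δ) (h : ∀ᶠ n in atTop, ∀ θ ∈ (M n).box σ δ, f n θ = g n θ) :
    Tame M σ f := by
  obtain ⟨⟨L, hL⟩, hg⟩ := hg
  refine ⟨⟨L, ?_⟩, fun ε hε => ?_⟩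
  · filter_upwards [hL, h] with n h1 h2
    rwa [h2 σ ((M n).self_mem_box (hd n) hδ.le)]
  · obtain ⟨δ₁, hδ₁, h1⟩ := hg ε hε
    refine ⟨min δ₁ δ, lt_min hδ₁ hδ, ?_⟩
    filter_upwards [h1, h] with n h1 h2 θ hθ
    rw [h2 σ ((M n).self_mem_box (hd n) hδ.le),
      h2 θ ((M n).box_mono (hd n) (min_le_right _ _) hθ)]
    exact h1 θ ((M n).box_mono (hd n) (min_le_left _ _) hθ)

end Tame

section Bias

variable {s : ℕ} {M : Experiment.{u, v} s} {θ : Param s}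

theorem Experiment.expect_sum {ι : Type*} (t : Finset ι) {f : ι → M.𝒴 → ℝ}
    (h : ∀ i, M.HasExpect θ (f i)) :
    M.HasExpect θ (fun y => ∑ i ∈ t, f i y) ∧
      M.expect θ (fun y => ∑ i ∈ t, f i y) = ∑ i ∈ t, M.expect θ (f i) :=
  ⟨integrable_finsetSum _ fun i _ => h i, integral_finsetSum _ fun i _ => h i⟩

theorem Experiment.expect_const_mul (c : ℝ) {f : M.𝒴 → ℝ} (h : M.HasExpect θ f) :
    M.HasExpect θ (fun y => c * f y) ∧ M.expect θ (fun y => c * f y) = c * M.expect θ f :=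
  ⟨h.const_mul c, integral_const_mul c _⟩

theorem Experiment.expect_add {f f' : M.𝒴 → ℝ} (h : M.HasExpect θ f) (h' : M.HasExpect θ f') :
    M.HasExpect θ (fun y => f y + f' y) ∧
      M.expect θ (fun y => f y + f' y) = M.expect θ f + M.expect θ f' :=
  ⟨h.add h', integral_add h h'⟩

theorem Experiment.expect_congr_eq {f f' : M.𝒴 → ℝ} {c : ℝ} (hf : ∀ y, f y = f' y)
    (h : M.HasExpect θ f' ∧ M.expect θ f' = c) : M.HasExpect θ f ∧ M.expect θ f = c := by
  rwa [funext hf]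

theorem Experiment.expect_dotProduct_mulVec (b : Fin s → ℝ) (B : Matrix (Fin s) (Fin s) ℝ)
    {w : M.𝒴 → Fin s → ℝ} (h : ∀ i, M.HasExpect θ fun y => w y i) :
    M.HasExpect θ (fun y => b ⬝ᵥ (B *ᵥ w y)) ∧
      M.expect θ (fun y => b ⬝ᵥ (B *ᵥ w y)) = b ⬝ᵥ (B *ᵥ fun i => M.expect θ fun y => w y i) := by
  have h1 := fun p i => M.expect_const_mul (B p i) (h i)
  have h2 := fun p => M.expect_sum Finset.univ fun i => (h1 p i).1
  have h3 := fun p => M.expect_const_mul (b p) (h2 p).1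
  have h4 := M.expect_sum Finset.univ fun p => (h3 p).1
  refine ⟨h4.1, h4.2.trans ?_⟩
  refine Finset.sum_congr rfl fun p _ => ?_
  rw [(h3 p).2, (h2 p).2]
  simp only [(h1 p _).2]
  rfl

theorem Experiment.expect_FAa (hd : ∀ i, 0 < M.d i) (hA : IsUnit (M.A θ).det)
    (hE : M.ExpectationsExist θ) (i : Fin s) :
    M.HasExpect θ (fun y => (M.F θ y *ᵥ ((M.A θ)⁻¹ *ᵥ M.a θ y)) i) ∧
    M.expect θ (fun y => (M.F θ y *ᵥ ((M.A θ)⁻¹ *ᵥ M.a θ y)) i) =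
      (∑ j, ∑ k, (M.A θ)⁻¹ j k * (√(M.d i) * √(M.d j) * M.d k) * M.U2 θ i j k) + M.Ea θ i := by
  have h1 := fun j k => M.expect_const_mul ((M.A θ)⁻¹ j k * (√(M.d i) * √(M.d j) * M.d k))
    (hE.2.2.2.1 i j k)
  have h2 := fun j => M.expect_sum Finset.univ fun k => (h1 j k).1
  have h3 := M.expect_sum Finset.univ fun j => (h2 j).1
  have h4 := M.expect_add h3.1 (hE.1 i)
  refine M.expect_congr_eq (fun y => ?_) ⟨h4.1, h4.2.trans ?_⟩
  · have e1 : M.F θ y = (M.F θ y - M.A θ) + M.A θ := by abel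
    have e2 : M.A θ *ᵥ ((M.A θ)⁻¹ *ᵥ M.a θ y) = M.a θ y := by
      rw [Matrix.mulVec_mulVec, Matrix.mul_nonsing_inv _ hA, Matrix.one_mulVec]
    rw [e1, Matrix.add_mulVec, e2, Pi.add_apply]
    congr 1
    simp only [Matrix.mulVec, dotProduct, Finset.mul_sum]
    refine Finset.sum_congr rfl fun j _ => Finset.sum_congr rfl fun k _ => ?_
    have := Real.sqrt_pos.2 (hd i)
    have := Real.sqrt_pos.2 (hd j)
    have := hd k
    simp only [Experiment.lam2, Experiment.lam1, Matrix.sub_apply]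
    field_simp
  · rw [h3.2]
    simp only [(h2 _).2, (h1 _ _).2]
    rfl

theorem Experiment.expect_CAa (hd : ∀ i, 0 < M.d i) (hE : M.ExpectationsExist θ) (i : Fin s) :
    M.HasExpect θ (fun y => (M.C θ y *ᵥ ((M.A θ)⁻¹ *ᵥ M.a θ y)) i) ∧
    M.expect θ (fun y => (M.C θ y *ᵥ ((M.A θ)⁻¹ *ᵥ M.a θ y)) i) =
      ∑ k, ∑ m, ∑ j, ∑ l, (M.A θ)⁻¹ l j * (M.A θ)⁻¹ k m * (M.d j * M.d k * M.d l * M.d m) *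
        M.U3 θ i j l k m := by
  have h1 := fun k m j l => M.expect_const_mul
    ((M.A θ)⁻¹ l j * (M.A θ)⁻¹ k m * (M.d j * M.d k * M.d l * M.d m))
    (hE.2.2.2.2 i j l k m)
  have h2 := fun k m j => M.expect_sum Finset.univ fun l => (h1 k m j l).1
  have h3 := fun k m => M.expect_sum Finset.univ fun j => (h2 k m j).1
  have h4 := fun k => M.expect_sum Finset.univ fun m => (h3 k m).1
  have h5 := M.expect_sum Finset.univ fun k => (h4 k).1
  refine M.expect_congr_eq (fun y => ?_) ⟨h5.1, h5.2.trans ?_⟩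
  · simp only [Experiment.C, Matrix.mulVec, Matrix.vecMul, dotProduct, Matrix.of_apply,
      Finset.mul_sum, Finset.sum_mul]
    refine Finset.sum_congr rfl fun k _ => Finset.sum_congr rfl fun m _ =>
      Finset.sum_congr rfl fun j _ => Finset.sum_congr rfl fun l _ => ?_
    have := (hd j).ne'
    have := (hd k).ne'
    have := (hd l).ne'
    have := (hd m).ne'
    simp only [Experiment.lam3, Experiment.lam1]
    field_simp
  · simp only [(h4 _).2, (h3 _ _).2, (h2 _ _ _).2, (h1 _ _ _ _).2]
    rfl

theorem Experiment.expect_aBa (hd : ∀ i, 0 < M.d i) (hE : M.ExpectationsExist θ)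
    (B : Matrix (Fin s) (Fin s) ℝ) :
    M.HasExpect θ (fun y => M.a θ y ⬝ᵥ (B *ᵥ M.a θ y)) ∧
    M.expect θ (fun y => M.a θ y ⬝ᵥ (B *ᵥ M.a θ y)) =
      ∑ l, ∑ m, B l m * (M.d l * M.d m) * M.U1 θ l m := by
  have h1 := fun l m => M.expect_const_mul (B l m * (M.d l * M.d m)) (hE.2.2.1 l m)
  have h2 := fun l => M.expect_sum Finset.univ fun m => (h1 l m).1
  have h3 := M.expect_sum Finset.univ fun l => (h2 l).1
  refine M.expect_congr_eq (fun y => ?_) ⟨h3.1, h3.2.trans ?_⟩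
  · simp only [Matrix.mulVec, dotProduct, Finset.mul_sum]
    refine Finset.sum_congr rfl fun l _ => Finset.sum_congr rfl fun m _ => ?_
    have := (hd l).ne'
    have := (hd m).ne'
    simp only [Experiment.lam1]
    field_simp
  · simp only [(h2 _).2, (h1 _ _).2]
    rfl

/-- The sum `∑ Δⱼ` of the bias terms. -/
noncomputable def Experiment.bias (M : Experiment.{u, v} s) (η : Param s → ℝ) (θ : Param s) : ℝ :=
  M.Delta0 η θ + M.Delta1 η θ + M.Delta2 η θ + M.Delta3 η θ

/-- The leading terms in the expansion of `η(σ̂) - η(σ)`. -/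
noncomputable def Experiment.leading (M : Experiment.{u, v} s) (η : Param s → ℝ) (θ : Param s)
    (y : M.𝒴) : ℝ :=
  -2 * (gradVec η θ ⬝ᵥ ((M.A θ)⁻¹ *ᵥ M.a θ y)) +
  gradVec η θ ⬝ᵥ ((M.A θ)⁻¹ *ᵥ (M.F θ y *ᵥ ((M.A θ)⁻¹ *ᵥ M.a θ y))) +
  (1 / 2) * (M.a θ y ⬝ᵥ (((M.A θ)⁻¹ * hessMat η θ * (M.A θ)⁻¹) *ᵥ M.a θ y)) +
  -(1 / 2) * (gradVec η θ ⬝ᵥ ((M.A θ)⁻¹ *ᵥ (M.C θ y *ᵥ ((M.A θ)⁻¹ *ᵥ M.a θ y))))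

theorem Experiment.expect_leading (hd : ∀ i, 0 < M.d i) (hA : IsUnit (M.A θ).det)
    (hE : M.ExpectationsExist θ) (η : Param s → ℝ) :
    M.HasExpect θ (M.leading η θ) ∧ M.expect θ (M.leading η θ) = M.bias η θ := by
  have h0 := M.expect_dotProduct_mulVec (gradVec η θ) (M.A θ)⁻¹ (w := M.a θ) hE.1
  have h1 := M.expect_dotProduct_mulVec (gradVec η θ) (M.A θ)⁻¹
    (w := fun y => M.F θ y *ᵥ ((M.A θ)⁻¹ *ᵥ M.a θ y)) fun i => (M.expect_FAa hd hA hE i).1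
  have h2 := M.expect_aBa hd hE ((M.A θ)⁻¹ * hessMat η θ * (M.A θ)⁻¹)
  have h3 := M.expect_dotProduct_mulVec (gradVec η θ) (M.A θ)⁻¹
    (w := fun y => M.C θ y *ᵥ ((M.A θ)⁻¹ *ᵥ M.a θ y)) fun i => (M.expect_CAa hd hE i).1
  have e0 := M.expect_const_mul (-2) h0.1
  have e2 := M.expect_const_mul (1 / 2) h2.1
  have e3 := M.expect_const_mul (-(1 / 2)) h3.1
  have f1 := M.expect_add e0.1 h1.1
  have f2 := M.expect_add f1.1 e2.1
  have f3 := M.expect_add f2.1 e3.1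
  refine ⟨f3.1, f3.2.trans ?_⟩
  rw [f2.2, f1.2, e0.2, e2.2, e3.2, h0.2, h1.2, h3.2]
  rfl

/-- The scaled bias terms in terms of `Q⁻¹` and the moments `E(a)`, `U₁`, `U₂`, `U₃`. -/
theorem Experiment.dstar_sq_mul_bias (hd : ∀ i, 0 < M.d i) (hA : IsUnit (M.A θ).det)
    (hE : M.ExpectationsExist θ) (η : Param s → ℝ) :
    M.dstar ^ 2 * M.bias η θ =
      (∑ p, ∑ i, -(M.dstar ^ 2 / (M.d p * M.d i)) *
        (gradVec η θ p * ((M.Q θ)⁻¹ p i * M.Ea θ i))) +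
      (∑ p, ∑ i, ∑ j, ∑ k, (M.dstar ^ 2 / (M.d p * (√(M.d i) * √(M.d j)))) *
        (gradVec η θ p * ((M.Q θ)⁻¹ p i * ((M.Q θ)⁻¹ j k * M.U2 θ i j k)))) +
      (∑ l, ∑ m, ∑ q, ∑ p, (1 / 2 * (M.dstar ^ 2 / (M.d p * M.d q))) *
        ((M.Q θ)⁻¹ l p * (hessMat η θ p q * ((M.Q θ)⁻¹ q m * M.U1 θ l m)))) +
      (∑ p, ∑ i, ∑ k, ∑ m, ∑ j, ∑ l, (-(1 / 2) * (M.dstar ^ 2 / (M.d p * M.d i))) *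
        (gradVec η θ p * ((M.Q θ)⁻¹ p i * ((M.Q θ)⁻¹ l j *
          ((M.Q θ)⁻¹ k m * M.U3 θ i j l k m))))) := by
  have hne : ∀ i, M.d i ≠ 0 := fun i => (hd i).ne'
  have hsq : ∀ i, √(M.d i) ≠ 0 := fun i => (Real.sqrt_pos.2 (hd i)).ne'
  have h0 : M.dstar ^ 2 * M.Delta0 η θ = 2 * ∑ p, ∑ i, -(M.dstar ^ 2 / (M.d p * M.d i)) *
        (gradVec η θ p * ((M.Q θ)⁻¹ p i * M.Ea θ i)) := by
    simp only [Experiment.Delta0, dotProduct, Matrix.mulVec, Finset.mul_sum, M.inv_A_apply hd]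
    refine Finset.sum_congr rfl fun p _ => Finset.sum_congr rfl fun i _ => ?_
    ring
  have h1 : M.dstar ^ 2 * M.Delta1 η θ = (∑ p, ∑ i, (M.dstar ^ 2 / (M.d p * M.d i)) *
        (gradVec η θ p * ((M.Q θ)⁻¹ p i * M.Ea θ i))) +
      (∑ p, ∑ i, ∑ j, ∑ k, (M.dstar ^ 2 / (M.d p * (√(M.d i) * √(M.d j)))) *
        (gradVec η θ p * ((M.Q θ)⁻¹ p i * ((M.Q θ)⁻¹ j k * M.U2 θ i j k)))) := by
    simp only [Experiment.Delta1, (M.expect_FAa hd hA hE _).2]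
    simp only [dotProduct, Matrix.mulVec,
      Finset.mul_sum, M.inv_A_apply hd, ← Finset.sum_add_distrib, mul_add]
    refine Finset.sum_congr rfl fun p _ => Finset.sum_congr rfl fun i _ => ?_
    rw [add_comm]
    congr 1
    · ring
    · refine Finset.sum_congr rfl fun j _ => Finset.sum_congr rfl fun k _ => ?_
      have e1 := Real.mul_self_sqrt (hd i).le
      have e2 := Real.mul_self_sqrt (hd j).le
      have := hne p; have := hne k; have := hsq i; have := hsq j
      rw [show M.d i = √(M.d i) * √(M.d i) from e1.symm,
        show M.d j = √(M.d j) * √(M.d j) from e2.symm]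
      simp only [Real.sqrt_mul_self (Real.sqrt_nonneg _)]
      field_simp
  have h2 : M.dstar ^ 2 * M.Delta2 η θ =
      ∑ l, ∑ m, ∑ q, ∑ p, (1 / 2 * (M.dstar ^ 2 / (M.d p * M.d q))) *
        ((M.Q θ)⁻¹ l p * (hessMat η θ p q * ((M.Q θ)⁻¹ q m * M.U1 θ l m))) := by
    simp only [Experiment.Delta2, (M.expect_aBa hd hE _).2]
    simp only [Matrix.mul_apply,
      Finset.mul_sum, Finset.sum_mul, M.inv_A_apply hd]
    refine Finset.sum_congr rfl fun l _ => Finset.sum_congr rfl fun m _ =>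
      Finset.sum_congr rfl fun q _ => Finset.sum_congr rfl fun p _ => ?_
    have := hne p; have := hne q; have := hne l; have := hne m
    field_simp
  have h3 : M.dstar ^ 2 * M.Delta3 η θ =
      ∑ p, ∑ i, ∑ k, ∑ m, ∑ j, ∑ l, (-(1 / 2) * (M.dstar ^ 2 / (M.d p * M.d i))) *
        (gradVec η θ p * ((M.Q θ)⁻¹ p i * ((M.Q θ)⁻¹ l j *
          ((M.Q θ)⁻¹ k m * M.U3 θ i j l k m)))) := by
    simp only [Experiment.Delta3, (M.expect_CAa hd hE _).2]
    simp only [dotProduct, Matrix.mulVec,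
      Finset.mul_sum, M.inv_A_apply hd]
    refine Finset.sum_congr rfl fun p _ => Finset.sum_congr rfl fun i _ =>
      Finset.sum_congr rfl fun k _ => Finset.sum_congr rfl fun m _ =>
      Finset.sum_congr rfl fun j _ => Finset.sum_congr rfl fun l _ => ?_
    have := hne p; have := hne i; have := hne l; have := hne m; have := hne j; have := hne k
    field_simp
  rw [Experiment.bias, mul_add, mul_add, mul_add, h0, h1, h2, h3]
  simp only [neg_mul, Finset.sum_neg_distrib]
  ring

end Bias

section EnvelopeExpectation

variable {s : ℕ} {M : Experiment.{u, v} s} {σ : Param s} {δ : ℝ}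

theorem Experiment.enorm_le_envelope_rpow (hd : ∀ i, 0 < M.d i) (hd' : 0 < M.dstar) {g : ℝ} {p : ℕ}
    (hg : 0 < g) (hp : (p : ℝ) ≤ g) {f : M.𝒴 → ℝ} (h : ∀ y x, M.Dominates σ δ y x → |f y| ≤ x ^ p)
    (y : M.𝒴) : ‖f y‖ₑ ≤ M.envelope σ δ y ^ g := by
  by_cases ht : M.envelope σ δ y = ∞
  · rw [ht, ENNReal.top_rpow_of_pos hg]; exact le_top
  · have hdom := M.dominates_envelope hd hd' ht
    have h1 := h y _ hdom
    have hx := hdom.one_le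
    rw [Real.enorm_eq_ofReal_abs, ← ENNReal.ofReal_toReal ht,
      ENNReal.ofReal_rpow_of_nonneg (by linarith) hg.le]
    refine ENNReal.ofReal_le_ofReal (h1.trans ?_)
    rw [← Real.rpow_natCast]
    exact Real.rpow_le_rpow_of_exponent_le hx hp

theorem Experiment.abs_expect_le (hd : ∀ i, 0 < M.d i) (hd' : 0 < M.dstar) {g : ℝ} {p : ℕ}
    (hg : 0 < g) (hp : (p : ℝ) ≤ g) {f : M.𝒴 → ℝ} (h : ∀ y x, M.Dominates σ δ y x → |f y| ≤ x ^ p)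
    {K : ℝ≥0} (hK : ∫⁻ ω, M.envelope σ δ (M.Y ω) ^ g ∂(M.P σ) ≤ K) :
    |M.expect σ f| ≤ K := by
  have h1 : ‖M.expect σ f‖ₑ ≤ K :=
    (enorm_integral_le_lintegral_enorm _).trans ((lintegral_mono fun ω =>
      M.enorm_le_envelope_rpow hd hd' hg hp h (M.Y ω)).trans hK)
  rw [Real.enorm_eq_ofReal_abs, ← ENNReal.ofReal_coe_nnreal] at h1
  exact (ENNReal.ofReal_le_ofReal_iff K.2).1 h1

theorem Experiment.Dominates.lam1_le {y : M.𝒴} {x : ℝ} (h : M.Dominates σ δ y x)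
    (hd : ∀ i, 0 < M.d i) (i : Fin s) : |M.lam1 i σ y| ≤ x := by
  rw [Experiment.lam1, abs_div, abs_of_pos (hd i), div_le_iff₀ (hd i)]
  exact h.a_le i

theorem Experiment.Dominates.lam2_le {y : M.𝒴} {x : ℝ} (h : M.Dominates σ δ y x)
    (hd : ∀ i, 0 < M.d i) (i j : Fin s) : |M.lam2 i j σ y| ≤ x := by
  have h0 : 0 < √(M.d i) * √(M.d j) :=
    mul_pos (Real.sqrt_pos.2 (hd i)) (Real.sqrt_pos.2 (hd j))
  rw [Experiment.lam2, abs_div, abs_of_pos h0, div_le_iff₀ h0]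
  exact h.F_le i j

theorem Experiment.Dominates.lam3_le {y : M.𝒴} {x : ℝ} (h : M.Dominates σ δ y x)
    (hd : ∀ i, 0 < M.d i) (i j k : Fin s) : |M.lam3 i j k σ y| ≤ x := by
  have h0 : 0 < M.d j * M.d k := mul_pos (hd j) (hd k)
  rw [Experiment.lam3, abs_div, abs_of_pos h0, div_le_iff₀ h0]
  exact h.l3_self_le i j k

theorem Experiment.abs_U1_le (hd : ∀ i, 0 < M.d i) (hd' : 0 < M.dstar) {g : ℝ} (hg : 3 ≤ g)
    {K : ℝ≥0} (hK : ∫⁻ ω, M.envelope σ δ (M.Y ω) ^ g ∂(M.P σ) ≤ K) (i l : Fin s) :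
    |M.U1 σ i l| ≤ K := by
  change |M.expect σ fun y => M.lam1 i σ y * M.lam1 l σ y| ≤ K
  refine M.abs_expect_le (p := 2) hd hd' (by linarith) (by push_cast; linarith)
    (fun y x h => ?_) hK
  rw [abs_mul, sq]
  exact mul_le_mul (h.lam1_le hd i) (h.lam1_le hd l) (abs_nonneg _) (by linarith [h.one_le])

theorem Experiment.abs_U2_le (hd : ∀ i, 0 < M.d i) (hd' : 0 < M.dstar) {g : ℝ} (hg : 3 ≤ g)
    {K : ℝ≥0} (hK : ∫⁻ ω, M.envelope σ δ (M.Y ω) ^ g ∂(M.P σ) ≤ K) (j k l : Fin s) :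
    |M.U2 σ j k l| ≤ K := by
  change |M.expect σ fun y => M.lam2 j k σ y * M.lam1 l σ y| ≤ K
  refine M.abs_expect_le (p := 2) hd hd' (by linarith) (by push_cast; linarith)
    (fun y x h => ?_) hK
  rw [abs_mul, sq]
  exact mul_le_mul (h.lam2_le hd j k) (h.lam1_le hd l) (abs_nonneg _) (by linarith [h.one_le])

theorem Experiment.abs_U3_le (hd : ∀ i, 0 < M.d i) (hd' : 0 < M.dstar) {g : ℝ} (hg : 3 ≤ g)
    {K : ℝ≥0} (hK : ∫⁻ ω, M.envelope σ δ (M.Y ω) ^ g ∂(M.P σ) ≤ K) (j k l m n : Fin s) :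
    |M.U3 σ j k l m n| ≤ K := by
  change |M.expect σ fun y => M.lam3 j k m σ y * M.lam1 l σ y * M.lam1 n σ y| ≤ K
  refine M.abs_expect_le (p := 3) hd hd' (by linarith) (by push_cast; linarith)
    (fun y x h => ?_) hK
  have hx := h.one_le
  rw [abs_mul, abs_mul, pow_succ, sq]
  exact mul_le_mul (mul_le_mul (h.lam3_le hd j k m) (h.lam1_le hd l) (abs_nonneg _)
    (by linarith)) (h.lam1_le hd n) (abs_nonneg _) (by positivity)

end EnvelopeExpectation

section TameFamilies

variable {s : ℕ} {M : ℕ → Experiment.{u, v} s} {σ : Param s}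

theorem exists_uniform_bound₃ {α : Type*} {p : α → Prop} {f : Fin s → Fin s → Fin s → α → ℝ}
    (h : ∀ i j k, ∃ K : ℝ, ∀ x, p x → |f i j k x| ≤ K) :
    ∃ K : ℝ, 0 ≤ K ∧ ∀ i j k x, p x → |f i j k x| ≤ K := by
  choose K hK using h
  refine ⟨∑ q : Fin s × Fin s × Fin s, |K q.1 q.2.1 q.2.2|,
    Finset.sum_nonneg fun _ _ => abs_nonneg _, fun i j k x hx => ?_⟩
  refine (hK i j k x hx).trans ((le_abs_self _).trans ?_)
  exact Finset.single_le_sum (f := fun q : Fin s × Fin s × Fin s => |K q.1 q.2.1 q.2.2|)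
    (fun _ _ => abs_nonneg _) (Finset.mem_univ (i, j, k))

theorem Experiment.abs_sub_le_of_abs_pderiv_le {M : Experiment.{u, v} s} (hd : ∀ i, 0 < M.d i)
    {U : Set (Param s)} (hU : IsOpen U) {δ r K : ℝ} (hr : 0 ≤ r) (hrδ : r ≤ δ)
    (hbox : M.box σ δ ⊆ U) {f : Param s → ℝ} (hf : DifferentiableOn ℝ f U)
    (hK : ∀ i, ∀ θ ∈ M.box σ δ, |pderiv i f θ| ≤ K) {θ : Param s} (hθ : θ ∈ M.box σ r) :
    |f θ - f σ| ≤ s * (r * K) := by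
  have hseg : ∀ t ∈ Set.Icc (0 : ℝ) 1, σ + t • (θ - σ) ∈ M.box σ δ := fun t ht =>
    M.box_mono hd hrδ (M.segment_mem_box (M.self_mem_box hd hr) hθ ht)
  have := taylor_one_abs_le hU hf σ (θ - σ) (fun t ht => hbox (hseg t ht)) (C := s * (r * K))
    fun t ht => by
      refine (Finset.abs_sum_le_sum_abs _ _).trans ?_
      have : ∀ i ∈ Finset.univ, |(θ - σ) i * pderiv i f (σ + t • (θ - σ))| ≤ r * K := by
        intro i _
        rw [abs_mul]
        exact mul_le_mul (M.abs_sub_le_of_mem_box hd hr hθ i) (hK i _ (hseg t ht))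
          (abs_nonneg _) hr
      refine (Finset.sum_le_sum this).trans ?_
      simp
  simpa using this

theorem Tame.of_abs_pderiv_le (hd : ∀ n i, 0 < (M n).d i) {U : Set (Param s)} (hU : IsOpen U)
    {δ K L : ℝ} (hδ : 0 < δ) (hK0 : 0 ≤ K) (hbox : ∀ n, (M n).box σ δ ⊆ U)
    {f : ℕ → Param s → ℝ} (hf : ∀ n, DifferentiableOn ℝ (f n) U)
    (hL : ∀ n, |f n σ| ≤ L)
    (hK : ∀ n i, ∀ θ ∈ (M n).box σ δ, |pderiv i (f n) θ| ≤ K) : Tame M σ f := by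
  refine ⟨⟨L, Eventually.of_forall hL⟩, fun ε hε => ?_⟩
  have hpos : 0 < s * K + 1 := by positivity
  refine ⟨min δ (ε / (s * K + 1)), lt_min hδ (div_pos hε hpos), Eventually.of_forall
    fun n θ hθ => ?_⟩
  have hr0 : 0 ≤ min δ (ε / (s * K + 1)) := (lt_min hδ (div_pos hε hpos)).le
  refine ((M n).abs_sub_le_of_abs_pderiv_le (hd n) hU hr0 (min_le_left _ _) (hbox n) (hf n)
    (hK n) hθ).trans ?_
  have h1 : min δ (ε / (s * K + 1)) * (s * K + 1) ≤ ε :=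
    (le_div_iff₀ hpos).1 (min_le_right _ _)
  nlinarith

/-- Uniform bounds for a function of the parameter and for its derivatives up to order three. -/
structure SmoothBound (M : ℕ → Experiment.{u, v} s) (σ : Param s) (δ : ℝ) (η : ℕ → Param s → ℝ)
    (K : ℝ) : Prop where
  nonneg : 0 ≤ K
  zero_le : ∀ n, ∀ θ ∈ (M n).box σ δ, |η n θ| ≤ K
  one_le : ∀ i n, ∀ θ ∈ (M n).box σ δ, |pderiv i (η n) θ| ≤ K
  two_le : ∀ i j n, ∀ θ ∈ (M n).box σ δ, |pderiv i (pderiv j (η n)) θ| ≤ K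
  three_le : ∀ i j k n, ∀ θ ∈ (M n).box σ δ, |pderiv i (pderiv j (pderiv k (η n))) θ| ≤ K

theorem exists_smoothBound (hd : ∀ n i, 0 < (M n).d i) {U : Set (Param s)} (hU : IsOpen U)
    {δ : ℝ} (hδ : 0 < δ) (hbox : ∀ n, (M n).box σ δ ⊆ U) {η : ℕ → Param s → ℝ}
    (hη : ∀ n, ContDiffOn ℝ 3 (η n) U)
    (hη0 : ∃ K : ℝ, ∀ n, |η n σ| ≤ K)
    (hη1 : ∃ K : ℝ, ∀ n, vecNorm (gradVec (η n) σ) ≤ K)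
    (hη2 : ∃ K : ℝ, ∀ n, specNorm (hessMat (η n) σ) ≤ K)
    (hη3 : ∀ i j k, ∃ K : ℝ, ∀ n, ∀ θ ∈ (M n).box σ δ,
      |pderiv i (pderiv j (pderiv k (η n))) θ| ≤ K) :
    ∃ K, SmoothBound M σ δ η K := by
  obtain ⟨K₀, h0⟩ := hη0
  obtain ⟨K₁, h1⟩ := hη1
  obtain ⟨K₂, h2⟩ := hη2
  obtain ⟨K₃, hK3, h3⟩ := exists_uniform_bound₃ (α := ℕ × Param s)
    (p := fun x => x.2 ∈ (M x.1).box σ δ)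
    (f := fun i j k x => pderiv i (pderiv j (pderiv k (η x.1))) x.2)
    (fun i j k => by
      obtain ⟨K, hK⟩ := hη3 i j k
      exact ⟨K, fun x hx => hK x.1 x.2 hx⟩)
  have step : ∀ (f : ℕ → Param s → ℝ) (L K : ℝ), 0 ≤ K → (∀ n, DifferentiableOn ℝ (f n) U) →
      (∀ n, |f n σ| ≤ L) → (∀ n i, ∀ θ ∈ (M n).box σ δ, |pderiv i (f n) θ| ≤ K) →
      ∀ n, ∀ θ ∈ (M n).box σ δ, |f n θ| ≤ |L| + s * (δ * K) := by
    intro f L K hK hf hL hd1 n θ hθ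
    have h := (M n).abs_sub_le_of_abs_pderiv_le (hd n) hU hδ.le le_rfl (hbox n) (hf n) (hd1 n) hθ
    calc |f n θ| = |f n σ + (f n θ - f n σ)| := by ring_nf
      _ ≤ |f n σ| + |f n θ - f n σ| := abs_add_le _ _
      _ ≤ _ := add_le_add ((hL n).trans (le_abs_self L)) h
  have c1 : ∀ n k, ContDiffOn ℝ 2 (pderiv k (η n)) U := fun n k =>
    contDiffOn_pderiv hU (hη n) (by norm_num) k
  have c2 : ∀ n j k, ContDiffOn ℝ 1 (pderiv j (pderiv k (η n))) U := fun n j k =>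
    contDiffOn_pderiv hU (c1 n k) (by norm_num) j
  set L2 := |K₂| + s * (δ * K₃)
  have b2 : ∀ j k n, ∀ θ ∈ (M n).box σ δ, |pderiv j (pderiv k (η n)) θ| ≤ L2 := fun j k =>
    step (fun n => pderiv j (pderiv k (η n))) K₂ K₃ hK3
      (fun n => (c2 n j k).differentiableOn (by norm_num))
      (fun n => (abs_apply_le_specNorm (hessMat (η n) σ) j k).trans (h2 n))
      (fun n i θ hθ => h3 i j k (n, θ) hθ)
  have hL2 : 0 ≤ L2 := by positivity
  set L1 := |K₁| + s * (δ * L2)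
  have b1 : ∀ k n, ∀ θ ∈ (M n).box σ δ, |pderiv k (η n) θ| ≤ L1 := fun k =>
    step (fun n => pderiv k (η n)) K₁ L2 hL2 (fun n => (c1 n k).differentiableOn (by norm_num))
      (fun n => (abs_apply_le_vecNorm (gradVec (η n) σ) k).trans (h1 n))
      (fun n i θ hθ => b2 i k n θ hθ)
  have hL1 : 0 ≤ L1 := by positivity
  set L0 := |K₀| + s * (δ * L1)
  have b0 : ∀ n, ∀ θ ∈ (M n).box σ δ, |η n θ| ≤ L0 :=
    step η K₀ L1 hL1 (fun n => (hη n).differentiableOn (by norm_num)) h0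
      (fun n i θ hθ => b1 i n θ hθ)
  have hL0 : 0 ≤ L0 := by positivity
  refine ⟨L0 + L1 + L2 + K₃, by positivity, fun n θ hθ => ?_, fun i n θ hθ => ?_,
    fun i j n θ hθ => ?_, fun i j k n θ hθ => ?_⟩
  · linarith [b0 n θ hθ]
  · linarith [b1 i n θ hθ]
  · linarith [b2 i j n θ hθ]
  · linarith [h3 i j k (n, θ) hθ]

theorem SmoothBound.tame_grad {U : Set (Param s)} {δ K : ℝ} {η : ℕ → Param s → ℝ}
    (h : SmoothBound M σ δ η K) (hd : ∀ n i, 0 < (M n).d i) (hU : IsOpen U) (hδ : 0 < δ)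
    (hbox : ∀ n, (M n).box σ δ ⊆ U) (hη : ∀ n, ContDiffOn ℝ 3 (η n) U) (p : Fin s) :
    Tame M σ fun n θ => gradVec (η n) θ p :=
  Tame.of_abs_pderiv_le hd hU hδ h.nonneg hbox
    (fun n => (contDiffOn_pderiv hU (hη n) (m := 2) (by norm_num) p).differentiableOn
      (by norm_num))
    (fun n => h.one_le p n σ ((M n).self_mem_box (hd n) hδ.le))
    (fun n i θ hθ => h.two_le i p n θ hθ)

theorem SmoothBound.tame_hess {U : Set (Param s)} {δ K : ℝ} {η : ℕ → Param s → ℝ}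
    (h : SmoothBound M σ δ η K) (hd : ∀ n i, 0 < (M n).d i) (hU : IsOpen U) (hδ : 0 < δ)
    (hbox : ∀ n, (M n).box σ δ ⊆ U) (hη : ∀ n, ContDiffOn ℝ 3 (η n) U) (p q : Fin s) :
    Tame M σ fun n θ => hessMat (η n) θ p q :=
  Tame.of_abs_pderiv_le hd hU hδ h.nonneg hbox
    (fun n => (contDiffOn_pderiv hU (contDiffOn_pderiv hU (hη n) (m := 2) (by norm_num) q)
      (m := 1) (by norm_num) p).differentiableOn (by norm_num))
    (fun n => h.two_le p q n σ ((M n).self_mem_box (hd n) hδ.le))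
    (fun n i θ hθ => h.three_le i p q n θ hθ)

theorem eventually_isNegDefBy_Q (hd : ∀ n i, 0 < (M n).d i) (hsymm : ∀ n, ((M n).A σ).IsSymm)
    (hlam_neg : limsup (fun n => ((lambdaMax ((M n).Q σ) : ℝ) : EReal)) atTop < 0) :
    ∃ m > 0, ∀ᶠ n in atTop, IsNegDefBy m ((M n).Q σ) := by
  obtain ⟨r, hr1, hr2⟩ := EReal.lt_iff_exists_real_btwn.1 hlam_neg
  refine ⟨-r, by simpa using hr2, ?_⟩
  filter_upwards [eventually_lt_of_limsup_lt hr1] with n hn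
  refine isNegDefBy_of_lambdaMax_le ((M n).Q_isSymm (hd n) (hsymm n)) ?_
  rw [neg_neg]
  exact (EReal.coe_lt_coe_iff.1 hn).le

theorem exists_isNegDefBy_Q_box (hQ : VanishesUniformly M σ fun n θ => specNorm ((M n).Q θ - (M n).Q σ))
    {m : ℝ} (hm : 0 < m) (h : ∀ᶠ n in atTop, IsNegDefBy m ((M n).Q σ)) :
    ∃ δ > 0, ∀ᶠ n in atTop, ∀ θ ∈ (M n).box σ δ, IsNegDefBy (m / 2) ((M n).Q θ) := by
  obtain ⟨δ, hδ, hQ⟩ := hQ (m / 2 / (s + 1)) (by positivity)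
  refine ⟨δ, hδ, ?_⟩
  filter_upwards [h] with n hn θ hθ
  refine hn.of_close (ε := m / 2 / (s + 1)) (fun i j => ?_) ?_
  · exact (abs_apply_le_specNorm ((M n).Q θ - (M n).Q σ) i j).trans (hQ n θ hθ)
  · rw [mul_div_assoc', div_le_iff₀ (by positivity)]
    nlinarith

theorem abs_sum_sum_le {ι : Type*} [Fintype ι] {f : ι → ι → ℝ} {C : ℝ} (h : ∀ i j, |f i j| ≤ C) :
    |∑ i, ∑ j, f i j| ≤ Fintype.card ι * (Fintype.card ι * C) := by
  refine (Finset.abs_sum_le_sum_abs _ _).trans ?_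
  have : ∀ i ∈ Finset.univ, |∑ j, f i j| ≤ Fintype.card ι * C := fun i _ => by
    refine (Finset.abs_sum_le_sum_abs _ _).trans ((Finset.sum_le_sum fun j _ => h i j).trans ?_)
    simp
  refine (Finset.sum_le_sum this).trans ?_
  simp

theorem tame_inv_Q (hd : ∀ n i, 0 < (M n).d i)
    (hQ : VanishesUniformly M σ fun n θ => specNorm ((M n).Q θ - (M n).Q σ))
    {m : ℝ} (hm : 0 < m) (h : ∀ᶠ n in atTop, IsNegDefBy m ((M n).Q σ)) (i j : Fin s) :
    Tame M σ fun n θ => ((M n).Q θ)⁻¹ i j := by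
  obtain ⟨δ₁, hδ₁, h1⟩ := exists_isNegDefBy_Q_box hQ hm h
  refine ⟨⟨1 / m, ?_⟩, fun ε hε => ?_⟩
  · filter_upwards [h] with n hn
    exact hn.abs_inv_apply_le hm i j
  · have hm2 : 0 < m / 2 := half_pos hm
    set c : ℝ := s * (s * (1 / (m / 2) * 1 * (1 / m))) with hc
    have hc0 : 0 ≤ c := by positivity
    obtain ⟨δ₂, hδ₂, h2⟩ := hQ (ε / (c + 1)) (by positivity)
    refine ⟨min δ₁ δ₂, lt_min hδ₁ hδ₂, ?_⟩
    filter_upwards [h, h1] with n hn h1 θ hθ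
    have e1 := h1 θ ((M n).box_mono (hd n) (min_le_left _ _) hθ)
    have e2 := h2 n θ ((M n).box_mono (hd n) (min_le_right _ _) hθ)
    have eq : ((M n).Q θ)⁻¹ - ((M n).Q σ)⁻¹ =
        -(((M n).Q θ)⁻¹ * ((M n).Q θ - (M n).Q σ) * ((M n).Q σ)⁻¹) := by
      rw [Matrix.mul_sub, Matrix.nonsing_inv_mul _ (e1.isUnit_det hm2), Matrix.sub_mul,
        Matrix.one_mul, Matrix.mul_assoc, Matrix.mul_nonsing_inv _ (hn.isUnit_det hm),
        Matrix.mul_one, neg_sub]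
    have eq' : ((M n).Q θ)⁻¹ i j - ((M n).Q σ)⁻¹ i j = -∑ q, ∑ p,
        ((M n).Q θ)⁻¹ i p * ((M n).Q θ - (M n).Q σ) p q * ((M n).Q σ)⁻¹ q j := by
      rw [← Matrix.sub_apply, eq, Matrix.neg_apply, Matrix.mul_apply]
      simp only [Matrix.mul_apply, Finset.sum_mul]
    rw [eq', abs_neg]
    refine (abs_sum_sum_le (C := 1 / (m / 2) * (ε / (c + 1)) * (1 / m)) fun q p => ?_).trans ?_
    · rw [abs_mul, abs_mul]
      have b1 := e1.abs_inv_apply_le hm2 i p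
      have b2 := hn.abs_inv_apply_le hm q j
      have b3 := (abs_apply_le_specNorm ((M n).Q θ - (M n).Q σ) p q).trans e2
      gcongr
    · rw [Fintype.card_fin]
      have : (s : ℝ) * (s * (1 / (m / 2) * (ε / (c + 1)) * (1 / m))) = c * ε / (c + 1) := by
        rw [hc]; ring
      rw [this, div_le_iff₀ (by positivity)]
      nlinarith

theorem tame_bias (hd : ∀ n i, 0 < (M n).d i) (hdpos : ∀ n, 0 ≤ (M n).dstar)
    {η : ℕ → Param s → ℝ} {δ : ℝ} (hδ : 0 < δ)
    (hreg : ∀ᶠ n in atTop, ∀ θ ∈ (M n).box σ δ,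
      IsUnit ((M n).A θ).det ∧ (M n).ExpectationsExist θ)
    (tb : ∀ p, Tame M σ fun n θ => gradVec (η n) θ p)
    (tB : ∀ p q, Tame M σ fun n θ => hessMat (η n) θ p q)
    (tW : ∀ i j, Tame M σ fun n θ => ((M n).Q θ)⁻¹ i j)
    (tE : ∀ i, Tame M σ fun n θ => (M n).Ea θ i)
    (tU1 : ∀ i j, Tame M σ fun n θ => (M n).U1 θ i j)
    (tU2 : ∀ i j k, Tame M σ fun n θ => (M n).U2 θ i j k)
    (tU3 : ∀ i j k l m, Tame M σ fun n θ => (M n).U3 θ i j k l m) :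
    Tame M σ fun n θ => (M n).dstar ^ 2 * (M n).bias (η n) θ := by
  have w1 : ∀ p i n, |(M n).dstar ^ 2 / ((M n).d p * (M n).d i)| ≤ 1 := fun p i n => by
    have h1 := hd n p; have h2 := hd n i
    rw [abs_of_nonneg (by positivity), div_le_one (by positivity), sq]
    exact mul_le_mul ((M n).dstar_le p) ((M n).dstar_le i) (hdpos n) h1.le
  have w2 : ∀ p i j n, |(M n).dstar ^ 2 / ((M n).d p * (√((M n).d i) * √((M n).d j)))| ≤ 1 :=
    fun p i j n => by
      have h1 := hd n p
      have h2 := Real.sqrt_pos.2 (hd n i); have h3 := Real.sqrt_pos.2 (hd n j)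
      rw [abs_of_nonneg (by positivity), div_le_one (by positivity), sq]
      refine mul_le_mul ((M n).dstar_le p) ?_ (hdpos n) h1.le
      rw [← Real.mul_self_sqrt (hdpos n)]
      exact mul_le_mul (Real.sqrt_le_sqrt ((M n).dstar_le i))
        (Real.sqrt_le_sqrt ((M n).dstar_le j)) (Real.sqrt_nonneg _) h2.le
  refine Tame.congr hd ?_ hδ (hreg.mono fun n hn θ hθ =>
    (M n).dstar_sq_mul_bias (hd n) (hn θ hθ).1 (hn θ hθ).2 (η n))
  refine Tame.add hd (Tame.add hd (Tame.add hd ?_ ?_) ?_) ?_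
  · refine Tame.sum hd _ fun p => Tame.sum hd _ fun i => Tame.mul hd
      (Tame.const (K := 1) (Eventually.of_forall fun n => ?_)) ?_
    · rw [abs_neg]; exact w1 p i n
    · exact (tb p).mul hd ((tW p i).mul hd (tE i))
  · refine Tame.sum hd _ fun p => Tame.sum hd _ fun i => Tame.sum hd _ fun j =>
      Tame.sum hd _ fun k => Tame.mul hd
      (Tame.const (K := 1) (Eventually.of_forall fun n => w2 p i j n)) ?_
    exact (tb p).mul hd ((tW p i).mul hd ((tW j k).mul hd (tU2 i j k)))
  · refine Tame.sum hd _ fun l => Tame.sum hd _ fun m => Tame.sum hd _ fun q =>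
      Tame.sum hd _ fun p => Tame.mul hd
      (Tame.const (K := 1) (Eventually.of_forall fun n => ?_)) ?_
    · rw [abs_mul]
      have := w1 p q n
      rw [abs_of_pos (by norm_num : (0 : ℝ) < 1 / 2)]
      linarith
    · exact (tW l p).mul hd ((tB p q).mul hd ((tW q m).mul hd (tU1 l m)))
  · refine Tame.sum hd _ fun p => Tame.sum hd _ fun i => Tame.sum hd _ fun k =>
      Tame.sum hd _ fun m => Tame.sum hd _ fun j => Tame.sum hd _ fun l => Tame.mul hd
      (Tame.const (K := 1) (Eventually.of_forall fun n => ?_)) ?_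
    · rw [abs_mul]
      have := w1 p i n
      rw [abs_neg, abs_of_pos (by norm_num : (0 : ℝ) < 1 / 2)]
      linarith
    · exact (tb p).mul hd ((tW p i).mul hd ((tW l j).mul hd ((tW k m).mul hd (tU3 i j l k m))))

end TameFamilies

section RootExpansion

variable {s : ℕ}

theorem abs_sum_mul_le {w h : Fin s → ℝ} {c : ℝ} (hw : ∀ i, |w i| ≤ c) :
    |∑ i, w i * h i| ≤ c * ∑ i, |h i| := by
  rw [Finset.mul_sum]
  refine (Finset.abs_sum_le_sum_abs _ _).trans (Finset.sum_le_sum fun i _ => ?_)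
  rw [abs_mul]
  exact mul_le_mul_of_nonneg_right (hw i) (abs_nonneg _)

theorem abs_sum_sum_mul_le {w : Fin s → Fin s → ℝ} {h k : Fin s → ℝ} {c : ℝ}
    (hw : ∀ i j, |w i j| ≤ c) :
    |∑ i, ∑ j, w i j * h i * k j| ≤ c * ((∑ i, |h i|) * ∑ j, |k j|) := by
  rw [Finset.sum_mul_sum, Finset.mul_sum]
  refine (Finset.abs_sum_le_sum_abs _ _).trans (Finset.sum_le_sum fun i _ => ?_)
  rw [Finset.mul_sum]
  refine (Finset.abs_sum_le_sum_abs _ _).trans (Finset.sum_le_sum fun j _ => ?_)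
  rw [abs_mul, abs_mul, mul_assoc]
  exact mul_le_mul_of_nonneg_right (hw i j) (by positivity)

theorem abs_quadratic_sub_le {w : Fin s → Fin s → ℝ} {h k : Fin s → ℝ} {c : ℝ}
    (hw : ∀ i j, |w i j| ≤ c) :
    |∑ i, ∑ j, w i j * h i * h j - ∑ i, ∑ j, w i j * k i * k j| ≤
      c * ((∑ i, |h i - k i|) * (∑ i, |h i| + ∑ i, |k i|)) := by
  have e : ∑ i, ∑ j, w i j * h i * h j - ∑ i, ∑ j, w i j * k i * k j =
      ∑ i, ∑ j, w i j * h i * (h j - k j) + ∑ i, ∑ j, w i j * (h i - k i) * k j := by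
    simp only [← Finset.sum_sub_distrib, ← Finset.sum_add_distrib]
    refine Finset.sum_congr rfl fun i _ => Finset.sum_congr rfl fun j _ => ?_
    ring
  rw [e]
  refine (abs_add_le _ _).trans ?_
  have h1 := abs_sum_sum_mul_le (h := h) (k := fun j => h j - k j) hw
  have h2 := abs_sum_sum_mul_le (h := fun j => h j - k j) (k := k) hw
  refine (add_le_add h1 h2).trans (le_of_eq ?_)
  ring

theorem sum_abs_mulVec_le {W : Matrix (Fin s) (Fin s) ℝ} {e : Fin s → ℝ} {κ c : ℝ}
    (hW : ∀ i j, |W i j| ≤ κ) (hκ : 0 ≤ κ) (he : ∀ i, |e i| ≤ c) :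
    ∑ p, |(W *ᵥ e) p| ≤ (s : ℝ) ^ 2 * κ * c := by
  have h1 : ∀ p ∈ Finset.univ, |(W *ᵥ e) p| ≤ s * (κ * c) := fun p _ => by
    refine (abs_sum_mul_le (hW p)).trans ?_
    have : ∑ i, |e i| ≤ s * c := (Finset.sum_le_sum fun i _ => he i).trans (by simp)
    calc κ * ∑ i, |e i| ≤ κ * (s * c) := mul_le_mul_of_nonneg_left this hκ
      _ = s * (κ * c) := by ring
  refine (Finset.sum_le_sum h1).trans (le_of_eq ?_)
  simp only [Finset.sum_const, Finset.card_univ, Fintype.card_fin, nsmul_eq_mul]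
  ring

/-- The linear and quadratic terms `G h + ½ T[h, h]`. -/
noncomputable def secondOrder (G : Matrix (Fin s) (Fin s) ℝ) (T : Fin s → Fin s → Fin s → ℝ)
    (h : Fin s → ℝ) (i : Fin s) : ℝ :=
  ∑ j, G i j * h j + 1 / 2 * ∑ j, ∑ k, T i j k * h j * h k

theorem abs_secondOrder_le {G : Matrix (Fin s) (Fin s) ℝ} {T : Fin s → Fin s → Fin s → ℝ}
    {h : Fin s → ℝ} {c : ℝ} (hc : 0 ≤ c) (hG : ∀ i j, |G i j| ≤ c) (hT : ∀ i j k, |T i j k| ≤ c)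
    (i : Fin s) : |secondOrder G T h i| ≤ c * (∑ j, |h j| + (∑ j, |h j|) ^ 2) := by
  have h1 := abs_sum_mul_le (h := h) (hG i)
  have h2 := abs_sum_sum_mul_le (h := h) (k := h) (hT i)
  refine (abs_add_le _ _).trans ?_
  rw [abs_mul, abs_of_pos (by norm_num : (0 : ℝ) < 1 / 2)]
  have : 0 ≤ c * ((∑ j, |h j|) * ∑ j, |h j|) :=
    mul_nonneg hc (mul_self_nonneg _)
  nlinarith

theorem abs_secondOrder_sub_le {G : Matrix (Fin s) (Fin s) ℝ} {T : Fin s → Fin s → Fin s → ℝ}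
    {h k : Fin s → ℝ} {c : ℝ} (hG : ∀ i j, |G i j| ≤ c) (hT : ∀ i j k, |T i j k| ≤ c)
    (hc : 0 ≤ c) (i : Fin s) : |secondOrder G T h i - secondOrder G T k i| ≤
      c * ((∑ j, |h j - k j|) * (1 + (∑ j, |h j| + ∑ j, |k j|))) := by
  have h1 := abs_sum_mul_le (h := fun j => h j - k j) (hG i)
  have h2 := abs_quadratic_sub_le (h := h) (k := k) (hT i)
  have e : secondOrder G T h i - secondOrder G T k i = ∑ j, G i j * (h j - k j) +
      1 / 2 * (∑ i', ∑ j, T i i' j * h i' * h j - ∑ i', ∑ j, T i i' j * k i' * k j) := by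
    simp only [secondOrder, mul_sub, Finset.sum_sub_distrib]
    ring
  rw [e]
  refine (abs_add_le _ _).trans ?_
  rw [abs_mul, abs_of_pos (by norm_num : (0 : ℝ) < 1 / 2)]
  have : 0 ≤ c * ((∑ j, |h j - k j|) * (∑ j, |h j| + ∑ j, |k j|)) := by positivity
  nlinarith

/-- Second-order expansion of a small root `h` of `α + W⁻¹ h + G h + ½ T[h, h] + R = 0`. -/
theorem exists_root_expansion (s : ℕ) {κ : ℝ} (hκ : 0 ≤ κ) :
    ∃ ε > 0, ∃ C ≥ 0, ∀ (W G : Matrix (Fin s) (Fin s) ℝ) (T : Fin s → Fin s → Fin s → ℝ)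
      (α h R : Fin s → ℝ) (x d : ℝ), 1 ≤ x → 1 ≤ d → (∀ i j, |W i j| ≤ κ) → (∀ i, |α i| ≤ x) →
      (∀ i j, |G i j| ≤ x / d) → (∀ i j k, |T i j k| ≤ x / d) →
      (∀ i, |R i| ≤ x / d ^ 2 * (∑ j, |h j|) ^ 3) →
      x * (1 + ∑ j, |h j|) ≤ ε * d → x * (∑ j, |h j|) ^ 2 ≤ ε * d ^ 2 →
      h = -(W *ᵥ (α + secondOrder G T h + R)) →
      ∑ j, |h j| ≤ C * x ∧ ∑ j, |(-(W *ᵥ α)) j| ≤ C * x ∧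
      ∑ j, |h j - (-(W *ᵥ α)) j| ≤ C * (x ^ 4 / d) ∧
      ∑ j, |h j - (-(W *ᵥ α) - W *ᵥ secondOrder G T (-(W *ᵥ α))) j| ≤ C * (x ^ 6 / d ^ 2) := by
  set B : ℝ := (s : ℝ) ^ 2 * κ with hB
  have hB0 : 0 ≤ B := by positivity
  set c₁ := 2 * B
  set c₂ := B * (c₁ + c₁ ^ 2 + c₁ ^ 3)
  set c₃ := B * (c₂ * (1 + 2 * c₁) + c₁ ^ 3)
  have hc₁ : 0 ≤ c₁ := by positivity
  have hc₂ : 0 ≤ c₂ := by positivity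
  have hc₃ : 0 ≤ c₃ := by positivity
  refine ⟨1 / (4 * (B + 1)), by positivity, c₁ + c₂ + c₃, by positivity, ?_⟩
  intro W G T α h R x d hx hd hW hα hG hT hR hs1 hs2 heq
  have hd0 : 0 < d := by linarith
  have hx0 : 0 < x := by linarith
  set N := ∑ j, |h j| with hN
  have hN0 : 0 ≤ N := Finset.sum_nonneg fun _ _ => abs_nonneg _
  have hxd : 0 ≤ x / d := by positivity
  set u := -(W *ᵥ α) with hu
  have hSO := abs_secondOrder_le (h := h) hxd hG hT
  -- the root is of order `x`
  have hNle : N ≤ c₁ * x := by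
    have h1 : N ≤ B * (x + x / d * (N + N ^ 2) + x / d ^ 2 * N ^ 3) := by
      have : N = ∑ p, |(W *ᵥ (α + secondOrder G T h + R)) p| := by
        rw [hN]
        refine Finset.sum_congr rfl fun p _ => ?_
        conv_lhs => rw [heq]
        rw [Pi.neg_apply, abs_neg]
      refine this.trans_le (sum_abs_mulVec_le hW hκ fun i => ?_)
      refine (abs_add_three _ _ _).trans (add_le_add (add_le_add (hα i) (hSO i)) (hR i))
    have h2 : x / d * (N + N ^ 2) ≤ 1 / (4 * (B + 1)) * N := by
      have : x / d * (N + N ^ 2) = x * (1 + N) / d * N := by ring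
      rw [this]
      refine mul_le_mul_of_nonneg_right ?_ hN0
      rwa [div_le_iff₀ hd0]
    have h3 : x / d ^ 2 * N ^ 3 ≤ 1 / (4 * (B + 1)) * N := by
      have : x / d ^ 2 * N ^ 3 = x * N ^ 2 / d ^ 2 * N := by ring
      rw [this]
      refine mul_le_mul_of_nonneg_right ?_ hN0
      rwa [div_le_iff₀ (by positivity)]
    have h4 : B * (1 / (4 * (B + 1)) * N) ≤ N / 4 := by
      have : B * (1 / (4 * (B + 1)) * N) = (B / (B + 1)) * (N / 4) := by field_simp
      rw [this]
      have hle : B / (B + 1) ≤ 1 := by rw [div_le_one (by positivity)]; linarith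
      nlinarith
    have h5 : N ≤ B * x + N / 4 + N / 4 := by
      calc N ≤ B * (x + x / d * (N + N ^ 2) + x / d ^ 2 * N ^ 3) := h1
        _ ≤ B * (x + 1 / (4 * (B + 1)) * N + 1 / (4 * (B + 1)) * N) := by gcongr
        _ = B * x + B * (1 / (4 * (B + 1)) * N) + B * (1 / (4 * (B + 1)) * N) := by ring
        _ ≤ _ := by gcongr
    simp only [c₁]
    linarith
  have hU : ∑ j, |u j| ≤ c₁ * x := by
    have := sum_abs_mulVec_le hW hκ hα
    simp only [hu, Pi.neg_apply, abs_neg]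
    refine this.trans ?_
    simp only [c₁]
    nlinarith
  have hd1 : 1 / d ≤ 1 := by rw [div_le_one hd0]; exact hd
  have hx2 : ∀ {a b : ℕ}, a ≤ b → x ^ a ≤ x ^ b := fun hab => pow_le_pow_right₀ hx hab
  have hRle : ∀ i, |R i| ≤ c₁ ^ 3 * (x ^ 4 / d ^ 2) := fun i => by
    refine (hR i).trans ?_
    calc x / d ^ 2 * N ^ 3 ≤ x / d ^ 2 * (c₁ * x) ^ 3 := by gcongr
      _ = _ := by ring
  have hr : h - u = -(W *ᵥ (secondOrder G T h + R)) := by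
    conv_lhs => rw [heq, hu]
    rw [add_assoc, Matrix.mulVec_add]
    abel
  have hdiff : ∑ j, |h j - u j| ≤ c₂ * (x ^ 4 / d) := by
    have h1 : ∑ j, |h j - u j| = ∑ j, |(W *ᵥ (secondOrder G T h + R)) j| := by
      refine Finset.sum_congr rfl fun j _ => ?_
      rw [← Pi.sub_apply, hr, Pi.neg_apply, abs_neg]
    rw [h1]
    refine (sum_abs_mulVec_le (c := (c₁ + c₁ ^ 2 + c₁ ^ 3) * (x ^ 4 / d)) hW hκ
      fun i => ?_).trans (le_of_eq (by simp only [c₂]; ring))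
    refine (abs_add_le _ _).trans ((add_le_add (hSO i) (hRle i)).trans ?_)
    have e1 : x / d * (N + N ^ 2) ≤ (c₁ + c₁ ^ 2) * (x ^ 4 / d) := by
      calc x / d * (N + N ^ 2) ≤ x / d * (c₁ * x + (c₁ * x) ^ 2) := by gcongr
        _ = (c₁ * x ^ 2 + c₁ ^ 2 * x ^ 3) / d := by ring
        _ ≤ (c₁ * x ^ 4 + c₁ ^ 2 * x ^ 4) / d := by
          gcongr (c₁ * ?_ + c₁ ^ 2 * ?_) / d
          · exact hx2 (by norm_num)
          · exact hx2 (by norm_num)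
        _ = _ := by ring
    have e2 : c₁ ^ 3 * (x ^ 4 / d ^ 2) ≤ c₁ ^ 3 * (x ^ 4 / d) := by
      gcongr
      nlinarith
    linarith
  have hdiff2 : ∑ j, |h j - (u - W *ᵥ secondOrder G T u) j| ≤ c₃ * (x ^ 6 / d ^ 2) := by
    have h1 : h - (u - W *ᵥ secondOrder G T u)
        = -(W *ᵥ (secondOrder G T h - secondOrder G T u + R)) := by
      have : h - (u - W *ᵥ secondOrder G T u) = (h - u) + W *ᵥ secondOrder G T u := by abel
      rw [this, hr, Matrix.mulVec_add, Matrix.mulVec_add, Matrix.mulVec_sub]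
      abel
    have h2 : ∑ j, |h j - (u - W *ᵥ secondOrder G T u) j|
        = ∑ j, |(W *ᵥ (secondOrder G T h - secondOrder G T u + R)) j| := by
      refine Finset.sum_congr rfl fun j _ => ?_
      rw [← Pi.sub_apply, h1, Pi.neg_apply, abs_neg]
    rw [h2]
    refine (sum_abs_mulVec_le (c := (c₂ * (1 + 2 * c₁) + c₁ ^ 3) * (x ^ 6 / d ^ 2)) hW hκ
      fun i => ?_).trans (le_of_eq (by simp only [c₃]; ring))
    refine (abs_add_le _ _).trans ((add_le_add
      (abs_secondOrder_sub_le hG hT hxd i) (hRle i)).trans ?_)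
    have e1 : x / d * ((∑ j, |h j - u j|) * (1 + (∑ j, |h j| + ∑ j, |u j|))) ≤
        c₂ * (1 + 2 * c₁) * (x ^ 6 / d ^ 2) := by
      calc x / d * ((∑ j, |h j - u j|) * (1 + (∑ j, |h j| + ∑ j, |u j|)))
          ≤ x / d * (c₂ * (x ^ 4 / d) * (x + (c₁ * x + c₁ * x))) := by
            have := Finset.sum_nonneg fun (j : Fin s) (_ : j ∈ Finset.univ) => abs_nonneg (u j)
            gcongr
        _ = _ := by field_simp; ring
    have e2 : c₁ ^ 3 * (x ^ 4 / d ^ 2) ≤ c₁ ^ 3 * (x ^ 6 / d ^ 2) := by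
      gcongr c₁ ^ 3 * (?_ / d ^ 2)
      exact hx2 (by norm_num)
    linarith
  have hx4 : 0 ≤ x ^ 4 / d := by positivity
  have hx6 : 0 ≤ x ^ 6 / d ^ 2 := by positivity
  refine ⟨hNle.trans ?_, hU.trans ?_, hdiff.trans ?_, hdiff2.trans ?_⟩ <;>
    refine mul_le_mul_of_nonneg_right ?_ (by positivity) <;> linarith

end RootExpansion

section ScoreExpansion

variable {s : ℕ} {M : Experiment.{u, v} s} {σ : Param s} {δ : ℝ} {U : Set (Param s)}

/-- The normalized score `D⁻¹ a` at `σ`. -/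
noncomputable def Experiment.nscore (M : Experiment.{u, v} s) (σ : Param s) (y : M.𝒴) :
    Fin s → ℝ := fun i => M.a σ y i / M.d i

/-- The normalized centred Hessian `D⁻¹ (F - A) D⁻¹` at `σ`. -/
noncomputable def Experiment.nhess (M : Experiment.{u, v} s) (σ : Param s) (y : M.𝒴) :
    Matrix (Fin s) (Fin s) ℝ :=
  Matrix.of fun i j => (M.F σ y i j - M.A σ i j) / (M.d i * M.d j)

/-- The normalized third derivatives at `σ`. -/
noncomputable def Experiment.nthird (M : Experiment.{u, v} s) (σ : Param s) (y : M.𝒴)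
    (i j k : Fin s) : ℝ := M.l3 i j k σ y / (M.d i * M.d j * M.d k)

/-- The normalized deviation `D (θ - σ)`. -/
noncomputable def Experiment.ndev (M : Experiment.{u, v} s) (σ θ : Param s) : Fin s → ℝ :=
  fun i => M.d i * (θ i - σ i)

theorem Experiment.Dominates.nscore_le {y : M.𝒴} {x : ℝ} (h : M.Dominates σ δ y x)
    (hd : ∀ i, 0 < M.d i) (i : Fin s) : |M.nscore σ y i| ≤ x := h.lam1_le hd i

theorem Experiment.Dominates.nhess_le {y : M.𝒴} {x : ℝ} (h : M.Dominates σ δ y x)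
    (hd : ∀ i, 0 < M.d i) (hd' : 0 < M.dstar) (i j : Fin s) :
    |M.nhess σ y i j| ≤ x / M.dstar := by
  have hi := hd i; have hj := hd j
  have h2 := Real.sqrt_pos.2 hi; have h3 := Real.sqrt_pos.2 hj
  have hx : 0 ≤ x := by linarith [h.one_le]
  have hle : M.dstar ≤ √(M.d i) * √(M.d j) := by
    rw [← Real.mul_self_sqrt hd'.le]
    exact mul_le_mul (Real.sqrt_le_sqrt (M.dstar_le i)) (Real.sqrt_le_sqrt (M.dstar_le j))
      (Real.sqrt_nonneg _) h2.le
  simp only [Experiment.nhess, Matrix.of_apply]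
  rw [abs_div, abs_of_pos (mul_pos hi hj)]
  calc |M.F σ y i j - M.A σ i j| / (M.d i * M.d j)
      ≤ x * (√(M.d i) * √(M.d j)) / (M.d i * M.d j) := by
        gcongr
        exact h.F_le i j
    _ = x / (√(M.d i) * √(M.d j)) := by
        have e1 := Real.mul_self_sqrt hi.le
        have e2 := Real.mul_self_sqrt hj.le
        rw [div_eq_div_iff (by positivity) (by positivity)]
        calc x * (√(M.d i) * √(M.d j)) * (√(M.d i) * √(M.d j))
            = x * ((√(M.d i) * √(M.d i)) * (√(M.d j) * √(M.d j))) := by ring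
          _ = _ := by rw [e1, e2]
    _ ≤ x / M.dstar := by gcongr

theorem Experiment.Dominates.nthird_le {y : M.𝒴} {x : ℝ} (h : M.Dominates σ δ y x)
    (hd : ∀ i, 0 < M.d i) (hδ : 0 ≤ δ) (i j k : Fin s) :
    |M.nthird σ y i j k| ≤ x / M.dstar := by
  have hi := hd i; have hj := hd j; have hk := hd k
  have h0 : 0 < M.d i * M.d j * M.d k := by positivity
  rw [Experiment.nthird, abs_div, abs_of_pos h0, div_le_iff₀ h0]
  refine (h.l3_le i j k σ (M.self_mem_box hd hδ)).trans (le_of_eq ?_)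
  ring

theorem Experiment.score_expansion (hd : ∀ i, 0 < M.d i) (hδ : 0 ≤ δ)
    (hU : IsOpen U) (hbox : M.box σ δ ⊆ U) {y : M.𝒴}
    (hl : ContDiffOn ℝ 4 (fun τ => M.l τ y) U) {x : ℝ} (h : M.Dominates σ δ y x)
    {θ : Param s} (hθ : θ ∈ M.box σ δ) (i : Fin s) :
    |M.nscore θ y i - (M.nscore σ y + M.Q σ *ᵥ M.ndev σ θ
      + secondOrder (M.nhess σ y) (M.nthird σ y) (M.ndev σ θ)) i| ≤
      x / M.dstar ^ 2 * (∑ j, |M.ndev σ θ j|) ^ 3 := by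
  set f : Param s → ℝ := pderiv i fun τ => M.l τ y with hf
  have hσU : σ ∈ U := hbox (M.self_mem_box hd hδ)
  have hne : ∀ i, M.d i ≠ 0 := fun i => (hd i).ne'
  have hcf : ContDiffOn ℝ 3 f U := contDiffOn_pderiv hU hl (by norm_num) i
  have hseg : ∀ t ∈ Set.Icc (0 : ℝ) 1, σ + t • (θ - σ) ∈ M.box σ δ := fun t ht =>
    M.segment_mem_box (M.self_mem_box hd hδ) hθ ht
  have hx : 0 ≤ x := by linarith [h.one_le]
  have hT := taylor_three_abs_le hU hcf σ (θ - σ) (fun t ht => hbox (hseg t ht))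
    (C := M.d i * (x / M.dstar ^ 2 * (∑ j, |M.ndev σ θ j|) ^ 3)) fun t ht => by
      have e : M.d i * (x / M.dstar ^ 2 * (∑ j, |M.ndev σ θ j|) ^ 3) =
          ∑ j, ∑ k, ∑ m, M.d i * (x / M.dstar ^ 2) *
            (|M.ndev σ θ j| * |M.ndev σ θ k| * |M.ndev σ θ m|) := by
        simp only [← Finset.mul_sum, ← Finset.sum_mul]
        ring
      rw [e]
      refine (Finset.abs_sum_le_sum_abs _ _).trans (Finset.sum_le_sum fun j _ => ?_)
      rw [Finset.mul_sum]
      refine (Finset.abs_sum_le_sum_abs _ _).trans (Finset.sum_le_sum fun k _ => ?_)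
      rw [Finset.mul_sum, Finset.mul_sum]
      refine (Finset.abs_sum_le_sum_abs _ _).trans (Finset.sum_le_sum fun m _ => ?_)
      have hb := h.l4_le m k j i _ (hseg t ht)
      have hdj := (hd j).le; have hdk := (hd k).le; have hdm := (hd m).le
      rw [abs_mul, abs_mul, abs_mul]
      simp only [Experiment.ndev, abs_mul, abs_of_pos (hd _)]
      calc |(θ - σ) j| * (|(θ - σ) k| * (|(θ - σ) m| * |M.l4 m k j i (σ + t • (θ - σ)) y|))
          ≤ |(θ - σ) j| * (|(θ - σ) k| * (|(θ - σ) m| *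
            (x * (M.d m * M.d k * M.d j * M.d i / M.dstar ^ 2)))) := by gcongr
        _ = _ := by simp only [PiLp.sub_apply]; ring
  have hFs : ∀ j, pderiv j f σ = M.F σ y i j := fun j =>
    pderiv_comm hU (hl.of_le (by norm_num)) j i hσU
  have hls : ∀ j k, pderiv k (pderiv j f) σ = M.l3 i j k σ y := fun j k =>
    pderiv₃_reverse hU (hl.of_le (by norm_num)) i j k hσU
  have e2 : f (σ + (θ - σ)) - f σ - ∑ j, (θ - σ) j * pderiv j f σ
      - 1 / 2 * ∑ j, (θ - σ) j * ∑ k, (θ - σ) k * pderiv k (pderiv j f) σ =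
      M.d i * (M.nscore θ y i - (M.nscore σ y + M.Q σ *ᵥ M.ndev σ θ
      + secondOrder (M.nhess σ y) (M.nthird σ y) (M.ndev σ θ)) i) := by
    have a1 : M.d i * M.nscore θ y i = f (σ + (θ - σ)) := by
      rw [add_sub_cancel]
      simp only [Experiment.nscore]
      rw [mul_div_cancel₀ _ (hne i)]
      rfl
    have a2 : M.d i * M.nscore σ y i = f σ := by
      simp only [Experiment.nscore]
      rw [mul_div_cancel₀ _ (hne i)]
      rfl
    have a3 : M.d i * (M.Q σ *ᵥ M.ndev σ θ) i + M.d i * ∑ j, M.nhess σ y i j * M.ndev σ θ j =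
        ∑ j, (θ - σ) j * pderiv j f σ := by
      simp only [Matrix.mulVec, dotProduct, Finset.mul_sum, ← Finset.sum_add_distrib]
      refine Finset.sum_congr rfl fun j _ => ?_
      rw [hFs, M.Q_apply hd]
      simp only [Experiment.nhess, Experiment.ndev, Matrix.of_apply, PiLp.sub_apply]
      have := hne i; have := hne j
      field_simp
      ring
    have a4 : M.d i * ∑ j, ∑ k, M.nthird σ y i j k * M.ndev σ θ j * M.ndev σ θ k =
        ∑ j, (θ - σ) j * ∑ k, (θ - σ) k * pderiv k (pderiv j f) σ := by
      simp only [Finset.mul_sum]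
      refine Finset.sum_congr rfl fun j _ => Finset.sum_congr rfl fun k _ => ?_
      rw [hls]
      simp only [Experiment.nthird, Experiment.ndev, PiLp.sub_apply]
      have := hne i; have := hne j; have := hne k
      field_simp
    rw [← a1, ← a2, ← a3, ← a4]
    simp only [Pi.add_apply, secondOrder]
    ring
  rw [e2, abs_mul, abs_of_pos (hd i)] at hT
  exact le_of_mul_le_mul_left hT (hd i)

theorem Experiment.dotProduct_inv_A_mulVec (hd : ∀ i, 0 < M.d i) (b w : Fin s → ℝ) :
    b ⬝ᵥ ((M.A σ)⁻¹ *ᵥ w) = ∑ p, b p / M.d p * ((M.Q σ)⁻¹ *ᵥ fun i => w i / M.d i) p := by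
  simp only [dotProduct, Matrix.mulVec, Finset.mul_sum, M.inv_A_apply hd]
  refine Finset.sum_congr rfl fun p _ => Finset.sum_congr rfl fun i _ => ?_
  have := (hd p).ne'; have := (hd i).ne'
  field_simp

/-- The leading terms of the expansion in normalized form. -/
theorem Experiment.leading_eq (hd : ∀ i, 0 < M.d i) (hA : IsUnit (M.A σ).det)
    (hsymm : (M.A σ).IsSymm) (η : Param s → ℝ) (y : M.𝒴) :
    M.leading η σ y =
      ∑ p, gradVec η σ p / M.d p *
        (-((M.Q σ)⁻¹ *ᵥ M.nscore σ y) - (M.Q σ)⁻¹ *ᵥ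
          secondOrder (M.nhess σ y) (M.nthird σ y) (-((M.Q σ)⁻¹ *ᵥ M.nscore σ y))) p
      + 1 / 2 * ∑ p, ∑ q, hessMat η σ p q / (M.d p * M.d q) *
        (-((M.Q σ)⁻¹ *ᵥ M.nscore σ y)) p * (-((M.Q σ)⁻¹ *ᵥ M.nscore σ y)) q := by
  set W := (M.Q σ)⁻¹ with hW
  set u := -(W *ᵥ M.nscore σ y) with hu
  have hne : ∀ i, M.d i ≠ 0 := fun i => (hd i).ne'
  set vv := (M.A σ)⁻¹ *ᵥ M.a σ y with hvv
  have hv : ∀ p, vv p = -(u p / M.d p) := fun p => by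
    simp only [hvv, hu, Matrix.mulVec, dotProduct, M.inv_A_apply hd, Pi.neg_apply,
      Experiment.nscore, neg_div, neg_neg, Finset.sum_div, ← hW]
    refine Finset.sum_congr rfl fun i _ => ?_
    have := hne p; have := hne i
    field_simp
  have hAinv : ((M.A σ)⁻¹)ᵀ = (M.A σ)⁻¹ := by
    rw [Matrix.transpose_nonsing_inv, hsymm.eq]
  have hvm : M.a σ y ᵥ* (M.A σ)⁻¹ = vv := by
    rw [hvv, ← hAinv, Matrix.mulVec_transpose, hAinv]
  have t1 : gradVec η σ ⬝ᵥ vv = -∑ p, gradVec η σ p / M.d p * u p := by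
    simp only [dotProduct, hv, ← Finset.sum_neg_distrib]
    refine Finset.sum_congr rfl fun p _ => ?_
    ring
  have t2 : gradVec η σ ⬝ᵥ ((M.A σ)⁻¹ *ᵥ (M.F σ y *ᵥ vv)) =
      gradVec η σ ⬝ᵥ vv - ∑ p, gradVec η σ p / M.d p *
        (W *ᵥ fun i => ∑ j, M.nhess σ y i j * u j) p := by
    have e1 : M.F σ y = M.A σ + (M.F σ y - M.A σ) := by abel
    have e2 : M.A σ *ᵥ vv = M.a σ y := by
      rw [hvv, Matrix.mulVec_mulVec, Matrix.mul_nonsing_inv _ hA, Matrix.one_mulVec]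
    have e3 : (fun i => ((M.F σ y - M.A σ) *ᵥ vv) i / M.d i) =
        -(fun i => ∑ j, M.nhess σ y i j * u j) := by
      funext i
      simp only [Matrix.mulVec, dotProduct, Finset.sum_div, Pi.neg_apply,
        ← Finset.sum_neg_distrib, hv, Experiment.nhess, Matrix.of_apply, Matrix.sub_apply]
      refine Finset.sum_congr rfl fun j _ => ?_
      have := hne i; have := hne j
      field_simp
    rw [e1, Matrix.add_mulVec, e2, Matrix.mulVec_add, dotProduct_add, ← hvv,
      M.dotProduct_inv_A_mulVec hd _ ((M.F σ y - M.A σ) *ᵥ vv), e3, Matrix.mulVec_neg]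
    simp only [Pi.neg_apply, mul_neg, Finset.sum_neg_distrib]
    exact (sub_eq_add_neg _ _).symm
  have t3 : M.a σ y ⬝ᵥ (((M.A σ)⁻¹ * hessMat η σ * (M.A σ)⁻¹) *ᵥ M.a σ y) =
      ∑ p, ∑ q, hessMat η σ p q / (M.d p * M.d q) * u p * u q := by
    rw [← Matrix.mulVec_mulVec, ← hvv, ← Matrix.mulVec_mulVec, Matrix.dotProduct_mulVec, hvm]
    simp only [dotProduct, Matrix.mulVec, hv, Finset.mul_sum]
    refine Finset.sum_congr rfl fun p _ => Finset.sum_congr rfl fun q _ => ?_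
    have := hne p; have := hne q
    field_simp
  have t4 : gradVec η σ ⬝ᵥ ((M.A σ)⁻¹ *ᵥ (M.C σ y *ᵥ vv)) = ∑ p, gradVec η σ p / M.d p *
        (W *ᵥ fun i => ∑ j, ∑ k, M.nthird σ y i j k * u j * u k) p := by
    rw [M.dotProduct_inv_A_mulVec hd]
    refine Finset.sum_congr rfl fun p _ => ?_
    congr 3
    funext i
    simp only [Matrix.mulVec, Experiment.C, Matrix.of_apply, hvm]
    simp only [Matrix.vecMul, dotProduct, Finset.sum_mul, Finset.sum_div, hv]
    rw [Finset.sum_comm]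
    refine Finset.sum_congr rfl fun j _ => Finset.sum_congr rfl fun k _ => ?_
    simp only [Experiment.nthird, Experiment.H, Matrix.of_apply]
    have := hne i; have := hne j; have := hne k
    field_simp
  have e : secondOrder (M.nhess σ y) (M.nthird σ y) u =
      (fun i => ∑ j, M.nhess σ y i j * u j) +
        (1 / 2 : ℝ) • (fun i => ∑ j, ∑ k, M.nthird σ y i j k * u j * u k) := by
    funext i
    simp [secondOrder]
  rw [Experiment.leading, ← hvv, t2, t3, t4, t1, e, Matrix.mulVec_add, Matrix.mulVec_smul]
  simp only [Pi.sub_apply, Pi.add_apply, Pi.smul_apply, smul_eq_mul, mul_sub, mul_add,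
    Finset.sum_sub_distrib, Finset.sum_add_distrib]
  have e3 : ∑ p, gradVec η σ p / M.d p *
      (1 / 2 * (W *ᵥ fun i => ∑ j, ∑ k, M.nthird σ y i j k * u j * u k) p) =
      1 / 2 * ∑ p, gradVec η σ p / M.d p *
      (W *ᵥ fun i => ∑ j, ∑ k, M.nthird σ y i j k * u j * u k) p := by
    rw [Finset.mul_sum]
    refine Finset.sum_congr rfl fun p _ => ?_
    ring
  rw [e3]
  ring

end ScoreExpansion

section EtaExpansion

theorem abs_div_le_div {s : ℕ} {M : Experiment.{u, v} s} (hd : 0 < M.dstar) {b K : ℝ}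
    (hb : |b| ≤ K) (p : Fin s) : |b / M.d p| ≤ K / M.dstar := by
  have hp : 0 < M.d p := hd.trans_le (M.dstar_le p)
  rw [abs_div, abs_of_pos hp]
  have := abs_nonneg b
  exact div_le_div₀ (this.trans hb) hb hd (M.dstar_le p)

theorem abs_div_mul_le_div_sq {s : ℕ} {M : Experiment.{u, v} s} (hd : 0 < M.dstar) {b K : ℝ}
    (hb : |b| ≤ K) (p q : Fin s) : |b / (M.d p * M.d q)| ≤ K / M.dstar ^ 2 := by
  rw [← div_div, sq, ← div_div]
  exact abs_div_le_div hd (abs_div_le_div hd hb p) q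

/-- The value of `η` at a root of the score equation differs from `η(σ)` by the leading terms, up
to an error of order `d_*⁻³`. -/
theorem exists_eta_expansion (s : ℕ) {κ K : ℝ} (hκ : 0 ≤ κ) (hK : 0 ≤ K) :
    ∃ ε > 0, ∃ C ≥ 0, ∀ (M : Experiment.{u, v} s) (σ θ : Param s) (δ : ℝ) (U : Set (Param s))
      (y : M.𝒴) (x : ℝ) (η : Param s → ℝ), (∀ i, 0 < M.d i) → 1 ≤ M.dstar → 0 ≤ δ →
      IsOpen U → M.box σ δ ⊆ U → ContDiffOn ℝ 4 (fun τ => M.l τ y) U → ContDiffOn ℝ 3 η U →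
      M.Dominates σ δ y x → θ ∈ M.box σ δ → M.a θ y = 0 → IsUnit (M.Q σ).det →
      (∀ i j, |(M.Q σ)⁻¹ i j| ≤ κ) → (M.A σ).IsSymm →
      (∀ i, |pderiv i η σ| ≤ K) → (∀ i j, |pderiv i (pderiv j η) σ| ≤ K) →
      (∀ i j k, ∀ τ ∈ M.box σ δ, |pderiv i (pderiv j (pderiv k η)) τ| ≤ K) →
      x * (1 + ∑ j, |M.ndev σ θ j|) ≤ ε * M.dstar →
      x * (∑ j, |M.ndev σ θ j|) ^ 2 ≤ ε * M.dstar ^ 2 →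
      |η θ - η σ - M.leading η σ y| ≤ C * (x ^ 6 / M.dstar ^ 3) := by
  obtain ⟨ε, hε, C, hC, H⟩ := exists_root_expansion s hκ
  refine ⟨ε, hε, K * C ^ 3 + K * C + K * C ^ 2, by positivity, ?_⟩
  intro M σ θ δ U y x η hd hd1 hδ hU hbox hl hη hdom hθ hroot hQ hW hsymm hb hB hT3 hs1 hs2
  have hd0 : 0 < M.dstar := by linarith
  have hne : ∀ i, M.d i ≠ 0 := fun i => (hd i).ne'
  have hx1 := hdom.one_le
  have hx0 : 0 ≤ x := by linarith
  set h := M.ndev σ θ with hh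
  set W := (M.Q σ)⁻¹ with hWdef
  set G := M.nhess σ y
  set T := M.nthird σ y
  set α := M.nscore σ y
  set R : Fin s → ℝ := -(α + M.Q σ *ᵥ h + secondOrder G T h) with hRdef
  have hsc : M.nscore θ y = 0 := by
    funext i
    simp [Experiment.nscore, hroot]
  have hR : ∀ i, |R i| ≤ x / M.dstar ^ 2 * (∑ j, |h j|) ^ 3 := fun i => by
    have := M.score_expansion hd hδ hU hbox hl hdom hθ i
    rw [hsc, Pi.zero_apply, zero_sub] at this
    exact this
  have heq : h = -(W *ᵥ (α + secondOrder G T h + R)) := by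
    have : α + secondOrder G T h + R = -(M.Q σ *ᵥ h) := by rw [hRdef]; abel
    rw [this, Matrix.mulVec_neg, neg_neg, Matrix.mulVec_mulVec, hWdef,
      Matrix.nonsing_inv_mul _ hQ, Matrix.one_mulVec]
  obtain ⟨r1, r2, r3, r4⟩ := H W G T α h R x M.dstar hx1 hd1 hW (hdom.nscore_le hd)
    (hdom.nhess_le hd hd0) (hdom.nthird_le hd hδ) hR hs1 hs2 heq
  set u := -(W *ᵥ α) with hu
  have hA : IsUnit (M.A σ).det := M.isUnit_A_det hQ
  rw [M.leading_eq hd hA hsymm]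
  have hseg : ∀ t ∈ Set.Icc (0 : ℝ) 1, σ + t • (θ - σ) ∈ M.box σ δ := fun t ht =>
    M.segment_mem_box (M.self_mem_box hd hδ) hθ ht
  have hdev : ∀ i, (θ - σ) i = h i / M.d i := fun i => by
    simp only [hh, Experiment.ndev, PiLp.sub_apply]
    rw [mul_div_cancel_left₀ _ (hne i)]
  have habs : ∀ i, |(θ - σ) i| ≤ |h i| / M.dstar := fun i => by
    rw [hdev]
    exact abs_div_le_div hd0 le_rfl i
  have hTay := taylor_three_abs_le hU hη σ (θ - σ) (fun t ht => hbox (hseg t ht))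
    (C := K * ((∑ j, |h j|) / M.dstar) ^ 3) fun t ht => by
      have e : K * ((∑ j, |h j|) / M.dstar) ^ 3 = ∑ j, ∑ k, ∑ m,
          (|h j| / M.dstar) * ((|h k| / M.dstar) * ((|h m| / M.dstar) * K)) := by
        simp only [← Finset.mul_sum, ← Finset.sum_mul, ← Finset.sum_div]
        ring
      rw [e]
      refine (Finset.abs_sum_le_sum_abs _ _).trans (Finset.sum_le_sum fun j _ => ?_)
      rw [Finset.mul_sum]
      refine (Finset.abs_sum_le_sum_abs _ _).trans (Finset.sum_le_sum fun k _ => ?_)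
      rw [Finset.mul_sum, Finset.mul_sum]
      refine (Finset.abs_sum_le_sum_abs _ _).trans (Finset.sum_le_sum fun m _ => ?_)
      have hb := hT3 m k j _ (hseg t ht)
      rw [abs_mul, abs_mul, abs_mul]
      have := habs j; have := habs k; have := habs m
      gcongr
  rw [add_sub_cancel] at hTay
  have hσU : σ ∈ U := hbox (M.self_mem_box hd hδ)
  have e1 : ∑ i, (θ - σ) i * pderiv i η σ = ∑ p, gradVec η σ p / M.d p * h p := by
    refine Finset.sum_congr rfl fun p _ => ?_
    rw [hdev, gradVec]
    ring
  have e2 : ∑ i, (θ - σ) i * ∑ j, (θ - σ) j * pderiv j (pderiv i η) σ =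
      ∑ p, ∑ q, hessMat η σ p q / (M.d p * M.d q) * h p * h q := by
    simp only [Finset.mul_sum]
    refine Finset.sum_congr rfl fun p _ => Finset.sum_congr rfl fun q _ => ?_
    rw [hdev, hdev, pderiv_comm hU (hη.of_le (by norm_num)) q p hσU]
    simp only [hessMat, Matrix.of_apply]
    have := hne p; have := hne q
    field_simp
  rw [e1, e2] at hTay
  have b1 := abs_sum_mul_le (w := fun p => gradVec η σ p / M.d p)
    (h := fun p => h p - (u - W *ᵥ secondOrder G T u) p)
    (fun p => abs_div_le_div hd0 (hb p) p)
  have b2 := abs_quadratic_sub_le (w := fun p q => hessMat η σ p q / (M.d p * M.d q))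
    (h := h) (k := u)
    (fun p q => abs_div_mul_le_div_sq hd0 (hB p q) p q)
  set N := ∑ j, |h j| with hN
  have hN0 : 0 ≤ N := Finset.sum_nonneg fun _ _ => abs_nonneg _
  have hNu0 : 0 ≤ ∑ j, |u j| := Finset.sum_nonneg fun _ _ => abs_nonneg _
  have f1 : K * (N / M.dstar) ^ 3 ≤ K * C ^ 3 * (x ^ 6 / M.dstar ^ 3) := by
    calc K * (N / M.dstar) ^ 3 ≤ K * (C * x / M.dstar) ^ 3 := by gcongr
      _ = K * C ^ 3 * (x ^ 3 / M.dstar ^ 3) := by ring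
      _ ≤ K * C ^ 3 * (x ^ 6 / M.dstar ^ 3) := by
        gcongr K * C ^ 3 * (?_ / M.dstar ^ 3)
        exact pow_le_pow_right₀ hx1 (by norm_num)
  have f2 : K / M.dstar * ∑ p, |h p - (u - W *ᵥ secondOrder G T u) p| ≤
      K * C * (x ^ 6 / M.dstar ^ 3) := by
    calc _ ≤ K / M.dstar * (C * (x ^ 6 / M.dstar ^ 2)) := by gcongr
      _ = _ := by field_simp
  have f3 : K / M.dstar ^ 2 * ((∑ i, |h i - u i|) * (N + ∑ i, |u i|)) ≤
      2 * (K * C ^ 2 * (x ^ 6 / M.dstar ^ 3)) := by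
    calc _ ≤ K / M.dstar ^ 2 * (C * (x ^ 4 / M.dstar) * (C * x + C * x)) := by gcongr
      _ = 2 * (K * C ^ 2 * (x ^ 5 / M.dstar ^ 3)) := by field_simp; ring
      _ ≤ _ := by
        gcongr 2 * (K * C ^ 2 * (?_ / M.dstar ^ 3))
        exact pow_le_pow_right₀ hx1 (by norm_num)
  have hb1 := b1.trans f2
  have hb2 := b2.trans f3
  have hTay' := hTay.trans f1
  simp only [mul_sub, Finset.sum_sub_distrib] at hb1
  rw [abs_le] at *
  constructor <;> linarith [hb1.1, hb1.2, hb2.1, hb2.2, hTay'.1, hTay'.2]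

theorem exists_abs_leading_le (s : ℕ) {κ K : ℝ} (hκ : 0 ≤ κ) (hK : 0 ≤ K) :
    ∃ C ≥ 0, ∀ (M : Experiment.{u, v} s) (σ : Param s) (δ : ℝ)
      (y : M.𝒴) (x : ℝ) (η : Param s → ℝ), (∀ i, 0 < M.d i) → 1 ≤ M.dstar → 0 ≤ δ →
      M.Dominates σ δ y x → IsUnit (M.Q σ).det →
      (∀ i j, |(M.Q σ)⁻¹ i j| ≤ κ) → (M.A σ).IsSymm →
      (∀ i, |pderiv i η σ| ≤ K) → (∀ i j, |pderiv i (pderiv j η) σ| ≤ K) →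
      |M.leading η σ y| ≤ C * (x ^ 3 / M.dstar) := by
  set B : ℝ := (s : ℝ) ^ 2 * κ with hB
  have hB0 : 0 ≤ B := by positivity
  refine ⟨K * (B + B * (B + B ^ 2)) + K * B ^ 2, by positivity, ?_⟩
  intro M σ δ y x η hd hd1 hδ hdom hQ hW hsymm hb hB2
  have hd0 : 0 < M.dstar := by linarith
  have hx1 := hdom.one_le
  have hx0 : 0 ≤ x := by linarith
  rw [M.leading_eq hd (M.isUnit_A_det hQ) hsymm]
  set W := (M.Q σ)⁻¹ with hWdef
  set G := M.nhess σ y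
  set T := M.nthird σ y
  set α := M.nscore σ y
  set u := -(W *ᵥ α) with hu
  have hU : ∑ j, |u j| ≤ B * x := by
    simp only [hu, Pi.neg_apply, abs_neg]
    exact sum_abs_mulVec_le hW hκ (hdom.nscore_le hd)
  have hU0 : 0 ≤ ∑ j, |u j| := Finset.sum_nonneg fun _ _ => abs_nonneg _
  have hp : ∀ {a b : ℕ}, a ≤ b → x ^ a ≤ x ^ b := fun hab => pow_le_pow_right₀ hx1 hab
  have hS : ∑ j, |(W *ᵥ secondOrder G T u) j| ≤ B * ((B + B ^ 2) * x ^ 3) := by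
    refine sum_abs_mulVec_le hW hκ fun i => ?_
    refine (abs_secondOrder_le (by positivity) (hdom.nhess_le hd hd0)
      (hdom.nthird_le hd hδ) i).trans ?_
    calc x / M.dstar * (∑ j, |u j| + (∑ j, |u j|) ^ 2)
        ≤ x / 1 * (B * x + (B * x) ^ 2) := by gcongr
      _ = B * x ^ 2 + B ^ 2 * x ^ 3 := by ring
      _ ≤ B * x ^ 3 + B ^ 2 * x ^ 3 := by
        gcongr B * ?_ + B ^ 2 * x ^ 3
        exact hp (by norm_num)
      _ = _ := by ring
  have hsum : ∑ j, |(u - W *ᵥ secondOrder G T u) j| ≤ (B + B * (B + B ^ 2)) * x ^ 3 := by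
    calc _ ≤ ∑ j, (|u j| + |(W *ᵥ secondOrder G T u) j|) :=
          Finset.sum_le_sum fun j _ => abs_sub _ _
      _ ≤ B * x ^ 1 + B * ((B + B ^ 2) * x ^ 3) := by
          rw [Finset.sum_add_distrib, pow_one]; exact add_le_add hU hS
      _ ≤ B * x ^ 3 + B * ((B + B ^ 2) * x ^ 3) := by
          gcongr B * ?_ + B * ((B + B ^ 2) * x ^ 3)
          exact hp (by norm_num)
      _ = _ := by ring
  have b1 := abs_sum_mul_le (w := fun p => gradVec η σ p / M.d p)
    (h := (u - W *ᵥ secondOrder G T u))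
    (fun p => abs_div_le_div hd0 (hb p) p)
  have b2 := abs_sum_sum_mul_le (w := fun p q => hessMat η σ p q / (M.d p * M.d q)) (h := u) (k := u)
    (fun p q => abs_div_mul_le_div_sq hd0 (hB2 p q) p q)
  have f1 : K / M.dstar * ∑ j, |(u - W *ᵥ secondOrder G T u) j| ≤
      K * (B + B * (B + B ^ 2)) * (x ^ 3 / M.dstar) := by
    calc _ ≤ K / M.dstar * ((B + B * (B + B ^ 2)) * x ^ 3) := by gcongr
      _ = _ := by ring
  have f2 : K / M.dstar ^ 2 * ((∑ i, |u i|) * ∑ i, |u i|) ≤ K * B ^ 2 * (x ^ 3 / M.dstar) := by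
    calc _ ≤ K / M.dstar ^ 2 * ((B * x) * (B * x)) := by gcongr
      _ = K * B ^ 2 * (x ^ 2 / M.dstar ^ 2) := by ring
      _ ≤ _ := by
        have : M.dstar ^ 1 ≤ M.dstar ^ 2 := pow_le_pow_right₀ hd1 (by norm_num)
        rw [pow_one] at this
        have := hp (a := 2) (b := 3) (by norm_num)
        gcongr K * B ^ 2 * ?_
        exact div_le_div₀ (by positivity) this hd0 (by assumption)
  have hb1 := b1.trans f1
  have hb2 := b2.trans f2
  have hnn : 0 ≤ K * B ^ 2 * (x ^ 3 / M.dstar) := by positivity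
  rw [abs_le] at *
  constructor
  · linarith [hb1.1, hb1.2, hb2.1, hb2.2]
  · linarith [hb1.1, hb1.2, hb2.1, hb2.2]

end EtaExpansion

section MomentBounds

variable {Ω : Type*} [MeasurableSpace Ω] {μ : Measure Ω} {X : Ω → ℝ≥0∞} {g : ℝ} {K : ℝ≥0}

theorem meas_ge_le_of_lintegral_rpow_le (hX : Measurable X) (hg : 0 < g)
    (hK : ∫⁻ ω, X ω ^ g ∂μ ≤ K) {c : ℝ} (hc : 0 < c) :
    μ {ω | ENNReal.ofReal c ≤ X ω} ≤ ENNReal.ofReal (K * c ^ (-g)) := by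
  have h1 := mul_meas_ge_le_lintegral (μ := μ) (hX.pow_const g) (ENNReal.ofReal c ^ g)
  have h2 : {ω | ENNReal.ofReal c ≤ X ω} ⊆ {ω | ENNReal.ofReal c ^ g ≤ X ω ^ g} :=
    fun ω hω => ENNReal.rpow_le_rpow hω hg.le
  rw [ENNReal.ofReal_rpow_of_pos hc] at h1 h2
  have hcg : 0 < c ^ g := Real.rpow_pos_of_pos hc g
  calc μ {ω | ENNReal.ofReal c ≤ X ω} ≤ μ {ω | ENNReal.ofReal (c ^ g) ≤ X ω ^ g} :=
        measure_mono h2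
    _ ≤ K / ENNReal.ofReal (c ^ g) := by
        rw [ENNReal.le_div_iff_mul_le (Or.inl (by simpa using hcg)) (Or.inl ENNReal.ofReal_ne_top),
          mul_comm]
        exact h1.trans hK
    _ = _ := by
        rw [Real.rpow_neg hc.le, ← div_eq_mul_inv, ENNReal.ofReal_div_of_pos hcg,
          ENNReal.ofReal_coe_nnreal]

theorem pow_three_le_add_rpow {x t : ℝ} (hx : 0 < x) (ht : 0 < t) (hg : 3 ≤ g) :
    x ^ 3 ≤ t ^ 3 + t ^ (3 - g) * x ^ g := by
  have hxg : 0 ≤ x ^ g := (Real.rpow_pos_of_pos hx g).le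
  have htg : 0 ≤ t ^ (3 - g) := (Real.rpow_pos_of_pos ht _).le
  rcases le_total x t with h | h
  · have : x ^ 3 ≤ t ^ 3 := by gcongr
    nlinarith [mul_nonneg htg hxg]
  · have e : x ^ 3 = x ^ (3 - g) * x ^ g := by
      rw [← Real.rpow_add hx, sub_add_cancel]
      exact (Real.rpow_natCast x 3).symm
    have : x ^ (3 - g) ≤ t ^ (3 - g) := Real.rpow_le_rpow_of_nonpos ht h (by linarith)
    rw [e]
    have h3 : 0 ≤ t ^ 3 := by positivity
    nlinarith [mul_le_mul_of_nonneg_right this hxg]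

/-- A bound for an integral whose integrand is small off a set `N` of small measure. -/
theorem abs_integral_le_of_split [IsProbabilityMeasure μ] (hX : Measurable X) (hX1 : ∀ ω, 1 ≤ X ω)
    (hg : 6 ≤ g) (hK : ∫⁻ ω, X ω ^ g ∂μ ≤ K) {N : Set Ω} (hN : MeasurableSet N)
    {ψ : Ω → ℝ} {a₁ a₂ b₁ b₂ t : ℝ} (ha₁ : 0 ≤ a₁) (ha₂ : 0 ≤ a₂) (hb₂ : 0 ≤ b₂)
    (ht : 0 < t)
    (h₁ : ∀ ω, X ω ≠ ∞ → ω ∉ N → |ψ ω| ≤ a₁ * (X ω).toReal ^ 6 + a₂)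
    (h₂ : ∀ ω, X ω ≠ ∞ → ω ∈ N → |ψ ω| ≤ b₁ + b₂ * (X ω).toReal ^ 3) :
    |∫ ω, ψ ω ∂μ| ≤ (a₁ + b₂ * t ^ (3 - g)) * K + a₂ + (b₁ + b₂ * t ^ 3) * μ.real N := by
  have hg0 : 0 < g := by linarith
  have hne : ∫⁻ ω, X ω ^ g ∂μ ≠ ∞ := (hK.trans_lt ENNReal.coe_lt_top).ne
  have hfin : ∀ᵐ ω ∂μ, X ω ≠ ∞ := by
    filter_upwards [ae_lt_top (hX.pow_const g) hne] with ω hω h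
    rw [h, ENNReal.top_rpow_of_pos hg0] at hω
    exact lt_irrefl _ hω
  have hint : Integrable (fun ω => (X ω).toReal ^ g) μ := by
    have := integrable_toReal_of_lintegral_ne_top (hX.pow_const g).aemeasurable hne
    simpa only [ENNReal.toReal_rpow] using this
  have hintle : ∫ ω, (X ω).toReal ^ g ∂μ ≤ K := by
    have := integral_toReal (hX.pow_const g).aemeasurable
      (ae_lt_top (hX.pow_const g) hne)
    simp only [← ENNReal.toReal_rpow] at this
    rw [this]
    exact ENNReal.toReal_le_coe_of_le_coe hK
  have htg : 0 < t ^ (3 - g) := Real.rpow_pos_of_pos ht _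
  set c := b₁ + b₂ * t ^ 3
  set Φ : Ω → ℝ := fun ω =>
    (a₁ + b₂ * t ^ (3 - g)) * (X ω).toReal ^ g + a₂ + N.indicator (fun _ => c) ω with hΦ
  have i1 : Integrable (fun ω => (a₁ + b₂ * t ^ (3 - g)) * (X ω).toReal ^ g) μ :=
    hint.const_mul _
  have i2 : Integrable (fun ω => (a₁ + b₂ * t ^ (3 - g)) * (X ω).toReal ^ g + a₂) μ :=
    i1.add (integrable_const _)
  have i3 : Integrable (N.indicator fun _ => c) μ := (integrable_const c).indicator hN
  have hle : ∀ᵐ ω ∂μ, ‖ψ ω‖ ≤ Φ ω := by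
    filter_upwards [hfin] with ω hω
    have hx1 : 1 ≤ (X ω).toReal := by
      have := ENNReal.toReal_mono hω (hX1 ω)
      simpa using this
    have hx0 : 0 < (X ω).toReal := by linarith
    have hxg : 0 ≤ (X ω).toReal ^ g := (Real.rpow_pos_of_pos hx0 g).le
    rw [Real.norm_eq_abs]
    by_cases hmem : ω ∈ N
    · refine (h₂ ω hω hmem).trans ?_
      have h3 := pow_three_le_add_rpow (g := g) hx0 ht (by linarith)
      simp only [hΦ, Set.indicator_of_mem hmem]
      have := mul_le_mul_of_nonneg_left h3 hb₂
      have := mul_nonneg ha₁ hxg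
      simp only [c]
      linarith
    · refine (h₁ ω hω hmem).trans ?_
      simp only [hΦ, Set.indicator_of_notMem hmem]
      have h6 : (X ω).toReal ^ 6 ≤ (X ω).toReal ^ g := by
        rw [← Real.rpow_natCast]
        exact Real.rpow_le_rpow_of_exponent_le hx1 (by push_cast; exact hg)
      have := mul_le_mul_of_nonneg_left h6 ha₁
      have := mul_nonneg (mul_nonneg hb₂ htg.le) hxg
      linarith
  have hfinal := norm_integral_le_of_norm_le (i2.add i3) hle
  rw [Real.norm_eq_abs] at hfinal
  refine hfinal.trans ?_
  have e : ∫ ω, Φ ω ∂μ = (a₁ + b₂ * t ^ (3 - g)) * ∫ ω, (X ω).toReal ^ g ∂μ + a₂ +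
      c * μ.real N := by
    rw [hΦ, integral_add i2 i3, integral_add i1 (integrable_const _), integral_const_mul,
      integral_indicator_const _ hN]
    simp [mul_comm]
  refine e.le.trans ?_
  have : 0 ≤ a₁ + b₂ * t ^ (3 - g) := by positivity
  gcongr

end MomentBounds

section SecondOrder

variable {s : ℕ}

theorem Experiment.abs_etaHat_le (M : Experiment.{u, v} s) (η : Param s → ℝ) {c₀ κ K : ℝ}
    (hc₀ : 0 < c₀) (hd : 0 ≤ M.dstar) (σstar : Param s) (σhat : M.𝒴 → Param s)
    (hσ : |η σstar| ≤ K * M.dstar ^ κ) (y : M.𝒴) :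
    |M.etaHat η c₀ κ σstar σhat y| ≤ (c₀ + |K|) * M.dstar ^ κ := by
  have hk : 0 ≤ M.dstar ^ κ := Real.rpow_nonneg hd κ
  unfold Experiment.etaHat
  split_ifs with h
  · nlinarith [abs_nonneg K, mul_nonneg (abs_nonneg K) hk]
  · nlinarith [le_abs_self K, mul_le_mul_of_nonneg_right (le_abs_self K) hk]

theorem Experiment.hasExpect_etaHat (M : Experiment.{u, v} s) (σ : Param s) (η : Param s → ℝ)
    {c₀ κ K : ℝ} (hc₀ : 0 < c₀) (hd : 0 ≤ M.dstar) (σstar : Param s) (σhat : M.𝒴 → Param s)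
    (hσ : |η σstar| ≤ K * M.dstar ^ κ) (hm : Measurable (M.etaHat η c₀ κ σstar σhat)) :
    M.HasExpect σ (M.etaHat η c₀ κ σstar σhat) :=
  Integrable.of_bound (hm.comp M.measurable_Y).aestronglyMeasurable
    ((c₀ + |K|) * M.dstar ^ κ)
    (Eventually.of_forall fun ω => M.abs_etaHat_le η hc₀ hd σstar σhat hσ (M.Y ω))

theorem tendsto_dstar_rpow_neg {M : ℕ → Experiment.{u, v} s}
    (hdstar : Tendsto (fun n => (M n).dstar) atTop atTop) {r : ℝ} (hr : r < 0) (c : ℝ) :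
    Tendsto (fun n => c * (M n).dstar ^ r) atTop (𝓝 0) := by
  have h1 := (tendsto_rpow_neg_atTop (neg_pos.2 hr)).comp hdstar
  rw [neg_neg] at h1
  simpa using h1.const_mul c

end SecondOrder

section MainExpansion

variable {s : ℕ}

theorem Experiment.one_le_envelope (M : Experiment.{u, v} s) (σ : Param s) (δ : ℝ) (y : M.𝒴) :
    1 ≤ M.envelope σ δ y := le_self_add

theorem Experiment.mem_box_of_ndev_le {M : Experiment.{u, v} s} (hd : ∀ i, 0 < M.d i)
    {σ θ : Param s} {r : ℝ} (h : ∀ i, |M.ndev σ θ i| ≤ r * M.dstar) : θ ∈ M.box σ r := by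
  intro i
  have := h i
  rw [Experiment.ndev, abs_mul, abs_of_pos (hd i), mul_comm] at this
  rwa [le_div_iff₀ (hd i)]

theorem split_bound_eq {d κ g : ℝ} (hd : 0 < d) (C₁ C₂ C₃ C₅ K e : ℝ) :
    (C₁ / d ^ 3 + C₃ / d * (d ^ (1 / 4 : ℝ)) ^ (3 - g)) * K + e / d ^ 2 +
      (C₂ * d ^ κ + C₃ / d * (d ^ (1 / 4 : ℝ)) ^ 3) * (C₅ * d ^ (-(g / 4))) =
    d ^ (-2 : ℝ) * (C₁ * K * d ^ (-1 : ℝ) + C₃ * K * d ^ (1 + (3 - g) / 4) + e +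
      C₂ * C₅ * d ^ (κ + 2 - g / 4) + C₃ * C₅ * d ^ (7 / 4 - g / 4)) := by
  have e1 : (d ^ (1 / 4 : ℝ)) ^ (3 - g) = d ^ ((3 - g) / 4) := by
    rw [← Real.rpow_mul hd.le]; ring_nf
  have e2 : (d ^ (1 / 4 : ℝ)) ^ 3 = d ^ (3 / 4 : ℝ) := by
    rw [← Real.rpow_natCast, ← Real.rpow_mul hd.le]; norm_num
  have e3 : d ^ (1 + (3 - g) / 4) = d * d ^ ((3 - g) / 4) := by
    rw [Real.rpow_add hd, Real.rpow_one]
  have e4 : d ^ (κ + 2 - g / 4) = d ^ κ * d ^ 2 * d ^ (-(g / 4)) := by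
    rw [sub_eq_add_neg, Real.rpow_add hd, Real.rpow_add hd, Real.rpow_two]
  have e5 : d ^ (7 / 4 - g / 4) = d * d ^ (3 / 4 : ℝ) * d ^ (-(g / 4)) := by
    rw [sub_eq_add_neg, Real.rpow_add hd, show (7 / 4 : ℝ) = 1 + 3 / 4 by norm_num,
      Real.rpow_add hd, Real.rpow_one]
  have e6 : d ^ (-2 : ℝ) = 1 / d ^ 2 := by
    rw [Real.rpow_neg hd.le, Real.rpow_two, one_div]
  have e7 : d ^ (-1 : ℝ) = 1 / d := by rw [Real.rpow_neg_one, one_div]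
  rw [e1, e2, e3, e4, e5, e6, e7]
  field_simp
  ring

theorem small_of_le_half_power {ε d x N : ℝ} (hε : 0 < ε) (hd : 1 ≤ d) (hx0 : 0 ≤ x)
    (hx : x ≤ ε / (1 + s) ^ 2 * d ^ (1 / 2 : ℝ)) (hN0 : 0 ≤ N) (hN : N ≤ s * d ^ (1 / 2 : ℝ)) :
    x * (1 + N) ≤ ε * d ∧ x * N ^ 2 ≤ ε * d ^ 2 := by
  have hd0 : 0 < d := by linarith
  set ε' : ℝ := ε / (1 + s) ^ 2 with hε'
  have hε'0 : 0 < ε' := by positivity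
  set q := d ^ (1 / 2 : ℝ)
  have hq : q * q = d := by rw [← Real.rpow_add hd0]; norm_num
  have hq1 : 1 ≤ q := Real.one_le_rpow hd (by norm_num)
  have hs0 : (0 : ℝ) ≤ s := Nat.cast_nonneg s
  have hεe : ε' * (1 + s) ^ 2 = ε := by rw [hε']; field_simp
  constructor
  · calc x * (1 + N) ≤ (ε' * q) * (q + s * q) := by gcongr
      _ = ε' * (1 + s) * (q * q) := by ring
      _ = ε' * (1 + s) * d := by rw [hq]
      _ ≤ ε' * (1 + s) ^ 2 * d := by
        gcongr
        nlinarith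
      _ = ε * d := by rw [hεe]
  · calc x * N ^ 2 ≤ (ε' * q) * (s * q) ^ 2 := by gcongr
      _ ≤ (ε' * (q * q)) * (s * q) ^ 2 := by
        gcongr
        nlinarith
      _ = ε' * s ^ 2 * (q * q) ^ 2 := by ring
      _ = ε' * s ^ 2 * d ^ 2 := by rw [hq]
      _ ≤ ε' * (1 + s) ^ 2 * d ^ 2 := by
        gcongr
        linarith
      _ = ε * d ^ 2 := by rw [hεe]

/-- The corrected estimator is unbiased for `η(σ)` to the order `d_*⁻²`. -/
theorem isLittleO_expect_etaHat {M : ℕ → Experiment.{u, v} s} {Θ U : Set (Param s)}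
    {σ σstar : Param s} {η : ℕ → Param s → ℝ} {c₀ κ g δ K Kstar m : ℝ} {KX : ℝ≥0}
    (hc₀ : 0 < c₀) (hκ : 0 < κ) (hδ : 0 < δ) (hg : 8 + 4 * κ < g) (hm : 0 < m)
    (hd : ∀ n i, 0 < (M n).d i) (hdstar : Tendsto (fun n => (M n).dstar) atTop atTop)
    (hU : IsOpen U) (hbox : ∀ n, (M n).box σ δ ⊆ U)
    (hl : ∀ n y, ContDiffOn ℝ 4 (fun θ => (M n).l θ y) U)
    (hη : ∀ n, ContDiffOn ℝ 3 (η n) U) (hK : SmoothBound M σ δ η K)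
    (hησstar : ∀ n, |η n σstar| ≤ Kstar * (M n).dstar ^ κ)
    (hXm : ∀ n, Measurable ((M n).envelope σ δ))
    (hKX : ∀ n, ∫⁻ ω, (M n).envelope σ δ ((M n).Y ω) ^ g ∂((M n).P σ) ≤ KX)
    (hneg : ∀ᶠ n in atTop, IsNegDefBy m ((M n).Q σ)) (hsymm : ∀ n, ((M n).A σ).IsSymm)
    (hexp : ∀ n, (M n).ExpectationsExist σ)
    (htame : Tame M σ fun n θ => (M n).dstar ^ 2 * (M n).bias (η n) θ)
    {σhat : ∀ n, (M n).𝒴 → Param s} (hroot : IsScoreRoot M Θ σ g σhat)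
    (hmeas : ∀ n, Measurable ((M n).etaHat (η n) c₀ κ σstar (σhat n))) :
    (fun n => (M n).expect σ ((M n).etaHat (η n) c₀ κ σstar (σhat n)) - η n σ)
      =o[atTop] fun n => (M n).dstar ^ (-2 : ℝ) := by
  have hm' : 0 ≤ 1 / m := by positivity
  obtain ⟨ε, hε, C₁, hC₁, Hη⟩ := exists_eta_expansion.{u, v} s hm' hK.nonneg
  obtain ⟨C₃, hC₃, Hlead⟩ := exists_abs_leading_le.{u, v} s hm' hK.nonneg
  obtain ⟨⟨L, hL⟩, hcont⟩ := htame
  obtain ⟨ℬ, c, hℬ⟩ := hroot.2 (1 / 2) (by norm_num) (by norm_num)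
  set ε' : ℝ := ε / (1 + s) ^ 2 with hε'
  have hε'0 : 0 < ε' := by positivity
  set C₂ : ℝ := c₀ + |Kstar| + K + |L| with hC₂
  set C₅ : ℝ := |c| + KX * ε' ^ (-g) with hC₅
  rw [isLittleO_iff]
  intro e₀ he₀
  obtain ⟨δ₁, hδ₁, hcont⟩ := hcont (e₀ / 2) (half_pos he₀)
  have hsmall : ∀ r > 0, ∀ᶠ n in atTop, (M n).dstar ^ (-(1 / 2) : ℝ) ≤ r := fun r hr => by
    have := tendsto_dstar_rpow_neg hdstar (r := -(1 / 2)) (by norm_num) 1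
    simp only [one_mul] at this
    exact (this.eventually (gt_mem_nhds hr)).mono fun n hn => hn.le
  have hlim : ∀ᶠ n in atTop, C₁ * KX * (M n).dstar ^ (-1 : ℝ)
      + C₃ * KX * (M n).dstar ^ (1 + (3 - g) / 4) + e₀ / 2 +
      C₂ * C₅ * (M n).dstar ^ (κ + 2 - g / 4) + C₃ * C₅ * (M n).dstar ^ (7 / 4 - g / 4) ≤ e₀ := by
    have t1 := tendsto_dstar_rpow_neg hdstar (r := -1) (by norm_num) (C₁ * KX)
    have t2 := tendsto_dstar_rpow_neg hdstar (r := 1 + (3 - g) / 4) (by linarith) (C₃ * KX)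
    have t3 := tendsto_dstar_rpow_neg hdstar (r := κ + 2 - g / 4) (by linarith) (C₂ * C₅)
    have t4 := tendsto_dstar_rpow_neg hdstar (r := 7 / 4 - g / 4) (by linarith) (C₃ * C₅)
    have t := (((t1.add t2).add_const (e₀ / 2)).add t3).add t4
    simp only [add_zero, zero_add] at t
    exact (t.eventually (gt_mem_nhds (half_lt_self he₀))).mono fun n hn => hn.le
  have hbig : ∀ᶠ n in atTop, K + (|L| + e₀ / 2) ≤ c₀ * (M n).dstar ^ κ :=
    (((tendsto_rpow_atTop hκ).comp hdstar).const_mul_atTop hc₀).eventually_ge_atTop _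
  filter_upwards [hℬ, hL, hcont, hneg, hlim, hbig, hsmall δ hδ, hsmall δ₁ hδ₁,
    hdstar.eventually_ge_atTop 1] with n hℬ hL hcont hneg hlim hbig hsδ hsδ₁ hd1
  obtain ⟨hℬ1, hℬ2⟩ := hℬ
  set E := M n
  set d := E.dstar with hddef
  have hd0 : 0 < d := by linarith
  have hdn := hd n
  have hQ : IsUnit (E.Q σ).det := hneg.isUnit_det hm
  have hW := hneg.abs_inv_apply_le hm
  have hA := E.isUnit_A_det hQ
  have hσδ : σ ∈ E.box σ δ := E.self_mem_box hdn hδ.le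
  have hL' : |E.bias (η n) σ| ≤ |L| / d ^ 2 := by
    rw [le_div_iff₀ (by positivity)]
    have e : |E.bias (η n) σ| * d ^ 2 = |d ^ 2 * E.bias (η n) σ| := by
      rw [abs_mul, abs_of_pos (by positivity : 0 < d ^ 2), mul_comm]
    rw [e]
    exact hL.trans (le_abs_self L)
  have hd2 : 1 ≤ d ^ 2 := one_le_pow₀ hd1
  have hL1 : |E.bias (η n) σ| ≤ |L| := hL'.trans (div_le_self (abs_nonneg _) hd2)
  have hdκ : 1 ≤ d ^ κ := Real.one_le_rpow hd1 hκ.le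
  set X : E.Ω → ℝ≥0∞ := fun ω => E.envelope σ δ (E.Y ω) with hXdef
  have hXmeas : Measurable X := (hXm n).comp E.measurable_Y
  have hgpos : 0 < g := by linarith
  set μ := E.P σ with hμ
  set N : Set E.Ω := toMeasurable μ (ℬ n)ᶜ ∪ {ω | ENNReal.ofReal (ε' * d ^ (1 / 2 : ℝ)) ≤ X ω}
    with hNdef
  have hNmeas : MeasurableSet N :=
    (measurableSet_toMeasurable _ _).union (measurableSet_le measurable_const hXmeas)
  have hdh : 0 < d ^ (1 / 2 : ℝ) := Real.rpow_pos_of_pos hd0 _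
  have hdg : 0 < d ^ (-(g / 4)) := Real.rpow_pos_of_pos hd0 _
  have hC₅0 : 0 ≤ C₅ := by positivity
  have hPN : μ.real N ≤ C₅ * d ^ (-(g / 4)) := by
    have h1 : μ N ≤ ENNReal.ofReal (|c| * d ^ (-(g / 4))) +
        ENNReal.ofReal (KX * ε' ^ (-g) * d ^ (-(g / 4))) := by
      refine (measure_union_le _ _).trans (add_le_add ?_ ?_)
      · rw [measure_toMeasurable]
        refine hℬ2.trans (ENNReal.ofReal_le_ofReal ?_)
        have : -(min (1 / 4 : ℝ) (1 - 1 / 2) * g) = -(g / 4) := by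
          rw [min_eq_left (by norm_num)]; ring
        rw [this]
        exact mul_le_mul_of_nonneg_right (le_abs_self c) hdg.le
      · refine (meas_ge_le_of_lintegral_rpow_le hXmeas hgpos (hKX n)
          (mul_pos hε'0 hdh)).trans (ENNReal.ofReal_le_ofReal ?_)
        rw [Real.mul_rpow hε'0.le hdh.le, ← Real.rpow_mul hd0.le, mul_assoc]
        gcongr
        linarith
    rw [← ENNReal.ofReal_add (by positivity) (by positivity), ← add_mul] at h1
    exact ENNReal.toReal_le_of_le_ofReal (by positivity) h1
  obtain ⟨hZ1, hZ2⟩ := E.expect_leading hdn hA (hexp n) (η n)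
  have hH := E.hasExpect_etaHat σ (η n) hc₀ hd0.le σstar (σhat n) (hησstar n) (hmeas n)
  set ψ : E.Ω → ℝ := fun ω => (E.etaHat (η n) c₀ κ σstar (σhat n) (E.Y ω) - η n σ) -
    (E.leading (η n) σ (E.Y ω) - E.bias (η n) σ) with hψ
  have hint : ∫ ω, ψ ω ∂μ = E.expect σ (E.etaHat (η n) c₀ κ σstar (σhat n)) - η n σ := by
    have i1 : Integrable (fun ω => E.etaHat (η n) c₀ κ σstar (σhat n) (E.Y ω)) μ := hH
    have i2 : Integrable (fun ω => E.leading (η n) σ (E.Y ω)) μ := hZ1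
    have i3 : ∫ ω, E.leading (η n) σ (E.Y ω) ∂μ = E.bias (η n) σ := hZ2
    have i4 : ∫ ω, (E.etaHat (η n) c₀ κ σstar (σhat n) (E.Y ω) - η n σ) ∂μ =
        E.expect σ (E.etaHat (η n) c₀ κ σstar (σhat n)) - η n σ := by
      rw [integral_sub i1 (integrable_const _)]
      simp [Experiment.expect, hμ]
    have i5 : ∫ ω, (E.leading (η n) σ (E.Y ω) - E.bias (η n) σ) ∂μ = 0 := by
      rw [integral_sub i2 (integrable_const _), i3]
      simp
    calc ∫ ω, ψ ω ∂μ = _ :=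
          integral_sub (i1.sub (integrable_const _)) (i2.sub (integrable_const _))
      _ = _ := by
          rw [i4, i5, sub_zero]
  have hdom : ∀ ω, X ω ≠ ∞ → E.Dominates σ δ (E.Y ω) (X ω).toReal := fun ω hω =>
    E.dominates_envelope hdn hd0 hω
  have hsplit := abs_integral_le_of_split (μ := μ) (N := N) (ψ := ψ) (t := d ^ (1 / 4 : ℝ))
    (a₁ := C₁ / d ^ 3) (a₂ := e₀ / 2 / d ^ 2) (b₁ := C₂ * d ^ κ) (b₂ := C₃ / d)
    hXmeas (fun ω => E.one_le_envelope σ δ _) (by linarith) (hKX n) hNmeas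
    (by positivity) (by positivity) (by positivity) (Real.rpow_pos_of_pos hd0 _) ?_ ?_
  · rw [hint] at hsplit
    rw [Real.norm_eq_abs, Real.norm_eq_abs, abs_of_pos (Real.rpow_pos_of_pos hd0 _)]
    have hb1 : 0 ≤ C₂ * d ^ κ + C₃ / d * (d ^ (1 / 4 : ℝ)) ^ 3 := by
      have := hK.nonneg
      positivity
    refine hsplit.trans ((add_le_add_right (mul_le_mul_of_nonneg_left hPN hb1) _).trans ?_)
    rw [split_bound_eq hd0, mul_comm]
    exact mul_le_mul_of_nonneg_right hlim (Real.rpow_pos_of_pos hd0 _).le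
  · -- off the exceptional set
    intro ω hω hωN
    rw [hNdef, Set.mem_union, not_or] at hωN
    have hωB : ω ∈ ℬ n := by
      by_contra h
      exact hωN.1 (subset_toMeasurable _ _ h)
    have hxlt : (X ω).toReal ≤ ε' * d ^ (1 / 2 : ℝ) := by
      have h1 : X ω < ENNReal.ofReal (ε' * d ^ (1 / 2 : ℝ)) := not_le.1 hωN.2
      exact ENNReal.toReal_le_of_le_ofReal (by positivity) h1.le
    obtain ⟨_, hr2, hr3⟩ := hℬ1 ω hωB
    set θ := σhat n (E.Y ω) with hθdef
    have hdom' := hdom ω hω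
    set x := (X ω).toReal
    have hx1 := hdom'.one_le
    have hdev : ∀ i, |E.ndev σ θ i| ≤ d ^ (1 / 2 : ℝ) := fun i => by
      refine (abs_apply_le_vecNorm (E.ndev σ θ) i).trans ?_
      have : (1 : ℝ) - 1 / 2 = 1 / 2 := by norm_num
      rw [this] at hr3
      exact hr3.le
    have hdev' : θ ∈ E.box σ (d ^ (-(1 / 2) : ℝ)) := by
      refine E.mem_box_of_ndev_le hdn fun i => (hdev i).trans (le_of_eq ?_)
      have : d ^ (-(1 / 2) : ℝ) * d = d ^ (-(1 / 2) : ℝ) * d ^ (1 : ℝ) := by rw [Real.rpow_one]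
      rw [← hddef, this, ← Real.rpow_add hd0]
      norm_num
    have hθδ := E.box_mono hdn hsδ hdev'
    have hθδ₁ := E.box_mono hdn hsδ₁ hdev'
    have hNle : ∑ j, |E.ndev σ θ j| ≤ s * d ^ (1 / 2 : ℝ) :=
      (Finset.sum_le_sum fun j _ => hdev j).trans (by simp)
    have hN0 : 0 ≤ ∑ j, |E.ndev σ θ j| := Finset.sum_nonneg fun _ _ => abs_nonneg _
    obtain ⟨s1, s2⟩ := small_of_le_half_power hε hd1 (by linarith) hxlt hN0 hNle
    have hexpand := Hη E σ θ δ U (E.Y ω) x (η n) hdn hd1 hδ.le hU (hbox n) (hl n _) (hη n) hdom'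
      hθδ hr2 hQ hW (hsymm n) (fun i => hK.one_le i n σ hσδ) (fun i j => hK.two_le i j n σ hσδ)
      (fun i j k τ hτ => hK.three_le i j k n τ hτ) s1 s2
    have hb := hcont θ hθδ₁
    have hbias : |E.bias (η n) θ - E.bias (η n) σ| ≤ e₀ / 2 / d ^ 2 := by
      rw [le_div_iff₀ (by positivity)]
      have e : |E.bias (η n) θ - E.bias (η n) σ| * d ^ 2 =
          |d ^ 2 * E.bias (η n) θ - d ^ 2 * E.bias (η n) σ| := by
        rw [← mul_sub, abs_mul, abs_of_pos (by positivity : 0 < d ^ 2), mul_comm]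
      rw [e]
      exact hb
    have hcorr : E.corrected (η n) θ = η n θ - E.bias (η n) θ := rfl
    have htrunc : |E.corrected (η n) θ| ≤ c₀ * d ^ κ := by
      refine le_trans ?_ hbig
      have h1 := hK.zero_le n θ hθδ
      have h2 : e₀ / 2 / d ^ 2 ≤ e₀ / 2 := div_le_self (half_pos he₀).le hd2
      rw [hcorr]
      rw [abs_le] at hbias h1 hL1 ⊢
      constructor <;> linarith [hbias.1, hbias.2, h1.1, h1.2, hL1.1, hL1.2]
    have hval : E.etaHat (η n) c₀ κ σstar (σhat n) (E.Y ω) = η n θ - E.bias (η n) θ := by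
      unfold Experiment.etaHat
      rw [if_pos htrunc, hcorr]
    simp only [hψ, hval]
    have e5 : C₁ / d ^ 3 * x ^ 6 = C₁ * (x ^ 6 / d ^ 3) := by ring
    rw [e5]
    rw [abs_le] at hexpand hbias ⊢
    constructor <;> linarith [hexpand.1, hexpand.2, hbias.1, hbias.2]
  · -- on the exceptional set
    intro ω hω _
    have hlead := Hlead E σ δ (E.Y ω) _ (η n) hdn hd1 hδ.le (hdom ω hω) hQ hW (hsymm n)
      (fun i => hK.one_le i n σ hσδ) (fun i j => hK.two_le i j n σ hσδ)
    have h1 := E.abs_etaHat_le (η n) hc₀ hd0.le σstar (σhat n) (hησstar n) (E.Y ω)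
    have h2 := hK.zero_le n σ hσδ
    have e5 : C₃ / d * (X ω).toReal ^ 3 = C₃ * ((X ω).toReal ^ 3 / d) := by ring
    have e6 : K ≤ K * d ^ κ := le_mul_of_one_le_right hK.nonneg hdκ
    have e7 : |L| ≤ |L| * d ^ κ := le_mul_of_one_le_right (abs_nonneg _) hdκ
    have e8 : C₂ * d ^ κ = (c₀ + |Kstar|) * d ^ κ + K * d ^ κ + |L| * d ^ κ := by
      rw [hC₂]; ring
    rw [e5, e8]
    simp only [hψ]
    rw [abs_le] at hlead h1 h2 hL1 ⊢
    constructor <;> linarith [hlead.1, hlead.2, h1.1, h1.2, h2.1, h2.2, hL1.1, hL1.2]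

end MainExpansion

section Existence

variable {s : ℕ}

/-- Near `σ` the normalized Hessian of the criterion function is negative definite. -/
theorem Experiment.isNegDefBy_hessian {M : Experiment.{u, v} s} {σ : Param s} {δ r m x ε : ℝ}
    {U : Set (Param s)} {y : M.𝒴} (hd : ∀ i, 0 < M.d i) (hd' : 0 < M.dstar)
    (hr : 0 ≤ r) (hrδ : r ≤ δ) (hU : IsOpen U) (hbox : M.box σ δ ⊆ U)
    (hl : ∀ y, ContDiffOn ℝ 4 (fun τ => M.l τ y) U) (hdom : M.Dominates σ δ y x)
    (hneg : IsNegDefBy m (M.Q σ)) (hε : s * ((s + 1) * ε) ≤ m / 2) (hrx : r * x ≤ ε)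
    (hxd : x ≤ ε * M.dstar) {θ : Param s} (hθ : θ ∈ M.box σ r) :
    IsNegDefBy (m / 2) (Matrix.of fun i j => M.F θ y i j / (M.d i * M.d j)) := by
  refine hneg.of_close (ε := (s + 1) * ε) (fun i j => ?_) hε
  have hi := hd i; have hj := hd j
  have hx0 : 0 ≤ x := by linarith [hdom.one_le]
  have hseg : ∀ t ∈ Set.Icc (0 : ℝ) 1, σ + t • (θ - σ) ∈ M.box σ δ := fun t ht =>
    M.box_mono hd hrδ (M.segment_mem_box (M.self_mem_box hd hr) hθ ht)
  have h1 := taylor_one_abs_le hU ((M.contDiffOn_F hU hl i j y).differentiableOn (by norm_num))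
    σ (θ - σ) (fun t ht => hbox (hseg t ht)) (C := s * (r * x * (M.d i * M.d j))) fun t ht => by
      refine (Finset.abs_sum_le_sum_abs _ _).trans ?_
      refine (Finset.sum_le_sum (g := fun _ => r * x * (M.d i * M.d j)) fun k _ => ?_).trans
        (by simp)
      have hk := hd k
      have h2 := hdom.l3_le k i j _ (hseg t ht)
      have h3 : |(θ - σ) k| ≤ r * M.dstar / M.d k := hθ k
      rw [abs_mul]
      calc _ ≤ r * M.dstar / M.d k * (x * (M.d k * M.d i * M.d j / M.dstar)) :=
            mul_le_mul h3 h2 (abs_nonneg _) (by positivity)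
        _ = _ := by field_simp
  rw [add_sub_cancel] at h1
  have h2 := hdom.nhess_le hd hd' i j
  have e : (Matrix.of fun i j => M.F θ y i j / (M.d i * M.d j)) i j - M.Q σ i j =
      (M.F θ y i j - M.F σ y i j) / (M.d i * M.d j) + M.nhess σ y i j := by
    rw [M.Q_apply hd]
    simp only [Matrix.of_apply, Experiment.nhess]
    ring
  rw [e]
  have h3 : |(M.F θ y i j - M.F σ y i j) / (M.d i * M.d j)| ≤ s * ε := by
    rw [abs_div, abs_of_pos (mul_pos hi hj), div_le_iff₀ (mul_pos hi hj)]
    calc _ ≤ (s : ℝ) * (r * x * (M.d i * M.d j)) := h1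
      _ = s * (r * x) * (M.d i * M.d j) := by ring
      _ ≤ s * ε * (M.d i * M.d j) := by gcongr
  have h4 : x / M.dstar ≤ ε := by rwa [div_le_iff₀ hd']
  refine (abs_add_le _ _).trans ?_
  linarith

theorem Experiment.l_le_quadratic {M : Experiment.{u, v} s} {σ : Param s} {r m : ℝ}
    {U : Set (Param s)} {y : M.𝒴} (hd : ∀ i, 0 < M.d i) (hU : IsOpen U) (hbox : M.box σ r ⊆ U)
    (hl : ContDiffOn ℝ 4 (fun τ => M.l τ y) U)
    (hneg : ∀ θ ∈ M.box σ r,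
      IsNegDefBy m (Matrix.of fun i j => M.F θ y i j / (M.d i * M.d j)))
    {θ₁ θ₂ : Param s} (h₁ : θ₁ ∈ M.box σ r) (h₂ : θ₂ ∈ M.box σ r) :
    M.l θ₂ y ≤ M.l θ₁ y + ∑ i, (θ₂ - θ₁) i * M.a θ₁ y i
      - m * (∑ i, (M.ndev θ₁ θ₂ i) ^ 2) / 2 := by
  have hseg : ∀ t ∈ Set.Icc (0 : ℝ) 1, θ₁ + t • (θ₂ - θ₁) ∈ M.box σ r := fun t ht =>
    M.segment_mem_box h₁ h₂ ht
  have := le_of_dirDeriv₂_le hU (hl.of_le (by norm_num)) θ₁ (θ₂ - θ₁)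
    (fun t ht => hbox (hseg t ht)) (m := m * ∑ i, (M.ndev θ₁ θ₂ i) ^ 2) fun t ht => by
      have h := hneg _ (hseg t ht) (M.ndev θ₁ θ₂)
      rw [neg_mul] at h
      refine le_trans (le_of_eq ?_) h
      simp only [dotProduct, Matrix.mulVec, Finset.mul_sum, Matrix.of_apply]
      refine Finset.sum_congr rfl fun i _ => Finset.sum_congr rfl fun j _ => ?_
      rw [pderiv_comm hU (hl.of_le (by norm_num)) j i (hbox (hseg t ht))]
      have := (hd i).ne'; have := (hd j).ne'
      simp only [Experiment.ndev, Experiment.F, hessMat, Matrix.of_apply, PiLp.sub_apply]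
      field_simp
  rw [add_sub_cancel] at this
  exact this

theorem Experiment.box_mem_nhds {M : Experiment.{u, v} s} {σ θ : Param s} {r : ℝ}
    (h : ∀ i, |θ i - σ i| < r * M.dstar / M.d i) : M.box σ r ∈ 𝓝 θ := by
  have : ∀ i, ∀ᶠ τ : Param s in 𝓝 θ, |τ i - σ i| < r * M.dstar / M.d i := fun i => by
    have hc : Continuous fun τ : Param s => |τ i - σ i| := by fun_prop
    exact hc.continuousAt.eventually (gt_mem_nhds (h i))
  filter_upwards [eventually_all.2 this] with τ hτ i
  exact (hτ i).le

/-- The criterion function has a unique maximizer in a small box around `σ`; it is a root of the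
score equation and its distance to `σ` is controlled by the dominating value. -/
theorem Experiment.exists_unique_maximizer {M : Experiment.{u, v} s} {σ : Param s}
    {δ r m x ε : ℝ} {U : Set (Param s)} {y : M.𝒴} (hm : 0 < m) (hd : ∀ i, 0 < M.d i)
    (hd' : 0 < M.dstar) (hr : 0 ≤ r) (hrδ : r ≤ δ) (hU : IsOpen U)
    (hbox : M.box σ δ ⊆ U) (hl : ∀ y, ContDiffOn ℝ 4 (fun τ => M.l τ y) U)
    (hdom : M.Dominates σ δ y x) (hneg : IsNegDefBy m (M.Q σ))
    (hε : s * ((s + 1) * ε) ≤ m / 2) (hrx : r * x ≤ ε) (hxd : x ≤ ε * M.dstar)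
    (hint : 4 * s / m * x < r * M.dstar) :
    ∃ θ ∈ M.box σ r, (∀ θ' ∈ M.box σ r, M.l θ' y ≤ M.l θ y) ∧
      (∀ θ' ∈ M.box σ r, M.l θ y ≤ M.l θ' y → θ' = θ) ∧ M.a θ y = 0 ∧
      ∑ i, |M.ndev σ θ i| ≤ 4 * s / m * x := by
  have hσr : σ ∈ M.box σ r := M.self_mem_box hd hr
  have hboxr : M.box σ r ⊆ U := (M.box_mono hd hrδ).trans hbox
  have hx0 : 0 ≤ x := by linarith [hdom.one_le]
  have hnd : ∀ θ ∈ M.box σ r, IsNegDefBy (m / 2)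
      (Matrix.of fun i j => M.F θ y i j / (M.d i * M.d j)) := fun θ hθ =>
    M.isNegDefBy_hessian hd hd' hr hrδ hU hbox hl hdom hneg hε hrx hxd hθ
  obtain ⟨θ, hθ, hmax⟩ := (M.isCompact_box σ r).exists_isMaxOn ⟨σ, hσr⟩
    ((hl y).continuousOn.mono hboxr)
  have hmax' : ∀ θ' ∈ M.box σ r, M.l θ' y ≤ M.l θ y := fun θ' h => hmax h
  set N := ∑ i, |M.ndev σ θ i| with hN
  have hN0 : 0 ≤ N := Finset.sum_nonneg fun _ _ => abs_nonneg _
  have hNle : N ≤ 4 * s / m * x := by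
    have h1 := M.l_le_quadratic hd hU hboxr (hl y) hnd hσr hθ
    have h2 := hmax' σ hσr
    have h3 : ∑ i, (θ - σ) i * M.a σ y i ≤ x * N := by
      have e : ∑ i, (θ - σ) i * M.a σ y i = ∑ i, M.nscore σ y i * M.ndev σ θ i := by
        refine Finset.sum_congr rfl fun i _ => ?_
        have := (hd i).ne'
        simp only [Experiment.nscore, Experiment.ndev, PiLp.sub_apply]
        field_simp
      rw [e]
      exact (le_abs_self _).trans (abs_sum_mul_le (hdom.nscore_le hd))
    have h4 : N ^ 2 ≤ s * ∑ i, M.ndev σ θ i ^ 2 := by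
      have := sq_sum_le_card_mul_sum_sq (s := Finset.univ) (f := fun i => |M.ndev σ θ i|)
      simpa using this
    have hs0 : (0 : ℝ) ≤ s := Nat.cast_nonneg s
    have h5 : m * (∑ i, M.ndev σ θ i ^ 2) ≤ 4 * (x * N) := by linarith
    have h6 : m * N ^ 2 ≤ 4 * s * x * N := by
      calc m * N ^ 2 ≤ m * (s * ∑ i, M.ndev σ θ i ^ 2) := by gcongr
        _ = s * (m * ∑ i, M.ndev σ θ i ^ 2) := by ring
        _ ≤ s * (4 * (x * N)) := by gcongr
        _ = _ := by ring
    rcases hN0.eq_or_lt with h0 | h0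
    · rw [← h0]; positivity
    · have h7 : m * N ≤ 4 * s * x := by
        refine le_of_mul_le_mul_right ?_ h0
        linarith
      rw [div_mul_eq_mul_div, le_div_iff₀ hm]
      linarith
  have ha : M.a θ y = 0 := by
    have hnhds : M.box σ r ∈ 𝓝 θ := M.box_mem_nhds fun i => by
      rw [lt_div_iff₀ (hd i)]
      have h1 : |M.ndev σ θ i| ≤ N :=
        Finset.single_le_sum (f := fun i => |M.ndev σ θ i|) (fun _ _ => abs_nonneg _)
          (Finset.mem_univ i)
      rw [Experiment.ndev, abs_mul, abs_of_pos (hd i), mul_comm] at h1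
      exact (h1.trans hNle).trans_lt hint
    have hloc : IsLocalMax (fun τ => M.l τ y) θ :=
      Filter.mem_of_superset hnhds fun τ hτ => hmax' τ hτ
    funext i
    change fderiv ℝ (fun τ => M.l τ y) θ _ = 0
    rw [hloc.fderiv_eq_zero]
    simp
  refine ⟨θ, hθ, hmax', fun θ' hθ' hle => ?_, ha, hNle⟩
  have h1 := M.l_le_quadratic hd hU hboxr (hl y) hnd hθ hθ'
  rw [ha] at h1
  simp only [Pi.zero_apply, mul_zero, Finset.sum_const_zero, add_zero] at h1
  have h2 : m / 2 * ∑ i, M.ndev θ θ' i ^ 2 ≤ 0 := by linarith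
  have h3 : ∑ i, M.ndev θ θ' i ^ 2 = 0 := by
    refine le_antisymm ?_ (Finset.sum_nonneg fun _ _ => sq_nonneg _)
    by_contra! hpos
    have : 0 < m / 2 * ∑ i, M.ndev θ θ' i ^ 2 := by positivity
    linarith
  ext i
  have h4 := (Finset.sum_eq_zero_iff_of_nonneg fun _ _ => sq_nonneg _).1 h3 i (Finset.mem_univ i)
  have h5 : M.d i * (θ' i - θ i) = 0 := by simpa [Experiment.ndev] using h4
  have h6 : θ' i - θ i = 0 := (mul_eq_zero.1 h5).resolve_left (hd i).ne'
  linarith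

/-- A consistent measurable root of the score equation exists. -/
theorem exists_isScoreRoot {M : ℕ → Experiment.{u, v} s} {Θ U : Set (Param s)} {σ : Param s}
    {g δ m : ℝ} {KX : ℝ≥0} (hδ : 0 < δ) (hg : 0 < g) (hm : 0 < m)
    (hd : ∀ n i, 0 < (M n).d i) (hdstar : Tendsto (fun n => (M n).dstar) atTop atTop)
    (hU : IsOpen U) (hUΘ : U ⊆ Θ) (hbox : ∀ n, (M n).box σ δ ⊆ U)
    (hlm : ∀ n, ∀ θ ∈ U, Measurable ((M n).l θ))
    (hl : ∀ n y, ContDiffOn ℝ 4 (fun θ => (M n).l θ y) U)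
    (hXm : ∀ n, Measurable ((M n).envelope σ δ))
    (hKX : ∀ n, ∫⁻ ω, (M n).envelope σ δ ((M n).Y ω) ^ g ∂((M n).P σ) ≤ KX)
    (hneg : ∀ᶠ n in atTop, IsNegDefBy m ((M n).Q σ)) :
    ∃ σhat : ∀ n, (M n).𝒴 → Param s, IsScoreRoot M Θ σ g σhat := by
  set r : ℕ → ℝ := fun n => min δ ((M n).dstar ^ (-(1 / 4) : ℝ)) with hrdef
  have hd0 : ∀ n, 0 ≤ (M n).dstar := fun n => (M n).dstar_nonneg (hd n)
  have hr0 : ∀ n, 0 ≤ r n := fun n => le_min hδ.le (Real.rpow_nonneg (hd0 n) _)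
  have hboxr : ∀ n, (M n).box σ (r n) ⊆ U := fun n =>
    ((M n).box_mono (hd n) (min_le_left _ _)).trans (hbox n)
  have hsel := fun n => exists_measurable_unique_maximizer ((M n).isCompact_box σ (r n))
    ⟨σ, (M n).self_mem_box (hd n) (hr0 n)⟩ (F := (M n).l) (fun θ hθ => hlm n θ (hboxr n hθ))
    (fun y => (hl n y).continuousOn.mono (hboxr n))
  choose σhat hσm hσhat using hsel
  refine ⟨σhat, hσm, fun ρ hρ0 hρ1 => ?_⟩
  set τ : ℝ := min (1 / 4) (1 - ρ) with hτ
  set ε : ℝ := m / (4 * (s + 1) ^ 2) with hε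
  have hs0 : (0 : ℝ) ≤ s := Nat.cast_nonneg s
  have hε0 : 0 < ε := by positivity
  have hεs : (4 * (s + 1) ^ 2) * ε = m := by rw [hε]; field_simp
  refine ⟨fun n => {ω | ¬ ENNReal.ofReal (ε * (M n).dstar ^ τ) ≤
    (M n).envelope σ δ ((M n).Y ω)}, KX * ε ^ (-g), ?_⟩
  have hsmall : ∀ᶠ n in atTop, (M n).dstar ^ (-(1 / 4) : ℝ) ≤ δ := by
    have := tendsto_dstar_rpow_neg hdstar (r := -(1 / 4)) (by norm_num) 1
    simp only [one_mul] at this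
    exact (this.eventually (gt_mem_nhds hδ)).mono fun n hn => hn.le
  filter_upwards [hneg, hsmall, hdstar.eventually_ge_atTop 1] with n hneg hrδ hd1
  have hdpos : 0 < (M n).dstar := by linarith
  have hdτ : 0 < (M n).dstar ^ τ := Real.rpow_pos_of_pos hdpos _
  refine ⟨fun ω hω => ?_, ?_⟩
  · have hlt : (M n).envelope σ δ ((M n).Y ω) < ENNReal.ofReal (ε * (M n).dstar ^ τ) :=
      not_le.1 hω
    have hdom := (M n).dominates_envelope (hd n) hdpos (hlt.trans ENNReal.ofReal_lt_top).ne
    have hxle := ENNReal.toReal_le_of_le_ofReal (by positivity) hlt.le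
    set x := ((M n).envelope σ δ ((M n).Y ω)).toReal
    set d := (M n).dstar
    have hx0 : 0 ≤ x := by linarith [hdom.one_le]
    have hr : r n = d ^ (-(1 / 4) : ℝ) := min_eq_right hrδ
    have hτ4 : d ^ τ ≤ d ^ (1 / 4 : ℝ) :=
      Real.rpow_le_rpow_of_exponent_le hd1 (min_le_left _ _)
    have hx4 : x ≤ ε * d ^ (1 / 4 : ℝ) := hxle.trans (by gcongr)
    have hd34 : d ^ (1 / 4 : ℝ) ≤ d ^ (3 / 4 : ℝ) :=
      Real.rpow_le_rpow_of_exponent_le hd1 (by norm_num)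
    have hrd : r n * d = d ^ (3 / 4 : ℝ) := by
      have : d ^ (-(1 / 4) : ℝ) * d = d ^ (-(1 / 4) : ℝ) * d ^ (1 : ℝ) := by rw [Real.rpow_one]
      rw [hr, this, ← Real.rpow_add hdpos]
      norm_num
    have hd4 : d ^ (1 / 4 : ℝ) ≤ d := by
      conv_rhs => rw [← Real.rpow_one d]
      exact Real.rpow_le_rpow_of_exponent_le hd1 (by norm_num)
    have hratio : 4 * s / m * ε < 1 := by
      rw [div_mul_eq_mul_div, div_lt_one hm]
      nlinarith
    have hNlt : 4 * s / m * x < d ^ τ := by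
      calc 4 * s / m * x ≤ 4 * s / m * (ε * d ^ τ) := by gcongr
        _ = 4 * s / m * ε * d ^ τ := by ring
        _ < 1 * d ^ τ := by gcongr
        _ = d ^ τ := one_mul _
    obtain ⟨θ, hθ, hmax, huniq, ha, hN⟩ := (M n).exists_unique_maximizer (r := r n) (ε := ε)
      (y := (M n).Y ω) hm (hd n) hdpos (hr0 n) (min_le_left _ _) hU (hbox n) (hl n) hdom hneg
      (by nlinarith)
      (by
        rw [hr]
        calc d ^ (-(1 / 4) : ℝ) * x ≤ d ^ (-(1 / 4) : ℝ) * (ε * d ^ (1 / 4 : ℝ)) := by gcongr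
          _ = ε * (d ^ (-(1 / 4) : ℝ) * d ^ (1 / 4 : ℝ)) := by ring
          _ = ε := by rw [← Real.rpow_add hdpos]; norm_num)
      (hx4.trans (by gcongr))
      (by
        change 4 * s / m * x < r n * d
        rw [hrd]
        linarith)
    have heq : σhat n ((M n).Y ω) = θ := hσhat n _ θ hθ hmax huniq
    rw [heq]
    refine ⟨hUΘ (hboxr n hθ), ha, ?_⟩
    refine (vecNorm_le_sum_abs ((M n).ndev σ θ)).trans_lt ((hN.trans_lt hNlt).trans_le ?_)
    exact Real.rpow_le_rpow_of_exponent_le hd1 (min_le_right _ _)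
  · have hcompl : {ω | ¬ ENNReal.ofReal (ε * (M n).dstar ^ τ) ≤
        (M n).envelope σ δ ((M n).Y ω)}ᶜ = {ω | ENNReal.ofReal (ε * (M n).dstar ^ τ) ≤
        (M n).envelope σ δ ((M n).Y ω)} := by
      ext ω; simp
    rw [hcompl]
    refine (meas_ge_le_of_lintegral_rpow_le ((hXm n).comp (M n).measurable_Y) hg (hKX n)
      (mul_pos hε0 hdτ)).trans (ENNReal.ofReal_le_ofReal (le_of_eq ?_))
    rw [Real.mul_rpow hε0.le hdτ.le, ← Real.rpow_mul hdpos.le, mul_assoc, mul_neg]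

end Existence

theorem theorem4p1 {s : ℕ} (M : ℕ → Experiment.{u, v} s)
    (Θ : Set (Param s)) (σ σstar : Param s) (η : ℕ → Param s → ℝ)
    (c₀ κ g δ : ℝ) (hc₀ : 0 < c₀) (hκ : 0 < κ) (hδ : 0 < δ)
    -- the true parameter is an interior point, and the neighbourhoods `S_δ(σ)` lie in the interior
    (hσ : σ ∈ interior Θ) (hbox : ∀ n, (M n).box σ δ ⊆ interior Θ)
    -- the fixed point used by the truncation
    (hσstar : σstar ∈ Θ)
    (hησstar : ∃ K : ℝ, ∀ n, |η n σstar| ≤ K * (M n).dstar ^ κ)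
    -- (i) smoothness and boundedness of `η` and of its derivatives
    (hη : ∀ n, ContDiffOn ℝ 3 (η n) (interior Θ))
    (hη0 : ∃ K : ℝ, ∀ n, |η n σ| ≤ K)
    (hη1 : ∃ K : ℝ, ∀ n, vecNorm (gradVec (η n) σ) ≤ K)
    (hη2 : ∃ K : ℝ, ∀ n, specNorm (hessMat (η n) σ) ≤ K)
    (hη3 : ∀ i j k, ∃ K : ℝ, ∀ n, ∀ θ ∈ (M n).box σ δ,
      |pderiv i (pderiv j (pderiv k (η n))) θ| ≤ K)
    -- (ii) the criterion function, the normalizing constants and the moments of the derivatives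
    (hlmeas : ∀ n, ∀ θ ∈ interior Θ, Measurable ((M n).l θ))
    (hl : ∀ n y, ContDiffOn ℝ 4 (fun θ => (M n).l θ y) (interior Θ))
    (hd : ∀ n i, 0 < (M n).d i)
    (hdstar : Tendsto (fun n => (M n).dstar) atTop atTop)
    (hlam_bot : ⊥ < limsup (fun n => ((lambdaMax ((M n).Q σ) : ℝ) : EReal)) atTop)
    (hlam_neg : limsup (fun n => ((lambdaMax ((M n).Q σ) : ℝ) : EReal)) atTop < 0)
    (hg : 8 + 4 * κ < g)
    (hm1 : ∀ i, MomentsBounded M σ g fun n y =>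
      ENNReal.ofReal (|(M n).a σ y i| / (M n).d i))
    (hm2 : ∀ i j, MomentsBounded M σ g fun n y =>
      ENNReal.ofReal (|(M n).F σ y i j - (M n).expect σ fun y' => (M n).F σ y' i j|
        / √((M n).d i * (M n).d j)))
    (hm3 : ∀ i j k, MomentsBounded M σ g fun n y =>
      ENNReal.ofReal ((M n).dstar / ((M n).d i * (M n).d j * (M n).d k)) *
        (M n).supBox σ δ fun θ => (M n).l3 i j k θ y)
    -- (iii) moments of the third and fourth derivatives
    (hm4 : ∀ i j k, MomentsBounded M σ g fun n y =>
      ENNReal.ofReal (|(M n).l3 i j k σ y - (M n).expect σ fun y' => (M n).l3 i j k σ y'|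
        / √((M n).d j * (M n).d k)))
    (hm5 : ∀ i j k, MomentsBounded M σ g fun n y =>
      ENNReal.ofReal (|(M n).l3 i j k σ y| / ((M n).d j * (M n).d k)))
    (hm6 : ∀ i j k m, MomentsBounded M σ g fun n y =>
      ENNReal.ofReal ((M n).dstar ^ 2 / ((M n).d i * (M n).d j * (M n).d k * (M n).d m)) *
        (M n).supBox σ δ fun θ => (M n).l4 i j k m θ y)
    -- the expectations used in (iv), (v) and in the correction terms exist near `σ`
    (hexp : ∀ n, ∀ θ ∈ (M n).box σ δ, (M n).ExpectationsExist θ)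
    -- (iv) continuity of `Q`, `U₁`, `U₂`, `U₃` at `σ`, uniformly in `n`
    (hQ : VanishesUniformly M σ fun n θ => specNorm ((M n).Q θ - (M n).Q σ))
    (hU1 : VanishesUniformly M σ fun n θ => specNorm ((M n).U1 θ - (M n).U1 σ))
    (hU2 : VanishesUniformly M σ fun n θ => ‖(M n).U2 θ - (M n).U2 σ‖)
    (hU3 : VanishesUniformly M σ fun n θ => ‖(M n).U3 θ - (M n).U3 σ‖)
    -- (v) `E(a)` is bounded and continuous at `σ`, uniformly in `n`
    (hEa : ∃ K : ℝ, ∀ n, vecNorm ((M n).Ea σ) ≤ K)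
    (hEa' : VanishesUniformly M σ fun n θ => vecNorm ((M n).Ea θ - (M n).Ea σ)) :
    -- a consistent solution of the score equation exists
    (∃ σhat : ∀ n, (M n).𝒴 → Param s, IsScoreRoot M Θ σ g σhat) ∧
    -- and for each such solution the truncated estimator has the asserted expectation
    ∀ σhat : ∀ n, (M n).𝒴 → Param s, IsScoreRoot M Θ σ g σhat →
      (∀ n, Measurable ((M n).etaHat (η n) c₀ κ σstar (σhat n))) →
      (∀ n, (M n).HasExpect σ ((M n).etaHat (η n) c₀ κ σstar (σhat n))) ∧
      ((fun n => (M n).expect σ ((M n).etaHat (η n) c₀ κ σstar (σhat n)) - η n σ)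
        =o[atTop] fun n => (M n).dstar ^ (-2 : ℝ)) ∧
      -- hence its bias for the mean squared error of an empirical predictor `t(σhat)` of `μ` that
      -- `η(σ)` approximates to second order is of smaller order than `d_*^{-2}`
      ∀ (t : ∀ n, Param s → (M n).𝒴 → ℝ) (μ : ∀ n, (M n).Ω → ℝ),
        (∀ n, MemLp (fun ω => t n (σhat n ((M n).Y ω)) ((M n).Y ω) - μ n ω) 2 ((M n).P σ)) →
        ((fun n => (M n).mse σ (fun y => t n (σhat n y) y) (μ n) - η n σ)
          =o[atTop] fun n => (M n).dstar ^ (-2 : ℝ)) →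
        ((fun n => (M n).expect σ ((M n).etaHat (η n) c₀ κ σstar (σhat n)) -
            (M n).mse σ (fun y => t n (σhat n y) y) (μ n))
          =o[atTop] fun n => (M n).dstar ^ (-2 : ℝ)) := by
  have hU : IsOpen (interior Θ) := isOpen_interior
  have hg3 : 3 ≤ g := by linarith
  have hd0 : ∀ n, 0 ≤ (M n).dstar := fun n => (M n).dstar_nonneg (hd n)
  have hdpos : ∀ᶠ n in atTop, 0 < (M n).dstar := hdstar.eventually_gt_atTop 0
  have hsymm : ∀ n, ((M n).A σ).IsSymm := fun n => (M n).A_isSymm hU hσ (hl n)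
  obtain ⟨hXm, KX, hKX⟩ := exists_envelope_moments (by linarith) hU hσ hbox hlmeas hl
    hm1 hm2 hm3 hm5 hm6
  obtain ⟨m, hm, hneg⟩ := eventually_isNegDefBy_Q hd hsymm hlam_neg
  refine ⟨exists_isScoreRoot hδ (by linarith) hm hd hdstar hU interior_subset hbox hlmeas hl
    hXm hKX hneg, fun σhat hroot hmeas => ?_⟩
  obtain ⟨K, hK⟩ := exists_smoothBound hd hU hδ hbox hη hη0 hη1 hη2 hη3
  obtain ⟨Kstar, hKstar⟩ := hησstar
  obtain ⟨δ₁, hδ₁, hnegbox⟩ := exists_isNegDefBy_Q_box hQ hm hneg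
  have htame : Tame M σ fun n θ => (M n).dstar ^ 2 * (M n).bias (η n) θ := by
    refine tame_bias hd hd0 (lt_min hδ hδ₁) ?_ (hK.tame_grad hd hU hδ hbox hη)
      (hK.tame_hess hd hU hδ hbox hη) (tame_inv_Q hd hQ hm hneg) (fun i => ?_)
      (fun i j => ?_) (fun i j k => ?_) (fun i j k l p => ?_)
    · filter_upwards [hnegbox] with n hn θ hθ
      exact ⟨(M n).isUnit_A_det ((hn θ ((M n).box_mono (hd n) (min_le_right _ _) hθ)).isUnit_det
        (half_pos hm)), hexp n θ ((M n).box_mono (hd n) (min_le_left _ _) hθ)⟩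
    · obtain ⟨K, hK⟩ := hEa
      exact Tame.of_vanishesUniformly
        (Eventually.of_forall fun n => (abs_apply_le_vecNorm _ i).trans (hK n)) hEa'
        fun n θ => abs_apply_le_vecNorm ((M n).Ea θ - (M n).Ea σ) i
    · exact Tame.of_vanishesUniformly
        (hdpos.mono fun n hn => (M n).abs_U1_le (hd n) hn hg3 (hKX n) i j) hU1
        fun n θ => abs_apply_le_specNorm ((M n).U1 θ - (M n).U1 σ) i j
    · exact Tame.of_vanishesUniformly
        (hdpos.mono fun n hn => (M n).abs_U2_le (hd n) hn hg3 (hKX n) i j k) hU2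
        fun n θ => (norm_le_pi_norm (((M n).U2 θ - (M n).U2 σ) i j) k).trans <|
          (norm_le_pi_norm (((M n).U2 θ - (M n).U2 σ) i) j).trans (norm_le_pi_norm _ i)
    · exact Tame.of_vanishesUniformly
        (hdpos.mono fun n hn => (M n).abs_U3_le (hd n) hn hg3 (hKX n) i j k l p) hU3
        fun n θ => (norm_le_pi_norm (((M n).U3 θ - (M n).U3 σ) i j k l) p).trans <|
          (norm_le_pi_norm (((M n).U3 θ - (M n).U3 σ) i j k) l).trans <|
          (norm_le_pi_norm (((M n).U3 θ - (M n).U3 σ) i j) k).trans <|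
          (norm_le_pi_norm (((M n).U3 θ - (M n).U3 σ) i) j).trans (norm_le_pi_norm _ i)
  have hlim := isLittleO_expect_etaHat hc₀ hκ hδ hg hm hd hdstar hU hbox hl hη hK hKstar hXm hKX
    hneg hsymm (fun n => hexp n σ ((M n).self_mem_box (hd n) hδ.le)) htame hroot hmeas
  exact ⟨fun n => (M n).hasExpect_etaHat σ (η n) hc₀ (hd0 n) σstar (σhat n) (hKstar n) (hmeas n),
    hlim, fun t μ _ hmse => (hlim.sub hmse).congr_left fun n => by ring⟩
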